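/- Let $n\ge 2$, let $1<p,q<\infty$ with $\frac1p+\frac1q=1$, let $0<\alpha\le 1$, and let $\beta\in\mathbb R$ satisfy $\beta p>-\alpha$. Let $\Omega\subset\mathbb R^n$ be a bounded H\"older-$\alpha$ domain, that is, a nonempty bounded connected open set such that every point of $\partial\Omega$ has a neighbourhood in which, in suitable Cartesian coordinates $(x',x_n)\in\mathbb R^{n-1}\times\mathbb R$, $\Omega$ is the set $\{x_n<\varphi(x')\}$ for a function $\varphi$ with $|\varphi(x')-\varphi(y')|\le K|x'-y'|^\alpha$. Let $d(x)$ denote the distance from $x$ to $\partial\Omega$, and let $L^q(\Omega,d^{-\beta q})$ be the space of measurable $g:\Omega\to\mathbb R$ with $\int_\Omega |g|^q d^{-\beta q}\,dx<\infty$. Then there are a countably infinite family $\{U_t\}_{t\in\Gamma}$ of open subsets of $\Omega$ and a constant $C$, depending only on $\Omega,n,p,\alpha,\beta$ and not on $g$ below, such that: (i) the $U_t$ cover $\Omega$ up to a set of Lebesgue measure zero, and each $U_t$ intersects only finitely many of the sets $U_s$, $s\in\Gamma$; (ii) one of the $U_t$ is a bounded domain $\Omega_0$ with $C^\infty$ boundary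 and with positive distance to $\partial\Omega$, and each of the others is an open cube (of arbitrary orientation) or an open cube extended by a factor $3/2$ in the direction of one of its edges; (iii) every $g\in L^q(\Omega,d^{-\beta q})$ with $\int_\Omega g=0$ belongs to $L^1(\Omega)$ and has a $\mathcal C$-orthogonal decomposition subordinate to $\{U_t\}_{t\in\Gamma}$, that is, there are functions $g_t\in L^1(\Omega)$, $t\in\Gamma$, with $g=\sum_{t\in\Gamma}g_t$ almost everywhere in $\Omega$, with $g_t=0$ outside $U_t$, and with $\int_{U_t}g_t\,dx=0$ for all $t\in\Gamma$, and these satisfy $$\sum_{t\in\Gamma}\int_{U_t}|g_t(x)|^q\,d(x)^{(1-\alpha-\beta)q}\,dx\le C\int_\Omega |g(x)|^q\,d(x)^{-\beta q}\,dx .$$ -/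

import Mathlib

open MeasureTheory Set
open scoped ENNReal NNReal ContDiff

noncomputable section

/-- Distance from a point to the boundary of `Ω`. -/
def boundaryDist {n : ℕ} (Ω : Set (EuclideanSpace ℝ (Fin n))) (x : EuclideanSpace ℝ (Fin n)) : ℝ :=
  Metric.infDist x (frontier Ω)

/-- Near the point `x₀`, the set `Ω` is a subgraph: in suitable Cartesian coordinates
`(x', xₙ) ∈ ℝⁿ⁻¹ × ℝ` (given by the rigid motion `Φ`, with origin at `x₀`), inside the cylinder
`|x'| < r`, `|xₙ| < h`, the set `Ω` is given by `xₙ < φ x'`. The parameter `P r φ` is the regularity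
that is asked of `φ` on the ball of radius `r` of `ℝⁿ⁻¹`. -/
def IsSubgraphNear {n : ℕ} (P : ℝ → (EuclideanSpace ℝ (Fin (n - 1)) → ℝ) → Prop)
    (Ω : Set (EuclideanSpace ℝ (Fin n))) (x₀ : EuclideanSpace ℝ (Fin n)) : Prop :=
  ∃ (Φ : EuclideanSpace ℝ (Fin n) ≃ᵃⁱ[ℝ] WithLp 2 (EuclideanSpace ℝ (Fin (n - 1)) × ℝ))
    (r h : ℝ) (φ : EuclideanSpace ℝ (Fin (n - 1)) → ℝ),
    0 < r ∧ 0 < h ∧ Φ x₀ = 0 ∧ P r φ ∧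
      ∀ x, ‖(Φ x).fst‖ < r → |(Φ x).snd| < h → (x ∈ Ω ↔ (Φ x).snd < φ (Φ x).fst)

/-- Bounded domain whose boundary is locally the graph of a Hölder-`α` function. -/
structure IsBoundedHolderDomain {n : ℕ} (α : ℝ) (Ω : Set (EuclideanSpace ℝ (Fin n))) : Prop where
  isOpen : IsOpen Ω
  isConnected : IsConnected Ω
  isBounded : Bornology.IsBounded Ω
  boundary : ∀ x₀ ∈ frontier Ω,
    IsSubgraphNear (fun r φ => ∃ K : ℝ, ∀ x ∈ Metric.ball 0 r, ∀ y ∈ Metric.ball 0 r,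
      |φ x - φ y| ≤ K * ‖x - y‖ ^ α) Ω x₀

/-- Bounded domain whose boundary is locally the graph of a `C^∞` function. -/
structure IsBoundedSmoothDomain {n : ℕ} (Ω : Set (EuclideanSpace ℝ (Fin n))) : Prop where
  isOpen : IsOpen Ω
  isConnected : IsConnected Ω
  isBounded : Bornology.IsBounded Ω
  boundary : ∀ x₀ ∈ frontier Ω,
    IsSubgraphNear (fun r φ => ContDiffOn ℝ ∞ φ (Metric.ball 0 r)) Ω x₀

/-- Open cube of some edge length `ℓ > 0`, in any position and orientation. -/
def IsOpenCube {n : ℕ} (U : Set (EuclideanSpace ℝ (Fin n))) : Prop :=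
  ∃ (Φ : EuclideanSpace ℝ (Fin n) ≃ᵃⁱ[ℝ] EuclideanSpace ℝ (Fin n)) (ℓ : ℝ), 0 < ℓ ∧
    U = {x | ∀ i, Φ x i ∈ Ioo 0 ℓ}

/-- Open cube extended by the factor `3/2` in the direction of one of its edges. -/
def IsExtendedOpenCube {n : ℕ} (U : Set (EuclideanSpace ℝ (Fin n))) : Prop :=
  ∃ (Φ : EuclideanSpace ℝ (Fin n) ≃ᵃⁱ[ℝ] EuclideanSpace ℝ (Fin n)) (ℓ : ℝ) (j : Fin n), 0 < ℓ ∧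
    U = {x | ∀ i, Φ x i ∈ Ioo 0 (if i = j then 3 / 2 * ℓ else ℓ)}

/-- Open covering of `Ω` (up to a null set) by open subsets of `Ω`, each of which meets only
finitely many of the others. -/
structure IsOpenCovering {n : ℕ} {Γ : Type} (Ω : Set (EuclideanSpace ℝ (Fin n)))
    (U : Γ → Set (EuclideanSpace ℝ (Fin n))) : Prop where
  isOpen : ∀ t, IsOpen (U t)
  subset : ∀ t, U t ⊆ Ω
  null : volume (Ω \ ⋃ t, U t) = 0
  finite_inter : ∀ t, {s | (U t ∩ U s).Nonempty}.Finite

/-- `∫_S |f|^q η dx`, as an extended nonnegative number. -/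
def weightedEnergy {n : ℕ} (S : Set (EuclideanSpace ℝ (Fin n))) (q : ℝ)
    (η f : EuclideanSpace ℝ (Fin n) → ℝ) : ℝ≥0∞ :=
  ∫⁻ x in S, ENNReal.ofReal (|f x| ^ q * η x)

/-- Membership in the weighted space `L^q(Ω, η)`. -/
def MemWeightedLp {n : ℕ} (Ω : Set (EuclideanSpace ℝ (Fin n))) (q : ℝ)
    (η f : EuclideanSpace ℝ (Fin n) → ℝ) : Prop :=
  AEMeasurable f (volume.restrict Ω) ∧ weightedEnergy Ω q η f < ⊤

/-- `{G t}` is a decomposition of the integrable mean-zero function `g` on `Ω`, orthogonal to the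
constants and subordinate to `{U t}`. The support is the set where the function is nonzero. -/
structure IsConstOrthogonalDecomposition {n : ℕ} {Γ : Type} (Ω : Set (EuclideanSpace ℝ (Fin n)))
    (U : Γ → Set (EuclideanSpace ℝ (Fin n))) (g : EuclideanSpace ℝ (Fin n) → ℝ)
    (G : Γ → EuclideanSpace ℝ (Fin n) → ℝ) : Prop where
  integrable : IntegrableOn g Ω
  mean_zero : ∫ x in Ω, g x = 0
  integrable_piece : ∀ t, IntegrableOn (G t) Ω
  hasSum : ∀ᵐ x ∂(volume.restrict Ω), HasSum (fun t => G t x) (g x)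
  support_subset : ∀ t, Function.support (G t) ⊆ U t
  mean_zero_piece : ∀ t, ∫ x in U t, G t x = 0

end

/-! The heart of the matter is one boundary chart, where Ω is the region below the graph of a Hölder
function φ. The region above a fixed floor is cut into maximal dyadic cubes lying well below the
graph. These have side comparable to the boundary distance d, and along each vertical fibre they
form a pile whose sides do not increase upwards. Mass is moved down the pile: each cube receives on
its top sliver, of height half the side of the cube above, all the mass of g lying higher on the
same fibre, and the piece of the cube above gives this mass up on the same sliver. Hence a piece
lives on a cube extended downwards by half its side (the factor 3/2), its integral over each fibre
vanishes by telescoping, and only the root cube on the floor retains mass, namely that of the whole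
chart.

The transported density at height t is at most a constant times d⁻¹ ∫_t^φ |g|. Against the weight
d^{(1-α-β)q} this is a Hardy operator with weight d^{-(α+β)q}. The Hölder bound gives φ - t ≤ C d^α,
and with the condition -α < βp this reduces the estimate to the classical Hardy inequality with
power weights (`hardy_weighted`, `FibrePartition.exists_tsum_lintegral_piece_le`). The same
condition makes d^{βp} integrable, so that g lies in L¹ by Hölder's inequality
(`lintegral_enorm_le_of_weight`).

By compactness Ω is covered by finitely many charts, one ball and finitely many small cubes away
from the boundary. After g is split along this cover, every local decomposition leaves an
uncompensated mass on its root set. These masses add up to zero. As Ω is connected, the root sets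
are linked to the ball by finite chains of overlapping sets, and bounded bump functions in the
overlaps carry the masses along the chains (`exists_transfer`, `exists_glued_decomposition`). There
are finitely many corrections, each supported away from the boundary, so they cost only a constant.
-/

/-! ### Hardy inequalities on the line -/

theorem lintegral_rpow_Ioo_zero {r M : ℝ} (hr : -1 < r) (hM : 0 < M) :
    ∫⁻ t in Ioo 0 M, ENNReal.ofReal (t ^ r) = ENNReal.ofReal (M ^ (r + 1) / (r + 1)) := by
  have hi : IntegrableOn (fun t : ℝ => t ^ r) (Ioo 0 M) :=
    (intervalIntegral.integrableOn_Ioo_rpow_iff hM).2 hr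
  rw [← ofReal_integral_eq_lintegral_ofReal hi
    ((ae_restrict_iff' measurableSet_Ioo).2 (ae_of_all _ fun t ht => Real.rpow_nonneg ht.1.le _)),
    ← integral_Ioc_eq_integral_Ioo, ← intervalIntegral.integral_of_le hM.le,
    integral_rpow (Or.inl hr), Real.zero_rpow (by linarith), sub_zero]

theorem lintegral_rpow_Ioi {r c : ℝ} (hr : r < -1) (hc : 0 < c) :
    ∫⁻ t in Ioi c, ENNReal.ofReal (t ^ r) = ENNReal.ofReal (-c ^ (r + 1) / (r + 1)) := by
  rw [← ofReal_integral_eq_lintegral_ofReal (integrableOn_Ioi_rpow_of_lt hr hc)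
    ((ae_restrict_iff' measurableSet_Ioi).2
      (ae_of_all _ fun t ht => Real.rpow_nonneg (hc.trans ht).le _)),
    integral_Ioi_rpow_of_lt hr hc]

/-- Hölder's inequality against the weight `s ^ a`, the first half of the Schur test for the Hardy
operator. -/
theorem lintegral_Ioo_rpow_le {p q a : ℝ} (hqp : q.HolderConjugate p) (ha : a < 1 / p)
    {f : ℝ → ℝ≥0∞} (hf : Measurable f) {τ : ℝ} (hτ : 0 < τ) :
    (∫⁻ s in Ioo 0 τ, f s) ^ q ≤
      (∫⁻ s in Ioo 0 τ, f s ^ q * ENNReal.ofReal (s ^ (a * q))) *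
        ENNReal.ofReal ((1 - a * p)⁻¹ ^ (q - 1) * τ ^ ((1 - a * p) * (q - 1))) := by
  have hp0 := hqp.symm.pos
  have hq0 := hqp.pos
  have hap : 0 < 1 - a * p := by
    rw [lt_div_iff₀ hp0] at ha; linarith
  have hm : ∀ r : ℝ, Measurable fun s : ℝ => ENNReal.ofReal (s ^ r) := fun r => by fun_prop
  have h1 : ∫⁻ s in Ioo 0 τ, f s =
      ∫⁻ s in Ioo 0 τ, ((fun s => f s * ENNReal.ofReal (s ^ a)) *
        fun s => ENNReal.ofReal (s ^ (-a))) s := by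
    refine setLIntegral_congr_fun measurableSet_Ioo fun s hs => ?_
    simp only [Pi.mul_apply]
    rw [mul_assoc, ← ENNReal.ofReal_mul (Real.rpow_nonneg hs.1.le _), ← Real.rpow_add hs.1]
    simp
  have h2 : ∫⁻ s in Ioo 0 τ, (f s * ENNReal.ofReal (s ^ a)) ^ q =
      ∫⁻ s in Ioo 0 τ, f s ^ q * ENNReal.ofReal (s ^ (a * q)) := by
    refine setLIntegral_congr_fun measurableSet_Ioo fun s hs => ?_
    rw [ENNReal.mul_rpow_of_nonneg _ _ hq0.le,
      ENNReal.ofReal_rpow_of_nonneg (Real.rpow_nonneg hs.1.le _) hq0.le, ← Real.rpow_mul hs.1.le]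
  have h3 : ∫⁻ s in Ioo 0 τ, (ENNReal.ofReal (s ^ (-a))) ^ p =
      ENNReal.ofReal ((1 - a * p)⁻¹ * τ ^ (1 - a * p)) := by
    have h : ∫⁻ s in Ioo 0 τ, (ENNReal.ofReal (s ^ (-a))) ^ p =
        ∫⁻ s in Ioo 0 τ, ENNReal.ofReal (s ^ (-(a * p))) := by
      refine setLIntegral_congr_fun measurableSet_Ioo fun s hs => ?_
      rw [ENNReal.ofReal_rpow_of_nonneg (Real.rpow_nonneg hs.1.le _) hp0.le,
        ← Real.rpow_mul hs.1.le, neg_mul]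
    rw [h, lintegral_rpow_Ioo_zero (by linarith) hτ, show -(a * p) + 1 = 1 - a * p by ring,
      div_eq_inv_mul]
  have h4 := ENNReal.lintegral_mul_le_Lp_mul_Lq (volume.restrict (Ioo 0 τ)) hqp
    (hf.mul (hm a)).aemeasurable (hm (-a)).aemeasurable
  simp only [Pi.mul_apply] at h4 h1
  rw [h2, h3] at h4
  rw [h1]
  refine (ENNReal.rpow_le_rpow h4 hq0.le).trans_eq ?_
  rw [ENNReal.mul_rpow_of_nonneg _ _ hq0.le, ← ENNReal.rpow_mul, ← ENNReal.rpow_mul,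
    one_div_mul_cancel hq0.ne', ENNReal.rpow_one]
  have hqp' : 1 / p * q = q - 1 := by
    have := hqp.sub_one_mul_conj
    field_simp
    linarith
  rw [hqp', ENNReal.ofReal_rpow_of_nonneg (by positivity) hqp.sub_one_pos.le,
    Real.mul_rpow (by positivity) (by positivity), ← Real.rpow_mul hτ.le]

/-- Hardy's inequality with power weights. -/
theorem hardy_rpow {p q γ : ℝ} (hqp : q.HolderConjugate p) (hγ : γ < 1 / p) :
    ∃ C : ℝ≥0, ∀ f : ℝ → ℝ≥0∞, Measurable f →
      ∫⁻ τ in Ioi 0, ENNReal.ofReal (τ ^ ((γ - 1) * q)) * (∫⁻ s in Ioo 0 τ, f s) ^ q ≤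
        C * ∫⁻ s in Ioi 0, f s ^ q * ENNReal.ofReal (s ^ (γ * q)) := by
  -- The Schur exponent: a < 1/p makes s^(-ap) integrable at 0, and a > γ makes τ^e integrable at
  -- infinity.
  obtain ⟨a, hγa, ha⟩ := exists_between hγ
  have hp0 := hqp.symm.pos
  have hq0 := hqp.pos
  have hap : 0 < 1 - a * p := by
    rw [lt_div_iff₀ hp0] at ha; linarith
  set c : ℝ := (1 - a * p)⁻¹ ^ (q - 1) with hc
  have hc0 : 0 ≤ c := by positivity
  have haq : 0 < (a - γ) * q := mul_pos (by linarith) hq0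
  set e : ℝ := -1 - (a - γ) * q with he
  refine ⟨(c / ((a - γ) * q)).toNNReal, fun f hf => ?_⟩
  set F : ℝ → ℝ≥0∞ := fun s => f s ^ q * ENNReal.ofReal (s ^ (a * q)) with hF
  have hFm : Measurable F := by fun_prop
  have key : ∀ τ ∈ Ioi (0 : ℝ),
      ENNReal.ofReal (τ ^ ((γ - 1) * q)) * (∫⁻ s in Ioo 0 τ, f s) ^ q ≤
        ENNReal.ofReal c * ∫⁻ s in Ioi 0, (Ioi s).indicator (fun τ => ENNReal.ofReal (τ ^ e)) τ *
          F s := by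
    intro τ hτ
    have hτ' : 0 < τ := hτ
    have h1 : ∫⁻ s in Ioi 0, (Ioi s).indicator (fun τ => ENNReal.ofReal (τ ^ e)) τ * F s =
        ENNReal.ofReal (τ ^ e) * ∫⁻ s in Ioo 0 τ, F s := by
      rw [← lintegral_const_mul _ hFm, ← Ioi_inter_Iio, inter_comm, ← Measure.restrict_restrict measurableSet_Iio, ← lintegral_indicator measurableSet_Iio]
      refine lintegral_congr fun s => ?_
      by_cases hs : s < τ <;> simp [indicator, hs]
    rw [h1]
    refine (mul_le_mul_right (lintegral_Ioo_rpow_le hqp ha hf hτ') _).trans_eq ?_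
    have hexp : e = (γ - 1) * q + (1 - a * p) * (q - 1) := by
      have := hqp.sub_one_mul_conj
      rw [he]
      linear_combination a * this
    rw [hexp, Real.rpow_add hτ', ← hc,
      ENNReal.ofReal_mul hc0, ENNReal.ofReal_mul (Real.rpow_nonneg hτ'.le _)]
    ring
  refine (setLIntegral_mono' measurableSet_Ioi key).trans ?_
  have hmeas : Measurable (Function.uncurry fun τ s : ℝ =>
      (Ioi s).indicator (fun τ => ENNReal.ofReal (τ ^ e)) τ * F s) := by
    have h1 : (Function.uncurry fun τ s : ℝ =>
        (Ioi s).indicator (fun τ => ENNReal.ofReal (τ ^ e)) τ * F s) =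
        fun z : ℝ × ℝ => {z : ℝ × ℝ | z.2 < z.1}.indicator
          (fun z => ENNReal.ofReal (z.1 ^ e)) z * F z.2 := by
      ext ⟨τ, s⟩
      simp [indicator, Function.uncurry]
    rw [h1]
    exact ((by fun_prop : Measurable fun z : ℝ × ℝ => ENNReal.ofReal (z.1 ^ e)).indicator
      (measurableSet_lt measurable_snd measurable_fst)).mul (hFm.comp measurable_snd)
  have hmeas' : Measurable fun τ : ℝ => ∫⁻ s in Ioi 0,
      (Ioi s).indicator (fun τ => ENNReal.ofReal (τ ^ e)) τ * F s := hmeas.lintegral_prod_right'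
  -- Second half of the Schur test: after Tonelli the inner integral of τ^e over (s, ∞) is
  -- s^(-(a-γ)q) / ((a-γ)q), which turns the weight s^(aq) into s^(γq).
  rw [lintegral_const_mul _ hmeas', lintegral_lintegral_swap hmeas.aemeasurable,
    ENNReal.ofNNReal_toNNReal, div_eq_mul_inv, ENNReal.ofReal_mul hc0, mul_assoc]
  gcongr
  rw [← lintegral_const_mul _ (by fun_prop)]
  refine setLIntegral_mono' measurableSet_Ioi fun s hs => ?_
  have hs' : 0 < s := hs
  rw [lintegral_mul_const _ (by
      exact (by fun_prop : Measurable fun τ : ℝ => ENNReal.ofReal (τ ^ e)).indicator measurableSet_Ioi),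
    ← lintegral_indicator measurableSet_Ioi]
  have h2 : ∫⁻ τ, (Ioi (0 : ℝ)).indicator (fun τ => (Ioi s).indicator
      (fun τ => ENNReal.ofReal (τ ^ e)) τ) τ = ∫⁻ τ in Ioi s, ENNReal.ofReal (τ ^ e) := by
    rw [← lintegral_indicator measurableSet_Ioi]
    refine lintegral_congr fun τ => ?_
    by_cases h : s < τ
    · simp [indicator, h, hs'.trans h]
    · simp [indicator, h]
  rw [h2, lintegral_rpow_Ioi (by linarith) hs', hF]
  simp only
  have e1 : -1 - (a - γ) * q + 1 = -((a - γ) * q) := by ring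
  refine le_of_eq ?_
  rw [mul_comm, mul_assoc, ← ENNReal.ofReal_mul (by positivity), mul_left_comm,
    ← ENNReal.ofReal_mul (by positivity), he]
  congr 2
  rw [e1, neg_div_neg_eq, div_eq_mul_inv, ← mul_assoc, ← Real.rpow_add hs', mul_comm]
  congr 2
  ring

/-- Hardy's inequality with power weights, for integration up to the end point `M`. -/
theorem hardy_rpow_Iio {p q γ : ℝ} (hqp : q.HolderConjugate p) (hγ : γ < 1 / p) :
    ∃ C : ℝ≥0, ∀ (M : ℝ) (f : ℝ → ℝ≥0∞), Measurable f →
      ∫⁻ t in Iio M, ENNReal.ofReal ((M - t) ^ ((γ - 1) * q)) * (∫⁻ s in Ioo t M, f s) ^ q ≤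
        C * ∫⁻ s in Iio M, f s ^ q * ENNReal.ofReal ((M - s) ^ (γ * q)) := by
  obtain ⟨C, hC⟩ := hardy_rpow hqp hγ
  refine ⟨C, fun M f hf => ?_⟩
  have hsub : ∀ (F : ℝ → ℝ≥0∞) (s t : Set ℝ), MeasurableSet s → MeasurableSet t →
      (∀ x, M - x ∈ s ↔ x ∈ t) → ∫⁻ x in t, F (M - x) = ∫⁻ x in s, F x := by
    intro F s t hs ht hst
    rw [← lintegral_indicator hs, ← lintegral_indicator ht,
      ← lintegral_sub_left_eq_self (s.indicator F) M]
    refine lintegral_congr fun x => ?_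
    by_cases hx : x ∈ t
    · rw [indicator_of_mem hx, indicator_of_mem ((hst x).2 hx)]
    · rw [indicator_of_notMem hx, indicator_of_notMem (fun h => hx ((hst x).1 h))]
  have h := hC (fun x => f (M - x)) (by fun_prop)
  rw [← hsub _ (Ioi 0) (Iio M) measurableSet_Ioi measurableSet_Iio (by simp),
    ← hsub _ (Ioi 0) (Iio M) measurableSet_Ioi measurableSet_Iio (by simp)] at h
  simp only [sub_sub_cancel] at h
  convert h using 5 with t
  rw [← hsub f (Ioo t M) (Ioo 0 (M - t)) measurableSet_Ioo measurableSet_Ioo]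
  intro x
  simp only [mem_Ioo]
  constructor <;> rintro ⟨h1, h2⟩ <;> constructor <;> linarith

/-- Hardy's inequality for weights given by powers of a function `δ` that increases, up to a
constant, with the distance to the end point `M` and dominates a power of it. -/
theorem hardy_weighted {p q α β C₂ C₃ : ℝ} (hqp : q.HolderConjugate p) (hα : 0 < α)
    (hβ : -α < β * p) (hC₂ : 0 < C₂) (hC₃ : 0 < C₃) :
    ∃ C : ℝ≥0, ∀ (z M : ℝ) (δ : ℝ → ℝ) (f : ℝ → ℝ≥0∞), Measurable δ → Measurable f →
      (∀ t ∈ Ico z M, 0 < δ t) → (∀ t ∈ Ico z M, M - t ≤ C₂ * δ t ^ α) →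
      (∀ t ∈ Ico z M, ∀ s ∈ Ico t M, δ s ≤ C₃ * δ t) →
      ∫⁻ t in Ico z M, ENNReal.ofReal (δ t ^ (-(α + β) * q)) * (∫⁻ s in Ico t M, f s) ^ q ≤
        C * ∫⁻ s in Ico z M, f s ^ q * ENNReal.ofReal (δ s ^ (-β * q)) := by
  have hp0 := hqp.symm.pos
  have hq0 := hqp.pos
  -- Both signs of β reduce to the power-weight inequality with a suitable γ, applied to an
  -- auxiliary function h; what remains is a pointwise comparison of the weights on each side.
  have general : ∀ γ : ℝ, γ < 1 / p → ∀ A B : ℝ, 0 ≤ A → 0 ≤ B →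
      ∃ C : ℝ≥0, ∀ (z M : ℝ) (δ : ℝ → ℝ) (f h : ℝ → ℝ≥0∞), Measurable h →
      (∀ t ∈ Ico z M, ENNReal.ofReal (δ t ^ (-(α + β) * q)) * (∫⁻ s in Ico t M, f s) ^ q ≤
        ENNReal.ofReal A * (ENNReal.ofReal ((M - t) ^ ((γ - 1) * q)) *
          (∫⁻ s in Ico t M, h s) ^ q)) →
      (∀ s ∈ Ico z M, h s ^ q * ENNReal.ofReal ((M - s) ^ (γ * q)) ≤
        ENNReal.ofReal B * (f s ^ q * ENNReal.ofReal (δ s ^ (-β * q)))) →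
      ∫⁻ t in Ico z M, ENNReal.ofReal (δ t ^ (-(α + β) * q)) * (∫⁻ s in Ico t M, f s) ^ q ≤
        C * ∫⁻ s in Ico z M, f s ^ q * ENNReal.ofReal (δ s ^ (-β * q)) := by
    intro γ hγ A B hA hB
    obtain ⟨C, hC⟩ := hardy_rpow_Iio hqp hγ
    refine ⟨A.toNNReal * C * B.toNNReal, fun z M δ f h hh h1 h2 => ?_⟩
    have h3 := hC M ((Ico z M).indicator h) (hh.indicator measurableSet_Ico)
    have h4 : ∫⁻ t in Ico z M, ENNReal.ofReal ((M - t) ^ ((γ - 1) * q)) *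
        (∫⁻ s in Ico t M, h s) ^ q ≤ ∫⁻ t in Iio M, ENNReal.ofReal ((M - t) ^ ((γ - 1) * q)) *
        (∫⁻ s in Ioo t M, (Ico z M).indicator h s) ^ q := by
      refine (setLIntegral_mono' measurableSet_Ico fun t ht => ?_).trans
        (lintegral_mono_set Ico_subset_Iio_self)
      rw [setLIntegral_congr Ioo_ae_eq_Ico]
      have : ∫⁻ s in Ico t M, h s = ∫⁻ s in Ico t M, (Ico z M).indicator h s :=
        setLIntegral_congr_fun measurableSet_Ico fun s hs =>
          (indicator_of_mem (show s ∈ Ico z M from ⟨ht.1.trans hs.1, hs.2⟩) _).symm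
      rw [this]
    have h5 : ∫⁻ s in Iio M, (Ico z M).indicator h s ^ q * ENNReal.ofReal ((M - s) ^ (γ * q)) =
        ∫⁻ s in Ico z M, h s ^ q * ENNReal.ofReal ((M - s) ^ (γ * q)) := by
      rw [← lintegral_indicator measurableSet_Ico, ← lintegral_indicator measurableSet_Iio]
      refine lintegral_congr fun s => ?_
      by_cases hs : s ∈ Ico z M
      · simp [hs, hs.2]
      · simp [hs, hq0]
    rw [h5] at h3
    calc _ ≤ ∫⁻ t in Ico z M, ENNReal.ofReal A * (ENNReal.ofReal ((M - t) ^ ((γ - 1) * q)) *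
          (∫⁻ s in Ico t M, h s) ^ q) := setLIntegral_mono' measurableSet_Ico h1
      _ = ENNReal.ofReal A * ∫⁻ t in Ico z M, (ENNReal.ofReal ((M - t) ^ ((γ - 1) * q)) *
          (∫⁻ s in Ico t M, h s) ^ q) := lintegral_const_mul' _ _ ENNReal.ofReal_ne_top
      _ ≤ ENNReal.ofReal A * (C * ∫⁻ s in Ico z M, h s ^ q *
          ENNReal.ofReal ((M - s) ^ (γ * q))) := by
        gcongr
        exact h4.trans h3
      _ ≤ ENNReal.ofReal A * (C * ∫⁻ s in Ico z M, ENNReal.ofReal B *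
          (f s ^ q * ENNReal.ofReal (δ s ^ (-β * q)))) := by
        gcongr ENNReal.ofReal A * (C * ?_)
        exact setLIntegral_mono' measurableSet_Ico h2
      _ = _ := by
        rw [lintegral_const_mul' _ _ ENNReal.ofReal_ne_top]
        push_cast [ENNReal.ofNNReal_toNNReal]
        ring
  rcases le_or_gt 0 β with hβ0 | hβ0
  -- For β ≥ 0 take γ = 0: since δ s ≤ C₃ δ t for s above t, the factor δ^(-β) can be moved from t
  -- into the inner integral at the cost of C₃^β, and the remaining δ^(-α) is at most C₂ / (M - t).
  · obtain ⟨C, hC⟩ := general 0 (by positivity) (C₂ ^ q * C₃ ^ (β * q)) 1 (by positivity) (by simp)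
    refine ⟨C, fun z M δ f hδm hfm hδ h2 h3 => hC z M δ f
      (fun s => ENNReal.ofReal (δ s ^ (-β)) * f s) (by fun_prop) (fun t ht => ?_) fun s hs => ?_⟩
    · have hMt : 0 < M - t := sub_pos.2 ht.2
      have e1 : ENNReal.ofReal (C₃ ^ (-β) * δ t ^ (-β)) * ∫⁻ s in Ico t M, f s ≤
          ∫⁻ s in Ico t M, ENNReal.ofReal (δ s ^ (-β)) * f s := by
        rw [← lintegral_const_mul _ hfm]
        refine setLIntegral_mono' measurableSet_Ico fun s hs => ?_
        gcongr
        rw [← Real.mul_rpow hC₃.le (hδ t ht).le]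
        exact Real.rpow_le_rpow_of_nonpos (hδ s ⟨ht.1.trans hs.1, hs.2⟩) (h3 t ht s hs)
          (by linarith)
      have e2 : δ t ^ (-α) ≤ C₂ * (M - t)⁻¹ := by
        rw [Real.rpow_neg (hδ t ht).le, ← div_eq_mul_inv, le_div_iff₀ hMt,
          inv_mul_le_iff₀ (Real.rpow_pos_of_pos (hδ t ht) _), mul_comm]
        exact h2 t ht
      have e3 : δ t ^ (-(α + β)) ≤ C₂ * C₃ ^ β * (M - t)⁻¹ * (C₃ ^ (-β) * δ t ^ (-β)) := by
        rw [show -(α + β) = -α + -β by ring, Real.rpow_add (hδ t ht)]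
        calc δ t ^ (-α) * δ t ^ (-β) ≤ C₂ * (M - t)⁻¹ * δ t ^ (-β) := by
              gcongr
              exact Real.rpow_nonneg (hδ t ht).le _
          _ = _ := by
            rw [Real.rpow_neg hC₃.le]
            field_simp
      have e4 : ENNReal.ofReal (δ t ^ (-(α + β))) * ∫⁻ s in Ico t M, f s ≤
          ENNReal.ofReal (C₂ * C₃ ^ β * (M - t)⁻¹) *
            ∫⁻ s in Ico t M, ENNReal.ofReal (δ s ^ (-β)) * f s := by
        refine (mul_le_mul_left (ENNReal.ofReal_le_ofReal e3) _).trans ?_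
        rw [ENNReal.ofReal_mul (by positivity), mul_assoc]
        gcongr
      have e5 := ENNReal.rpow_le_rpow e4 hq0.le
      rw [ENNReal.mul_rpow_of_nonneg _ _ hq0.le, ENNReal.mul_rpow_of_nonneg _ _ hq0.le,
        ENNReal.ofReal_rpow_of_nonneg (Real.rpow_nonneg (hδ t ht).le _) hq0.le,
        ENNReal.ofReal_rpow_of_nonneg (by positivity) hq0.le, ← Real.rpow_mul (hδ t ht).le,
        Real.mul_rpow (by positivity) (by positivity), Real.mul_rpow (by positivity) (by positivity),
        ← Real.rpow_mul hC₃.le, Real.inv_rpow hMt.le, ← Real.rpow_neg hMt.le,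
        ENNReal.ofReal_mul (by positivity)] at e5
      rw [← mul_assoc, show (0 - 1) * q = -q by ring]
      exact e5
    · simp only [zero_mul, Real.rpow_zero, ENNReal.ofReal_one, mul_one, one_mul]
      rw [ENNReal.mul_rpow_of_nonneg _ _ hq0.le,
        ENNReal.ofReal_rpow_of_nonneg (Real.rpow_nonneg (hδ s hs).le _) hq0.le,
        ← Real.rpow_mul (hδ s hs).le, mul_comm]
  -- For β < 0 both weights are powers of δ^α, because αγ = -β. The bound γ < 1/p is exactly -α <
  -- βp. As 0 < γ < 1, the exponents (γ-1)q and γq have the signs needed to use M - t ≤ C₂ δ^α on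
  -- both sides.
  · set γ : ℝ := -β / α with hγ
    have hγ0 : 0 < γ := div_pos (by linarith) hα
    have hγp : γ < 1 / p := by
      rw [hγ, div_lt_div_iff₀ hα hp0]; linarith
    have hp1 : 1 / p < 1 := (div_lt_one hp0).2 hqp.symm.lt
    have hαγ : α * γ = -β := by rw [hγ]; field_simp
    obtain ⟨C, hC⟩ := general γ hγp (C₂ ^ ((1 - γ) * q)) (C₂ ^ (γ * q)) (by positivity)
      (by positivity)
    refine ⟨C, fun z M δ f hδm hfm hδ h2 h3 => hC z M δ f f hfm (fun t ht => ?_) fun s hs => ?_⟩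
    · have hMt : 0 < M - t := sub_pos.2 ht.2
      rw [← mul_assoc, ← ENNReal.ofReal_mul (by positivity)]
      gcongr
      calc δ t ^ (-(α + β) * q) = (δ t ^ α) ^ ((γ - 1) * q) := by
            rw [← Real.rpow_mul (hδ t ht).le]
            congr 1
            linear_combination (-q) * hαγ
        _ ≤ (C₂⁻¹ * (M - t)) ^ ((γ - 1) * q) := by
            refine Real.rpow_le_rpow_of_nonpos (by positivity) ?_
              (mul_nonpos_of_nonpos_of_nonneg (by linarith) hq0.le)
            rw [inv_mul_le_iff₀ hC₂]
            exact h2 t ht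
        _ = _ := by
            rw [Real.mul_rpow (by positivity) hMt.le, Real.inv_rpow hC₂.le, ← Real.rpow_neg hC₂.le]
            congr 2
            ring
    · have hMs : 0 < M - s := sub_pos.2 hs.2
      rw [mul_left_comm, ← ENNReal.ofReal_mul (by positivity)]
      gcongr
      calc (M - s) ^ (γ * q) ≤ (C₂ * δ s ^ α) ^ (γ * q) :=
            Real.rpow_le_rpow hMs.le (h2 s hs) (by positivity)
        _ = _ := by
            rw [Real.mul_rpow hC₂.le (Real.rpow_nonneg (hδ s hs).le _), ← Real.rpow_mul (hδ s hs).le]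
            congr 2
            linear_combination q * hαγ

/-- The power `β p` of a weight as in `hardy_weighted` has a bounded integral over an interval. -/
theorem lintegral_weight_le {α β' C₂ R : ℝ} (hα : 0 < α) (hβ : -α < β') (hC₂ : 0 < C₂)
    (hR : 0 < R) : ∃ C : ℝ≥0, ∀ (z M : ℝ) (δ : ℝ → ℝ), M - z ≤ R →
      (∀ t ∈ Ico z M, 0 < δ t ∧ δ t ≤ R) → (∀ t ∈ Ico z M, M - t ≤ C₂ * δ t ^ α) →
      ∫⁻ t in Ico z M, ENNReal.ofReal (δ t ^ β') ≤ C := by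
  rcases le_or_gt 0 β' with hβ0 | hβ0
  · refine ⟨(R ^ β' * R).toNNReal, fun z M δ hM hδ _ => ?_⟩
    calc _ ≤ ∫⁻ t in Ico z M, ENNReal.ofReal (R ^ β') :=
          setLIntegral_mono' measurableSet_Ico fun t ht => ENNReal.ofReal_le_ofReal
            (Real.rpow_le_rpow (hδ t ht).1.le (hδ t ht).2 hβ0)
      _ ≤ _ := by
        rw [setLIntegral_const, Real.volume_Ico, ENNReal.ofNNReal_toNNReal,
          ← ENNReal.ofReal_mul (by positivity)]
        gcongr
  -- For negative β' the weight is at most a constant times (M - t)^e, and -α < β' says precisely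
  -- that e > -1.
  · set e : ℝ := β' / α
    have he : -1 < e := by rw [lt_div_iff₀ hα]; linarith
    have he0 : e < 0 := div_neg_of_neg_of_pos hβ0 hα
    refine ⟨(C₂ ^ (-e) * (R ^ (e + 1) / (e + 1))).toNNReal, fun z M δ hM hδ h2 => ?_⟩
    have h1 : ∀ t ∈ Ico z M, ENNReal.ofReal (δ t ^ β') ≤
        ENNReal.ofReal (C₂ ^ (-e)) * ENNReal.ofReal ((M - t) ^ e) := by
      intro t ht
      have hMt : 0 < M - t := sub_pos.2 ht.2
      have hd := (hδ t ht).1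
      rw [← ENNReal.ofReal_mul (by positivity)]
      gcongr
      calc δ t ^ β' = (δ t ^ α) ^ e := by
            rw [← Real.rpow_mul hd.le, mul_div_cancel₀ _ hα.ne']
        _ ≤ (C₂⁻¹ * (M - t)) ^ e := by
            refine Real.rpow_le_rpow_of_nonpos (by positivity) ?_ he0.le
            rw [inv_mul_le_iff₀ hC₂]
            exact h2 t ht
        _ = _ := by
            rw [Real.mul_rpow (by positivity) hMt.le, Real.inv_rpow hC₂.le, ← Real.rpow_neg hC₂.le]
    refine (setLIntegral_mono' measurableSet_Ico h1).trans ?_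
    rw [lintegral_const_mul' _ _ ENNReal.ofReal_ne_top, ENNReal.ofNNReal_toNNReal,
      ENNReal.ofReal_mul (by positivity)]
    gcongr
    rw [← lintegral_rpow_Ioo_zero he hR, setLIntegral_congr Ioo_ae_eq_Ioc,
      ← lintegral_indicator measurableSet_Ico, ← lintegral_indicator measurableSet_Ioc,
      ← lintegral_sub_left_eq_self ((Ioc 0 R).indicator fun t => ENNReal.ofReal (t ^ e)) M]
    refine lintegral_mono fun t => ?_
    by_cases ht : t ∈ Ico z M
    · rw [indicator_of_mem ht, indicator_of_mem]
      exact ⟨sub_pos.2 ht.2, by linarith [ht.1]⟩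
    · rw [indicator_of_notMem ht]
      exact zero_le

/-! ### Downward transport of mass along fibres -/

/-- A partition `Q` of the region `{(t, x) | x ∈ B, z ≤ t < φ x}` below a graph into cells that meet
the fibre over `x` in intervals `[b s, b s + ℓ s)`, piled up without gaps and with lengths that do not
increase in the upward direction. -/
structure FibrePartition {X Γ : Type*} (D : Set (ℝ × X)) (Q : ℝ × X → Γ) (b ℓ : Γ → ℝ) (z : ℝ)
    (φ : X → ℝ) (B : Set X) : Prop where
  mem_iff : ∀ t x, (t, x) ∈ D ↔ x ∈ B ∧ z ≤ t ∧ t < φ x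
  pos : ∀ y ∈ D, 0 < ℓ (Q y)
  le_bot : ∀ y ∈ D, z ≤ b (Q y)
  bot_le : ∀ y ∈ D, b (Q y) ≤ y.1
  lt_top : ∀ y ∈ D, y.1 < b (Q y) + ℓ (Q y)
  top_lt : ∀ y ∈ D, b (Q y) + ℓ (Q y) < φ y.2
  const : ∀ y ∈ D, ∀ t, b (Q y) ≤ t → t < b (Q y) + ℓ (Q y) → Q (t, y.2) = Q y
  above_bot : ∀ y ∈ D, b (Q (b (Q y) + ℓ (Q y), y.2)) = b (Q y) + ℓ (Q y)
  above_le : ∀ y ∈ D, ℓ (Q (b (Q y) + ℓ (Q y), y.2)) ≤ ℓ (Q y)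
  below : ∀ y ∈ D, z < b (Q y) → ∀ t, b (Q y) - ℓ (Q y) / 2 ≤ t → t < b (Q y) →
    z ≤ t ∧ b (Q (t, y.2)) + ℓ (Q (t, y.2)) = b (Q y)

theorem integrable_indicator_Ico_const (a b c : ℝ) :
    Integrable ((Ico a b).indicator fun _ => c) :=
  (integrable_indicator_iff measurableSet_Ico).2
    (integrableOn_const (by simp) enorm_ne_top)

namespace FibrePartition

section Def

variable {X Γ : Type*} (Q : ℝ × X → Γ) (b ℓ : Γ → ℝ)

/-- The upper end of the cell of a point. -/
def top (y : ℝ × X) : ℝ := b (Q y) + ℓ (Q y)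

/-- The cell above the cell of a point. -/
def next (y : ℝ × X) : Γ := Q (top Q b ℓ y, y.2)

/-- The mass of `g` on the fibre above `(t, x)`. -/
noncomputable def massAbove (g : ℝ × X → ℝ) (y : ℝ × X) : ℝ := ∫ u in Ici y.1, g (u, y.2)

open Classical in
/-- The mass of the cells above, spread over the upper part of each cell. -/
noncomputable def transport (D : Set (ℝ × X)) (g : ℝ × X → ℝ) (y : ℝ × X) : ℝ :=
  if y ∈ D ∧ top Q b ℓ y - ℓ (next Q b ℓ y) / 2 ≤ y.1 then
    massAbove g (top Q b ℓ y, y.2) * (2 / ℓ (next Q b ℓ y)) else 0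

open Classical in
/-- The piece of `g` that belongs to the cell `s`. -/
noncomputable def piece (D : Set (ℝ × X)) (g : ℝ × X → ℝ) (s : Γ) (y : ℝ × X) : ℝ :=
  (if y ∈ D ∧ Q y = s then g y + transport Q b ℓ D g y else 0) -
    if y ∈ D ∧ next Q b ℓ y = s then transport Q b ℓ D g y else 0

end Def

variable {X Γ : Type*} {D : Set (ℝ × X)} {Q : ℝ × X → Γ} {b ℓ : Γ → ℝ} {z : ℝ}
  {φ : X → ℝ} {B : Set X} {g : ℝ × X → ℝ}

theorem top_mem (h : FibrePartition D Q b ℓ z φ B) {y : ℝ × X} (hy : y ∈ D) :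
    (top Q b ℓ y, y.2) ∈ D := by
  have h1 := (h.mem_iff y.1 y.2).1 hy
  exact (h.mem_iff _ _).2 ⟨h1.1, h1.2.1.trans (h.lt_top y hy).le, h.top_lt y hy⟩

theorem next_ne (h : FibrePartition D Q b ℓ z φ B) {y : ℝ × X} (hy : y ∈ D) :
    next Q b ℓ y ≠ Q y := fun he => by
  have h1 := h.above_bot y hy
  have h2 := h.pos y hy
  rw [show Q (b (Q y) + ℓ (Q y), y.2) = Q y from he] at h1
  linarith

theorem bot_mem (h : FibrePartition D Q b ℓ z φ B) {y : ℝ × X} (hy : y ∈ D) :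
    (b (Q y), y.2) ∈ D ∧ Q (b (Q y), y.2) = Q y := by
  have h1 := (h.mem_iff y.1 y.2).1 hy
  exact ⟨(h.mem_iff _ _).2 ⟨h1.1, h.le_bot y hy, (h.bot_le y hy).trans_lt h1.2.2⟩,
    h.const y hy _ le_rfl (by linarith [h.pos y hy])⟩

/-- The transported density at y is added once, in the piece of the cell of y, and subtracted once,
in the piece of the cell above, so it cancels in the sum. -/
theorem hasSum_piece (hg : ∀ y ∉ D, g y = 0) (y : ℝ × X) :
    HasSum (fun s => piece Q b ℓ D g s y) (g y) := by
  classical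
  by_cases hy : y ∈ D
  · have h1 : HasSum (fun s => if y ∈ D ∧ Q y = s then g y + transport Q b ℓ D g y else 0)
        (g y + transport Q b ℓ D g y) := by
      convert hasSum_ite_eq (Q y) (g y + transport Q b ℓ D g y) using 3 with s
      simp [hy, eq_comm]
    have h2 : HasSum (fun s => if y ∈ D ∧ next Q b ℓ y = s then transport Q b ℓ D g y else 0)
        (transport Q b ℓ D g y) := by
      convert hasSum_ite_eq (next Q b ℓ y) (transport Q b ℓ D g y) using 3 with s
      simp [hy, eq_comm]
    have h3 := h1.sub h2
    rw [add_sub_cancel_right] at h3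
    exact h3
  · simp [piece, hy, hg y hy, hasSum_zero]

/-- A piece reaches below its own cell only by half the length of that cell. This is the source of
the extension factor 3/2; on the floor there is no extension. -/
theorem piece_ne_zero (h : FibrePartition D Q b ℓ z φ B) {y : ℝ × X} {s : Γ}
    (hs : piece Q b ℓ D g s y ≠ 0) :
    y ∈ D ∧ (Q y = s ∨ (next Q b ℓ y = s ∧ b s - ℓ s / 2 ≤ y.1 ∧ y.1 < b s ∧ z < b s)) := by
  classical
  by_cases hy : y ∈ D
  · refine ⟨hy, ?_⟩
    by_cases h1 : Q y = s
    · exact Or.inl h1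
    · right
      have h2 : next Q b ℓ y = s := by
        by_contra h2
        simp [piece, h1, h2] at hs
      have h3 : top Q b ℓ y - ℓ (next Q b ℓ y) / 2 ≤ y.1 := by
        by_contra h3
        simp [piece, transport, h1, h3] at hs
      have h4 : b s = top Q b ℓ y := by rw [← h2]; exact h.above_bot y hy
      rw [h2] at h3
      rw [h4]
      exact ⟨h2, h3, h.lt_top y hy, ((h.mem_iff y.1 y.2).1 hy).2.1.trans_lt (h.lt_top y hy)⟩
  · simp [piece, hy] at hs

/-- The integral of a piece over a fibre. -/
theorem integral_piece_fibre (h : FibrePartition D Q b ℓ z φ B) (hg : ∀ y ∉ D, g y = 0) (s : Γ)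
    (x : X) (hi : Integrable fun u => g (u, x)) :
    ∫ t, piece Q b ℓ D g s (t, x) =
      open Classical in if b s = z ∧ x ∈ B ∧ ∃ t, (t, x) ∈ D ∧ Q (t, x) = s then ∫ t, g (t, x)
        else 0 := by
  classical
  by_cases hex : ∃ t, (t, x) ∈ D ∧ Q (t, x) = s
  · obtain ⟨t₀, ht₀, hs⟩ := hex
    have hx : x ∈ B := ((h.mem_iff _ _).1 ht₀).1
    have hℓ : 0 < ℓ s := hs ▸ h.pos _ ht₀
    have hbz : z ≤ b s := hs ▸ h.le_bot _ ht₀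
    have hφ : b s + ℓ s < φ x := hs ▸ h.top_lt _ ht₀
    have hc : ∀ t, b s ≤ t → t < b s + ℓ s → Q (t, x) = s := fun t h1 h2 => by
      have := h.const _ ht₀ t (hs.symm ▸ h1) (hs.symm ▸ h2)
      exact this.trans hs
    have hD : ∀ t, z ≤ t → t < φ x → (t, x) ∈ D := fun t h1 h2 => (h.mem_iff _ _).2 ⟨hx, h1, h2⟩
    set s' := Q (b s + ℓ s, x) with hs'
    have hTD : (b s + ℓ s, x) ∈ D := hD _ (by linarith) hφ
    have hℓ' : 0 < ℓ s' := h.pos _ hTD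
    have hℓle : ℓ s' ≤ ℓ s := by
      have := h.above_le _ ht₀
      rw [hs] at this; exact this
    have hmem : ∀ t, ((t, x) ∈ D ∧ Q (t, x) = s) ↔ t ∈ Ico (b s) (b s + ℓ s) := fun t =>
      ⟨fun ⟨h1, h2⟩ => ⟨h2 ▸ h.bot_le _ h1, h2 ▸ h.lt_top _ h1⟩,
        fun h1 => ⟨hD t (hbz.trans h1.1) (h1.2.trans hφ), hc t h1.1 h1.2⟩⟩
    have htop : ∀ t ∈ Ico (b s) (b s + ℓ s), top Q b ℓ (t, x) = b s + ℓ s := fun t ht => by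
      simp only [top]; rw [hc t ht.1 ht.2]
    have hnext : ∀ t ∈ Ico (b s) (b s + ℓ s), next Q b ℓ (t, x) = s' := fun t ht => by
      simp only [next]; rw [htop t ht]
    set T := b s + ℓ s with hT
    -- The positive part on the fibre: g on the cell, plus the mass above T spread evenly over the
    -- upper sliver. The sliver fits in the cell because the cell above is not longer.
    have e1 : (fun t => if (t, x) ∈ D ∧ Q (t, x) = s then
        g (t, x) + transport Q b ℓ D g (t, x) else 0) = fun t =>
        (Ico (b s) T).indicator (fun t => g (t, x)) t +
          (Ico (T - ℓ s' / 2) T).indicator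
            (fun _ => massAbove g (T, x) * (2 / ℓ s')) t := by
      ext t
      by_cases ht : t ∈ Ico (b s) T
      · rw [if_pos ((hmem t).2 ht), indicator_of_mem ht, transport, hnext t ht, htop t ht]
        congr 1
        by_cases h3 : T - ℓ s' / 2 ≤ t
        · rw [if_pos ⟨((hmem t).2 ht).1, h3⟩, indicator_of_mem (mem_Ico.2 ⟨h3, ht.2⟩)]
        · rw [if_neg (fun h4 => h3 h4.2), indicator_of_notMem (fun h4 => h3 h4.1)]
      · rw [if_neg (fun h3 => ht ((hmem t).1 h3)), indicator_of_notMem ht, indicator_of_notMem,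
          add_zero]
        exact fun h3 => ht ⟨by linarith [h3.1], h3.2⟩
    -- The negative part lives on the sliver just below s. By `below`, the cells met there all end
    -- at b s, so their successor is indeed s.
    have e2 : (fun t => if (t, x) ∈ D ∧ next Q b ℓ (t, x) = s then
        transport Q b ℓ D g (t, x) else 0) =
        if z < b s then (Ico (b s - ℓ s / 2) (b s)).indicator
            (fun _ => massAbove g (b s, x) * (2 / ℓ s)) else 0 := by
      ext t
      have h5 : (t, x) ∈ D → next Q b ℓ (t, x) = s → top Q b ℓ (t, x) = b s := fun h6 h7 => by
        rw [← h7]; exact (h.above_bot _ h6).symm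
      by_cases hz : z < b s
      · rw [if_pos hz]
        by_cases ht : t ∈ Ico (b s - ℓ s / 2) (b s)
        · have h3 := h.below _ ht₀ (by rwa [hs]) t (by rw [hs]; exact ht.1) (by rw [hs]; exact ht.2)
          have h4 : (t, x) ∈ D := hD t h3.1 (by linarith [ht.2])
          have h6 : top Q b ℓ (t, x) = b s := h3.2.trans (by rw [hs])
          have h7 : next Q b ℓ (t, x) = s := by
            simp only [next]; rw [h6]; exact hc _ le_rfl (by linarith)
          rw [if_pos ⟨h4, h7⟩, indicator_of_mem ht, transport, h7, h6, if_pos ⟨h4, ht.1⟩]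
        · rw [indicator_of_notMem ht]
          split_ifs with h3
          · rw [transport, h3.2, h5 h3.1 h3.2, if_neg]
            rintro ⟨-, h6⟩
            refine ht ⟨h6, ?_⟩
            have h7 := h.lt_top _ h3.1
            rw [← h5 h3.1 h3.2]
            exact h7
          · rfl
      · rw [if_neg hz, if_neg]
        · rfl
        rintro ⟨h3, h4⟩
        have h6 := h5 h3 h4
        have h7 : t < top Q b ℓ (t, x) := h.lt_top _ h3
        have h8 := ((h.mem_iff _ _).1 h3).2.1
        exact hz (by linarith)
    -- The density 2/ℓ s' on a sliver of height ℓ s'/2 restores the mass above T; together with g on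
    -- the cell this is the mass above b s.
    have i1 : ∫ t, (Ico (b s) T).indicator (fun t => g (t, x)) t +
          (Ico (T - ℓ s' / 2) T).indicator
            (fun _ => massAbove g (T, x) * (2 / ℓ s')) t = massAbove g (b s, x) := by
      rw [integral_add (hi.indicator measurableSet_Ico), integral_indicator measurableSet_Ico,
        integral_indicator measurableSet_Ico, setIntegral_const, measureReal_def, Real.volume_Ico,
        ENNReal.toReal_ofReal (by linarith)]
      · simp only [massAbove, smul_eq_mul]
        have h3 : (T - (T - ℓ s' / 2)) * ((∫ u in Ici T, g (u, x)) * (2 / ℓ s')) =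
            ∫ u in Ici T, g (u, x) := by
          field_simp
          ring
        rw [h3, ← setIntegral_union _ measurableSet_Ici hi.integrableOn hi.integrableOn,
          Ico_union_Ici_eq_Ici (by linarith)]
        exact disjoint_left.2 fun u hu hu' => (not_lt.2 hu') hu.2
      · exact integrable_indicator_Ico_const _ _ _
    have e3 : ∀ t, piece Q b ℓ D g s (t, x) =
      (fun t => (Ico (b s) T).indicator (fun t => g (t, x)) t +
          (Ico (T - ℓ s' / 2) T).indicator
            (fun _ => massAbove g (T, x) * (2 / ℓ s')) t) t -
      (if z < b s then (Ico (b s - ℓ s / 2) (b s)).indicator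
            (fun _ => massAbove g (b s, x) * (2 / ℓ s)) else 0) t := fun t => by
      rw [← e1, ← e2]; rfl
    have i0 : Integrable (fun t => (Ico (b s) T).indicator (fun t => g (t, x)) t +
          (Ico (T - ℓ s' / 2) T).indicator
            (fun _ => massAbove g (T, x) * (2 / ℓ s')) t) :=
      (hi.indicator measurableSet_Ico).add (integrable_indicator_Ico_const _ _ _)
    simp_rw [e3]
    -- On the floor nothing is subtracted and the whole mass of the fibre remains; higher up exactly
    -- the mass above b s is subtracted.
    rcases hbz.eq_or_lt with hz | hz
    · have h6 : massAbove g (b s, x) = ∫ t, g (t, x) := by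
        rw [massAbove]
        refine setIntegral_eq_integral_of_forall_compl_eq_zero fun t ht => hg _ fun h7 => ht ?_
        simp only [mem_Ici]
        rw [← hz]
        exact ((h.mem_iff _ _).1 h7).2.1
      rw [if_neg (by simp [hz]), if_pos ⟨hz.symm, hx, t₀, ht₀, hs⟩]
      simp only [Pi.zero_apply, sub_zero]
      rw [i1, h6]
    · rw [if_pos hz, if_neg (fun h3 => hz.ne' h3.1), integral_sub i0, i1,
        integral_indicator measurableSet_Ico, setIntegral_const, measureReal_def, Real.volume_Ico,
        ENNReal.toReal_ofReal (by linarith)]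
      · rw [smul_eq_mul]
        field_simp
        ring
      · exact integrable_indicator_Ico_const _ _ _
  · rw [if_neg (fun h1 => hex h1.2.2)]
    have : ∀ t, piece Q b ℓ D g s (t, x) = 0 := by
      intro t
      by_contra h1
      obtain ⟨h2, h3 | h3⟩ := h.piece_ne_zero h1
      · exact hex ⟨t, h2, h3⟩
      · exact hex ⟨_, h.top_mem h2, h3.1⟩
    simp [this]

section Measure

variable [MeasureSpace X] [SigmaFinite (volume : Measure X)] [MeasurableSpace Γ]
  [DiscreteMeasurableSpace Γ] [Countable Γ]

theorem measurable_top (hQ : Measurable Q) : Measurable (top Q b ℓ) :=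
  (Measurable.of_discrete.comp hQ).add (Measurable.of_discrete.comp hQ)

theorem measurable_next (hQ : Measurable Q) : Measurable (next Q b ℓ) :=
  hQ.comp ((measurable_top hQ).prodMk measurable_snd)

theorem measurable_massAbove (hg : Measurable g) : Measurable (massAbove g) := by
  have h1 : massAbove g = fun y : ℝ × X => ∫ u, {w : (ℝ × X) × ℝ | w.1.1 ≤ w.2}.indicator
      (fun w => g (w.2, w.1.2)) (y, u) := by
    ext y
    rw [massAbove, ← integral_indicator measurableSet_Ici]
    rfl
  rw [h1]
  refine (StronglyMeasurable.integral_prod_right' (f := {w : (ℝ × X) × ℝ | w.1.1 ≤ w.2}.indicator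
      (fun w => g (w.2, w.1.2))) (Measurable.stronglyMeasurable ?_)).measurable
  exact (hg.comp (by fun_prop)).indicator
    (measurableSet_le (by fun_prop) (by fun_prop))

theorem measurable_transport (hQ : Measurable Q) (hD : MeasurableSet D) (hg : Measurable g) :
    Measurable (transport Q b ℓ D g) := by
  have h1 : Measurable fun y => ℓ (next Q b ℓ y) :=
    Measurable.of_discrete.comp (measurable_next hQ)
  refine Measurable.ite ?_ ?_ measurable_const
  · exact hD.inter (measurableSet_le ((measurable_top hQ).sub (h1.div_const 2)) measurable_fst)
  · exact ((measurable_massAbove hg).comp ((measurable_top hQ).prodMk measurable_snd)).mul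
      (h1.const_div 2)

theorem measurable_piece (hQ : Measurable Q) (hD : MeasurableSet D) (hg : Measurable g) (s : Γ) :
    Measurable (piece Q b ℓ D g s) := by
  refine (Measurable.ite ?_ (hg.add (measurable_transport hQ hD hg)) measurable_const).sub
    (Measurable.ite ?_ (measurable_transport hQ hD hg) measurable_const)
  · exact hD.inter (hQ (measurableSet_singleton s))
  · exact hD.inter (measurable_next hQ (measurableSet_singleton s))

theorem integral_piece (h : FibrePartition D Q b ℓ z φ B) (hg : ∀ y ∉ D, g y = 0)
    (hgi : Integrable g) (s : Γ) (hp : Integrable (piece Q b ℓ D g s)) :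
    ∫ y, piece Q b ℓ D g s y = open Classical in ∫ x, if b s = z ∧ x ∈ B ∧
      ∃ t, (t, x) ∈ D ∧ Q (t, x) = s then ∫ t, g (t, x) else 0 := by
  rw [Measure.volume_eq_prod] at hp hgi ⊢
  rw [integral_prod_symm _ hp]
  refine integral_congr_ae ?_
  filter_upwards [hgi.prod_left_ae] with x hx
  exact h.integral_piece_fibre hg s x hx

theorem integral_piece_eq_zero (h : FibrePartition D Q b ℓ z φ B) (hg : ∀ y ∉ D, g y = 0)
    (hgi : Integrable g) {s : Γ} (hp : Integrable (piece Q b ℓ D g s)) (hs : b s ≠ z) :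
    ∫ y, piece Q b ℓ D g s y = 0 := by
  rw [h.integral_piece hg hgi s hp]
  simp [hs]

theorem integral_piece_root (h : FibrePartition D Q b ℓ z φ B) (hg : ∀ y ∉ D, g y = 0)
    (hgi : Integrable g) {s : Γ} (hp : Integrable (piece Q b ℓ D g s)) (hs : b s = z)
    (hB : ∀ x ∈ B, (z, x) ∈ D ∧ Q (z, x) = s) :
    ∫ y, piece Q b ℓ D g s y = ∫ y, g y := by
  rw [h.integral_piece hg hgi s hp, Measure.volume_eq_prod, integral_prod_symm _ hgi]
  refine integral_congr_ae (ae_of_all _ fun x => ?_)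
  by_cases hx : x ∈ B
  · simp only [if_pos (show b s = z ∧ x ∈ B ∧ ∃ t, (t, x) ∈ D ∧ Q (t, x) = s from
      ⟨hs, hx, z, hB x hx⟩)]
  · have : ∀ t, g (t, x) = 0 := fun t => hg _ fun h1 => hx ((h.mem_iff _ _).1 h1).1
    simp [this]

/-- At a given point at most two pieces are nonzero, that of its cell and that of the next one;
hence the factor 2. -/
theorem tsum_lintegral_piece_le (h : FibrePartition D Q b ℓ z φ B) (hQ : Measurable Q)
    (hD : MeasurableSet D) (hg : Measurable g) {q : ℝ} (hq : 0 < q)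
    {w : ℝ × X → ℝ≥0∞} (hw : Measurable w) :
    ∑' s, ∫⁻ y in D, ‖piece Q b ℓ D g s y‖ₑ ^ q * w y ≤
      2 * ∫⁻ y in D, (‖g y‖ₑ + ‖transport Q b ℓ D g y‖ₑ) ^ q * w y := by
  classical
  have ht := measurable_transport (b := b) (ℓ := ℓ) hQ hD hg
  rw [← lintegral_tsum fun s => by
    have := measurable_piece (b := b) (ℓ := ℓ) hQ hD hg s
    exact Measurable.aemeasurable (by fun_prop), ← lintegral_const_mul _ (by fun_prop)]
  refine setLIntegral_mono' hD fun y hy => ?_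
  set A := (‖g y‖ₑ + ‖transport Q b ℓ D g y‖ₑ) ^ q * w y with hA
  calc ∑' s, ‖piece Q b ℓ D g s y‖ₑ ^ q * w y
      ≤ ∑' s, ((if s = Q y then A else 0) + if s = next Q b ℓ y then A else 0) := by
        refine ENNReal.tsum_le_tsum fun s => ?_
        by_cases h1 : Q y = s
        · have h2 : next Q b ℓ y ≠ s := h1 ▸ h.next_ne hy
          rw [if_pos h1.symm, if_neg h2.symm, add_zero, hA]
          gcongr
          simp only [piece, hy, h1, h2, true_and, if_true, if_false, sub_zero]
          exact enorm_add_le _ _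
        · by_cases h2 : next Q b ℓ y = s
          · rw [if_neg (Ne.symm h1), if_pos h2.symm, zero_add, hA]
            gcongr
            simp [piece, hy, h1, h2]
          · simp [piece, hy, h1, h2, hq]
    _ = 2 * A := by rw [ENNReal.tsum_add, tsum_ite_eq, tsum_ite_eq, two_mul]

theorem setLIntegral_eq_fibres (h : FibrePartition D Q b ℓ z φ B) (hD : MeasurableSet D)
    {F : ℝ × X → ℝ≥0∞} (hF : Measurable F) :
    ∫⁻ y in D, F y = ∫⁻ x, B.indicator (fun x => ∫⁻ t in Ico z (φ x), F (t, x)) x := by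
  rw [← lintegral_indicator hD, Measure.volume_eq_prod,
    lintegral_prod_symm _ (hF.indicator hD).aemeasurable]
  refine lintegral_congr fun x => ?_
  by_cases hx : x ∈ B
  · rw [indicator_of_mem hx, ← lintegral_indicator measurableSet_Ico]
    refine lintegral_congr fun t => ?_
    by_cases ht : t ∈ Ico z (φ x)
    · rw [indicator_of_mem ht, indicator_of_mem ((h.mem_iff t x).2 ⟨hx, ht⟩)]
    · rw [indicator_of_notMem ht, indicator_of_notMem fun h1 => ht ((h.mem_iff t x).1 h1).2]
  · rw [indicator_of_notMem hx]
    have : ∀ t, D.indicator F (t, x) = 0 := fun t =>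
      indicator_of_notMem (fun h1 => hx ((h.mem_iff t x).1 h1).1) _
    simp [this]

/-- The pieces of `g` are bounded in the weighted norm, with the loss of a factor `δ ^ (α - 1)`. -/
theorem exists_tsum_lintegral_piece_le (h : FibrePartition D Q b ℓ z φ B) (hQ : Measurable Q)
    (hD : MeasurableSet D) {p q α β C₁ C₂ C₃ R : ℝ} (hqp : q.HolderConjugate p) (hα : 0 < α)
    (hα1 : α ≤ 1) (hβ : -α < β * p) (hC₁ : 0 < C₁) (hC₂ : 0 < C₂) (hC₃ : 0 < C₃) (hR : 0 < R)
    {δ : ℝ × X → ℝ} (hδm : Measurable δ) (hδ : ∀ y ∈ D, 0 < δ y ∧ δ y ≤ R)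
    (hφ : ∀ y ∈ D, φ y.2 - y.1 ≤ C₂ * δ y ^ α)
    (hmono : ∀ y ∈ D, ∀ t, y.1 ≤ t → (t, y.2) ∈ D → δ (t, y.2) ≤ C₃ * δ y)
    (hnext : ∀ y ∈ D, top Q b ℓ y - ℓ (next Q b ℓ y) / 2 ≤ y.1 → δ y ≤ C₁ * ℓ (next Q b ℓ y)) :
    ∃ C : ℝ≥0, ∀ g : ℝ × X → ℝ, Measurable g → (∀ y ∉ D, g y = 0) →
      ∑' s, ∫⁻ y in D, ‖piece Q b ℓ D g s y‖ₑ ^ q *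
        ENNReal.ofReal (δ y ^ ((1 - α - β) * q)) ≤
      C * ∫⁻ y in D, ‖g y‖ₑ ^ q * ENNReal.ofReal (δ y ^ (-β * q)) := by
  have hq0 := hqp.pos
  obtain ⟨C, hC⟩ := hardy_weighted hqp hα hβ hC₂ hC₃
  set K : ℝ≥0∞ := 2 * 2 ^ (q - 1) * (ENNReal.ofReal (R ^ ((1 - α) * q)) +
    ENNReal.ofReal ((2 * C₁) ^ q) * C) with hK
  have hKtop : K ≠ ⊤ := by
    simp [hK, ENNReal.mul_eq_top, ENNReal.rpow_eq_top_iff]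
  refine ⟨K.toNNReal, fun g hg hgD => ?_⟩
  have htm := measurable_transport (b := b) (ℓ := ℓ) hQ hD hg
  refine (h.tsum_lintegral_piece_le hQ hD hg hq0
    (w := fun y => ENNReal.ofReal (δ y ^ ((1 - α - β) * q))) (by fun_prop)).trans ?_
  rw [ENNReal.coe_toNNReal hKtop]
  -- Integrating from y itself rather than from the top of its cell overestimates the transported
  -- mass, but makes it the Hardy operator on the fibre.
  set M : ℝ × X → ℝ≥0∞ := fun y => ∫⁻ u in Ici y.1, ‖g (u, y.2)‖ₑ with hM
  have hMm : Measurable M := by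
    have h1 : M = fun y : ℝ × X => ∫⁻ u, {w : (ℝ × X) × ℝ | w.1.1 ≤ w.2}.indicator
        (fun w => ‖g (w.2, w.1.2)‖ₑ) (y, u) := by
      ext y
      simp only [hM]
      rw [← lintegral_indicator measurableSet_Ici]
      rfl
    rw [h1]
    exact Measurable.lintegral_prod_right' (((hg.enorm).comp (by fun_prop)).indicator
      (measurableSet_le (by fun_prop) (by fun_prop)))
  have htr : ∀ y ∈ D, ‖transport Q b ℓ D g y‖ₑ ≤ ENNReal.ofReal (2 * C₁ * (δ y)⁻¹) * M y := by
    intro y hy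
    by_cases h1 : top Q b ℓ y - ℓ (next Q b ℓ y) / 2 ≤ y.1
    · have h2 : 0 < ℓ (next Q b ℓ y) := h.pos _ (h.top_mem hy)
      have h3 := hnext y hy h1
      have h4 := (hδ y hy).1
      simp only [transport, hy, h1, and_self, if_true]
      rw [enorm_mul, mul_comm]
      gcongr
      · rw [Real.enorm_eq_ofReal (by positivity)]
        gcongr
        rw [div_le_iff₀ h2]
        calc (2 : ℝ) = 2 * (δ y)⁻¹ * δ y := by field_simp
          _ ≤ 2 * (δ y)⁻¹ * (C₁ * ℓ (next Q b ℓ y)) := by gcongr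
          _ = _ := by ring
      · refine (enorm_integral_le_lintegral_enorm _).trans ?_
        exact lintegral_mono_set (Ici_subset_Ici.2 (h.lt_top y hy).le)
    · simp [transport, h1]
  -- For g the surplus factor δ^((1-α)q) is bounded by a power of R. For the transport the factor
  -- δ^(-q) coming from `htr` turns the weight into δ^(-(α+β)q), the one in `hardy_weighted`.
  have hpt : ∀ y ∈ D, (‖g y‖ₑ + ‖transport Q b ℓ D g y‖ₑ) ^ q *
      ENNReal.ofReal (δ y ^ ((1 - α - β) * q)) ≤ 2 ^ (q - 1) *
        (ENNReal.ofReal (R ^ ((1 - α) * q)) * (‖g y‖ₑ ^ q * ENNReal.ofReal (δ y ^ (-β * q))) +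
          ENNReal.ofReal ((2 * C₁) ^ q) *
            (ENNReal.ofReal (δ y ^ (-(α + β) * q)) * M y ^ q)) := by
    intro y hy
    obtain ⟨hd, hdR⟩ := hδ y hy
    refine (mul_le_mul_left (ENNReal.rpow_add_le_mul_rpow_add_rpow _ _ hqp.lt.le) _).trans ?_
    rw [mul_assoc, add_mul]
    refine mul_le_mul_right (add_le_add ?_ ?_) _
    · rw [mul_left_comm, ← ENNReal.ofReal_mul (by positivity)]
      gcongr
      rw [show (1 - α - β) * q = (1 - α) * q + -β * q by ring, Real.rpow_add hd]
      gcongr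
    · refine (mul_le_mul_left (ENNReal.rpow_le_rpow (htr y hy) hq0.le) _).trans ?_
      rw [ENNReal.mul_rpow_of_nonneg _ _ hq0.le, ENNReal.ofReal_rpow_of_nonneg (by positivity) hq0.le,
        Real.mul_rpow (by positivity) (by positivity), ENNReal.ofReal_mul (by positivity),
        mul_assoc, mul_assoc]
      refine mul_le_mul_right ?_ _
      rw [mul_comm (M y ^ q), ← mul_assoc, ← ENNReal.ofReal_mul (by positivity),
        Real.inv_rpow hd.le, ← Real.rpow_neg hd.le, ← Real.rpow_add hd]
      refine le_of_eq ?_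
      congr 3
      ring
  calc _ ≤ 2 * ∫⁻ y in D, 2 ^ (q - 1) *
        (ENNReal.ofReal (R ^ ((1 - α) * q)) * (‖g y‖ₑ ^ q * ENNReal.ofReal (δ y ^ (-β * q))) +
          ENNReal.ofReal ((2 * C₁) ^ q) *
            (ENNReal.ofReal (δ y ^ (-(α + β) * q)) * M y ^ q)) := by
        exact mul_le_mul_right (setLIntegral_mono' hD hpt) _
    _ = 2 * (2 ^ (q - 1) * (ENNReal.ofReal (R ^ ((1 - α) * q)) *
          (∫⁻ y in D, ‖g y‖ₑ ^ q * ENNReal.ofReal (δ y ^ (-β * q))) +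
          ENNReal.ofReal ((2 * C₁) ^ q) *
            ∫⁻ y in D, (ENNReal.ofReal (δ y ^ (-(α + β) * q)) * M y ^ q))) := by
        rw [lintegral_const_mul _ (by fun_prop), lintegral_add_left (by fun_prop),
          lintegral_const_mul _ (by fun_prop), lintegral_const_mul _ (by fun_prop)]
    _ ≤ 2 * (2 ^ (q - 1) * (ENNReal.ofReal (R ^ ((1 - α) * q)) *
          (∫⁻ y in D, ‖g y‖ₑ ^ q * ENNReal.ofReal (δ y ^ (-β * q))) +
          ENNReal.ofReal ((2 * C₁) ^ q) *
            (C * ∫⁻ y in D, ‖g y‖ₑ ^ q * ENNReal.ofReal (δ y ^ (-β * q))))) := by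
        gcongr
        rw [h.setLIntegral_eq_fibres hD (by fun_prop), h.setLIntegral_eq_fibres hD (by fun_prop),
          ← lintegral_const_mul' _ _ ENNReal.coe_ne_top]
        refine lintegral_mono fun x => ?_
        by_cases hx : x ∈ B
        · simp only [indicator_of_mem hx]
          have hDx : ∀ t ∈ Ico z (φ x), (t, x) ∈ D := fun t ht => (h.mem_iff t x).2 ⟨hx, ht⟩
          refine le_trans (le_of_eq ?_) (hC z (φ x) (fun t => δ (t, x)) (fun t => ‖g (t, x)‖ₑ)
            (by fun_prop) (by fun_prop) (fun t ht => (hδ _ (hDx t ht)).1)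
            (fun t ht => hφ _ (hDx t ht))
            (fun t ht s hs => hmono _ (hDx t ht) s hs.1 (hDx s ⟨ht.1.trans hs.1, hs.2⟩)))
          refine setLIntegral_congr_fun measurableSet_Ico fun t ht => ?_
          simp only [hM]
          congr 2
          rw [← lintegral_indicator measurableSet_Ici, ← lintegral_indicator measurableSet_Ico]
          refine lintegral_congr fun u => ?_
          by_cases hu : u ∈ Ico t (φ x)
          · rw [indicator_of_mem hu, indicator_of_mem (show u ∈ Ici t from hu.1)]
          · rw [indicator_of_notMem hu]
            by_cases hu' : u ∈ Ici t
            · rw [indicator_of_mem hu', hgD _ fun h1 => hu ⟨hu', ((h.mem_iff u x).1 h1).2.2⟩,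
                enorm_zero]
            · rw [indicator_of_notMem hu']
        · simp [indicator_of_notMem hx]
    _ = _ := by rw [hK]; ring

/-- The power `β'` of the weight is integrable over the region. -/
theorem lintegral_weight_lt_top (h : FibrePartition D Q b ℓ z φ B) (hD : MeasurableSet D)
    {α β' C₂ R : ℝ} (hα : 0 < α) (hβ : -α < β') (hC₂ : 0 < C₂) (hR : 0 < R)
    {δ : ℝ × X → ℝ} (hδm : Measurable δ) (hδ : ∀ y ∈ D, 0 < δ y ∧ δ y ≤ R)
    (hφ : ∀ y ∈ D, φ y.2 - y.1 ≤ C₂ * δ y ^ α) (hφR : ∀ x ∈ B, φ x - z ≤ R)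
    (hB : MeasurableSet B) (hBv : volume B ≠ ⊤) :
    ∫⁻ y in D, ENNReal.ofReal (δ y ^ β') < ⊤ := by
  obtain ⟨C, hC⟩ := lintegral_weight_le hα hβ hC₂ hR
  rw [h.setLIntegral_eq_fibres hD (by fun_prop)]
  calc _ ≤ ∫⁻ x, B.indicator (fun _ => (C : ℝ≥0∞)) x := by
        refine lintegral_mono fun x => ?_
        by_cases hx : x ∈ B
        · simp only [indicator_of_mem hx]
          have hDx : ∀ t ∈ Ico z (φ x), (t, x) ∈ D := fun t ht => (h.mem_iff t x).2 ⟨hx, ht⟩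
          exact hC z (φ x) (fun t => δ (t, x)) (hφR x hx) (fun t ht => hδ _ (hDx t ht))
            fun t ht => hφ _ (hDx t ht)
        · simp [indicator_of_notMem hx]
    _ = C * volume B := lintegral_indicator_const hB _
    _ < ⊤ := ENNReal.mul_lt_top ENNReal.coe_lt_top hBv.lt_top

end Measure

end FibrePartition

/-! ### Dyadic cubes below a graph -/

namespace DyadicCube

/-- The index of a dyadic cube: generation, vertical position, horizontal position. -/
abbrev Index (m : ℕ) : Type := ℕ × ℤ × (Fin m → ℤ)

section Def

variable {m : ℕ} (L z : ℝ)

/-- The side length of the cubes of generation `k`. -/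
noncomputable def side (k : ℕ) : ℝ := L / 2 ^ k

/-- The least corner of the horizontal projection of a cube. -/
noncomputable def corner (s : Index m) (a : Fin m) : ℝ := -(L / 2) + s.2.2 a * side L s.1

/-- The height of the lower face of a cube. -/
noncomputable def bot (s : Index m) : ℝ := z + s.2.1 * side L s.1

/-- The cube of generation `k` that contains `y`. -/
noncomputable def cube (k : ℕ) (y : ℝ × (Fin m → ℝ)) : Index m :=
  (k, ⌊(y.1 - z) / side L k⌋, fun a => ⌊(y.2 a + L / 2) / side L k⌋)

/-- A cube is good if it lies well below the graph. -/
def Good (φ : (Fin m → ℝ) → ℝ) (s : Index m) : Prop :=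
  ∀ x, dist x (corner L s) ≤ 2 * side L s.1 → bot L z s + 2 * side L s.1 < φ x

/-- The base of the columns. -/
def base (m : ℕ) : Set (Fin m → ℝ) := {x | ∀ a, -(L / 2) ≤ x a ∧ x a < L / 2}

/-- The region between the height `z` and the graph. -/
def region (φ : (Fin m → ℝ) → ℝ) : Set (ℝ × (Fin m → ℝ)) :=
  {y | y.2 ∈ base L m ∧ z ≤ y.1 ∧ y.1 < φ y.2}

/-- The least generation of a good cube around `y`. -/
noncomputable def level (φ : (Fin m → ℝ) → ℝ) (y : ℝ × (Fin m → ℝ)) : ℕ :=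
  sInf {k | y ∉ region L z φ ∨ Good L z φ (cube L z k y)}

/-- The maximal good cube around `y`. -/
noncomputable def maxCube (φ : (Fin m → ℝ) → ℝ) (y : ℝ × (Fin m → ℝ)) : Index m :=
  cube L z (level L z φ y) y

end Def

variable {m : ℕ} {L z : ℝ} {φ : (Fin m → ℝ) → ℝ}

theorem side_pos (hL : 0 < L) (k : ℕ) : 0 < side L k := by unfold side; positivity

theorem side_add (L : ℝ) (k d : ℕ) : side L k = (2 ^ d : ℕ) * side L (k + d) := by
  unfold side
  rw [pow_add]
  push_cast
  field_simp

theorem side_anti (hL : 0 < L) {k k' : ℕ} (h : k ≤ k') : side L k' ≤ side L k := by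
  unfold side
  gcongr
  norm_num

theorem side_le (hL : 0 < L) (k : ℕ) : side L k ≤ L := by
  have := side_anti hL (Nat.zero_le k)
  simpa [side] using this

theorem tendsto_side (L : ℝ) : Filter.Tendsto (side L) Filter.atTop (nhds 0) := by
  have h := (tendsto_pow_atTop_nhds_zero_of_lt_one (r := (1 / 2 : ℝ)) (by norm_num)
    (by norm_num)).const_mul L
  rw [mul_zero] at h
  refine h.congr fun k => ?_
  simp [side, div_eq_mul_inv]

theorem bot_cube_le (hL : 0 < L) (k : ℕ) (y : ℝ × (Fin m → ℝ)) : bot L z (cube L z k y) ≤ y.1 := by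
  have h := Int.floor_le ((y.1 - z) / side L k)
  rw [le_div_iff₀ (side_pos hL k)] at h
  simp only [bot, cube]
  linarith

theorem lt_bot_cube (hL : 0 < L) (k : ℕ) (y : ℝ × (Fin m → ℝ)) :
    y.1 < bot L z (cube L z k y) + side L k := by
  have h := Int.lt_floor_add_one ((y.1 - z) / side L k)
  rw [div_lt_iff₀ (side_pos hL k)] at h
  simp only [bot, cube]
  linarith

theorem corner_cube_le (hL : 0 < L) (k : ℕ) (y : ℝ × (Fin m → ℝ)) (a : Fin m) :
    corner L (cube L z k y) a ≤ y.2 a := by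
  have h := Int.floor_le ((y.2 a + L / 2) / side L k)
  rw [le_div_iff₀ (side_pos hL k)] at h
  simp only [corner, cube]
  linarith

theorem lt_corner_cube (hL : 0 < L) (k : ℕ) (y : ℝ × (Fin m → ℝ)) (a : Fin m) :
    y.2 a < corner L (cube L z k y) a + side L k := by
  have h := Int.lt_floor_add_one ((y.2 a + L / 2) / side L k)
  rw [div_lt_iff₀ (side_pos hL k)] at h
  simp only [corner, cube]
  linarith

theorem dist_corner_cube_le (hL : 0 < L) (k : ℕ) (y : ℝ × (Fin m → ℝ)) :
    dist y.2 (corner L (cube L z k y)) ≤ side L k := by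
  refine (dist_pi_le_iff (side_pos hL k).le).2 fun a => ?_
  rw [Real.dist_eq, abs_le]
  have h1 := corner_cube_le (z := z) hL k y a
  have h2 := lt_corner_cube (z := z) hL k y a
  have := side_pos hL k
  constructor <;> linarith

theorem floor_div_side (L u : ℝ) (k d : ℕ) :
    ⌊u / side L k⌋ = ⌊u / side L (k + d)⌋ / ((2 ^ d : ℕ) : ℤ) := by
  rw [← Int.floor_div_natCast, side_add L k d, div_div, mul_comm]

/-- The index of a coarse cube is the integer quotient of the index of a fine one by a power of 2,
so the fine cube determines its ancestors. -/
theorem cube_coarse {k k' : ℕ} (hk : k' ≤ k) {y y' : ℝ × (Fin m → ℝ)}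
    (h : cube L z k y = cube L z k y') : cube L z k' y = cube L z k' y' := by
  obtain ⟨d, rfl⟩ := Nat.exists_eq_add_of_le hk
  simp only [cube, Prod.mk.injEq, true_and] at h ⊢
  refine ⟨?_, funext fun a => ?_⟩
  · rw [floor_div_side L _ k' d, floor_div_side L _ k' d, h.1]
  · rw [floor_div_side L _ k' d, floor_div_side L _ k' d, congrFun h.2 a]

/-- By continuity φ stays above the midpoint of y.1 and φ y.2 near y.2, and small cubes see only
this neighbourhood and half the gap. -/
theorem exists_good (hL : 0 < L) (hφ : Continuous φ) {y : ℝ × (Fin m → ℝ)}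
    (hy : y ∈ region L z φ) : ∃ k, Good L z φ (cube L z k y) := by
  have h1 : ∀ᶠ x in nhds y.2, (y.1 + φ y.2) / 2 < φ x :=
    hφ.continuousAt.eventually (lt_mem_nhds (by linarith [hy.2.2]))
  obtain ⟨ε, hε, h2⟩ := Metric.eventually_nhds_iff.1 h1
  have h3 : ∀ᶠ k in Filter.atTop, 3 * side L k < ε := by
    have := (tendsto_side L).const_mul 3
    rw [mul_zero] at this
    exact this.eventually (gt_mem_nhds hε)
  have h4 : ∀ᶠ k in Filter.atTop, 2 * side L k < (φ y.2 - y.1) / 2 := by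
    have := (tendsto_side L).const_mul 2
    rw [mul_zero] at this
    exact this.eventually (gt_mem_nhds (by linarith [hy.2.2]))
  obtain ⟨k, h5, h6⟩ := (h3.and h4).exists
  refine ⟨k, fun x hx => ?_⟩
  have h7 : dist x y.2 < ε := by
    have := dist_triangle_right x y.2 (corner L (cube L z k y))
    have h8 := dist_corner_cube_le (z := z) hL k y
    simp only [cube] at hx h8 this
    linarith
  have h9 := h2 h7
  have h10 := bot_cube_le (z := z) hL k y
  show bot L z (cube L z k y) + 2 * side L k < φ x
  linarith

theorem level_spec (hL : 0 < L) (hφ : Continuous φ) {y : ℝ × (Fin m → ℝ)}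
    (hy : y ∈ region L z φ) : Good L z φ (maxCube L z φ y) := by
  have h := Nat.sInf_mem (s := {k | y ∉ region L z φ ∨ Good L z φ (cube L z k y)})
    ((exists_good hL hφ hy).imp fun k hk => Or.inr hk)
  exact h.resolve_left (not_not.2 hy)

theorem level_le {y : ℝ × (Fin m → ℝ)} {k : ℕ} (hk : Good L z φ (cube L z k y)) :
    level L z φ y ≤ k := Nat.sInf_le (Or.inr hk)

/-- The maximal good cubes form a partition: a good cube around y' bounds the level of y' from
above, and a coarser good cube around y' would contain y as well. -/
theorem level_eq_of_cube_eq (hL : 0 < L) (hφ : Continuous φ) {y y' : ℝ × (Fin m → ℝ)}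
    (hy : y ∈ region L z φ) (hy' : y' ∈ region L z φ)
    (h : cube L z (level L z φ y) y' = maxCube L z φ y) : maxCube L z φ y' = maxCube L z φ y := by
  have h1 : level L z φ y' ≤ level L z φ y := level_le (h ▸ level_spec hL hφ hy)
  have h2 : level L z φ y ≤ level L z φ y' := by
    refine level_le ?_
    rw [← cube_coarse h1 h]
    exact level_spec hL hφ hy'
  rw [maxCube, le_antisymm h1 h2, h]

/-- Going down, the cube of the same generation has the same horizontal position and a lower bottom,
so it stays good. This makes the sides non-increasing upwards. -/
theorem level_mono (hL : 0 < L) (hφ : Continuous φ) {t t' : ℝ} {x : Fin m → ℝ}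
    (hy : (t, x) ∈ region L z φ) (ht : t' ≤ t) : level L z φ (t', x) ≤ level L z φ (t, x) := by
  refine level_le fun x' hx' => ?_
  have h := level_spec hL hφ hy x' hx'
  refine lt_of_le_of_lt ?_ h
  simp only [maxCube, bot, cube]
  have := side_pos hL (level L z φ (t, x))
  gcongr

theorem bot_nonneg (hL : 0 < L) (k : ℕ) {y : ℝ × (Fin m → ℝ)} (hy : z ≤ y.1) :
    z ≤ bot L z (cube L z k y) := by
  have h : (0 : ℤ) ≤ ⌊(y.1 - z) / side L k⌋ :=
    Int.floor_nonneg.2 (div_nonneg (by linarith) (side_pos hL k).le)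
  have h' : (0 : ℝ) ≤ (⌊(y.1 - z) / side L k⌋ : ℝ) := by exact_mod_cast h
  have := mul_nonneg h' (side_pos hL k).le
  simp only [bot, cube]
  linarith

theorem cube_eq_of_mem (hL : 0 < L) (k : ℕ) {t t' : ℝ} {x : Fin m → ℝ}
    (h1 : bot L z (cube L z k (t, x)) ≤ t') (h2 : t' < bot L z (cube L z k (t, x)) + side L k) :
    cube L z k (t', x) = cube L z k (t, x) := by
  have h3 : ⌊(t' - z) / side L k⌋ = ⌊(t - z) / side L k⌋ := by
    rw [Int.floor_eq_iff, le_div_iff₀ (side_pos hL k), div_lt_iff₀ (side_pos hL k)]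
    simp only [bot, cube] at h1 h2
    constructor <;> linarith
  simp only [cube, h3]

theorem maxCube_const (hL : 0 < L) (hφ : Continuous φ) {t t' : ℝ} {x : Fin m → ℝ}
    (hy : (t, x) ∈ region L z φ) (h1 : bot L z (maxCube L z φ (t, x)) ≤ t')
    (h2 : t' < bot L z (maxCube L z φ (t, x)) + side L (level L z φ (t, x))) :
    (t', x) ∈ region L z φ ∧ maxCube L z φ (t', x) = maxCube L z φ (t, x) := by
  have hmem : (t', x) ∈ region L z φ := by
    refine ⟨hy.1, (bot_nonneg hL _ hy.2.1).trans h1, ?_⟩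
    have h3 := level_spec hL hφ hy x ((dist_corner_cube_le hL _ (t, x)).trans ?_)
    · have := side_pos hL (level L z φ (t, x))
      simp only [maxCube, cube] at h2 h3 ⊢
      linarith
    · have := side_pos hL (level L z φ (t, x))
      simp only [maxCube, cube]
      linarith
  exact ⟨hmem, level_eq_of_cube_eq hL hφ hy hmem (cube_eq_of_mem hL _ h1 h2)⟩

theorem fibrePartition (hL : 0 < L) (hφ : Continuous φ) :
    FibrePartition (region L z φ) (maxCube L z φ) (bot L z) (fun s => side L s.1) z φ
      (base L m) where
  mem_iff t x := Iff.rfl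
  pos y _ := side_pos hL _
  le_bot y hy := bot_nonneg hL _ hy.2.1
  bot_le y _ := bot_cube_le hL _ y
  lt_top y _ := lt_bot_cube hL _ y
  top_lt y hy := by
    have := side_pos hL (level L z φ y)
    have h3 := level_spec hL hφ hy y.2 ((dist_corner_cube_le hL _ y).trans (by
      simp only [maxCube, cube]; linarith))
    simp only [maxCube, cube] at h3 ⊢
    linarith
  const := fun ⟨t, x⟩ hy t' h1 h2 => (maxCube_const hL hφ hy h1 h2).2
  above_bot := by
    rintro ⟨t, x⟩ hy
    set k := level L z φ (t, x) with hk
    set i := ⌊(t - z) / side L k⌋ with hi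
    have hT : bot L z (maxCube L z φ (t, x)) + side L k = z + (i + 1 : ℤ) * side L k := by
      simp only [bot, maxCube, cube, ← hk, ← hi]; push_cast; ring
    have h3 := level_spec hL hφ hy x ((dist_corner_cube_le hL _ (t, x)).trans (by
      simp only [maxCube, cube]; linarith [side_pos hL k]))
    have hlt : t < z + (i + 1 : ℤ) * side L k := by
      rw [← hT]; exact lt_bot_cube hL k (t, x)
    have hmem : (z + (i + 1 : ℤ) * side L k, x) ∈ region L z φ := by
      refine ⟨hy.1, hy.2.1.trans hlt.le, ?_⟩
      rw [← hT]
      simp only [maxCube, cube, ← hk] at h3 ⊢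
      linarith [side_pos hL k]
    -- The cell above is at least as fine, so the top, a multiple of the coarser side above z, is
    -- also a multiple of the finer one: the next cell starts there without a gap.
    have hle := level_mono hL hφ hmem hlt.le
    obtain ⟨d, hd⟩ := Nat.exists_eq_add_of_le hle
    show bot L z (maxCube L z φ (bot L z (maxCube L z φ (t, x)) + side L k, x)) =
      bot L z (maxCube L z φ (t, x)) + side L k
    rw [hT]
    simp only [maxCube, cube, bot, hd]
    rw [← hk, side_add L k d, add_sub_cancel_left, ← mul_assoc,
      mul_div_cancel_right₀ _ (side_pos hL _).ne', ← Int.cast_natCast (R := ℝ), ← Int.cast_mul,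
      Int.floor_intCast]
  above_le := by
    rintro ⟨t, x⟩ hy
    refine side_anti hL (level_mono hL hφ ?_ (lt_bot_cube hL _ (t, x)).le)
    refine ⟨hy.1, hy.2.1.trans (lt_bot_cube hL _ (t, x)).le, ?_⟩
    have := side_pos hL (level L z φ (t, x))
    have h3 := level_spec hL hφ hy x ((dist_corner_cube_le hL _ (t, x)).trans (by
      simp only [maxCube, cube]; linarith))
    simp only [maxCube, cube] at h3 ⊢
    linarith
  below := by
    rintro ⟨t, x⟩ hy hz u hu hub
    set k := level L z φ (t, x) with hk
    set i := ⌊(t - z) / side L k⌋ with hi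
    have hs := side_pos hL k
    have hb : bot L z (maxCube L z φ (t, x)) = z + i * side L k := rfl
    have hi1 : 1 ≤ i := by
      rw [hb] at hz
      have : 0 < (i : ℝ) * side L k := by linarith
      have h2 : 0 < (i : ℝ) := (mul_pos_iff_of_pos_right hs).1 this
      exact_mod_cast h2
    have hi1' : (1 : ℝ) ≤ i := by exact_mod_cast hi1
    change bot L z (maxCube L z φ (t, x)) - side L k / 2 ≤ u at hu
    rw [hb] at hu hub hz ⊢
    have hzu : z ≤ u := by nlinarith
    have hbt : z + i * side L k ≤ t := bot_cube_le hL k (t, x)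
    have hmem : (u, x) ∈ region L z φ := ⟨hy.1, hzu, (hub.trans_le hbt).trans hy.2.2⟩
    have hle := level_mono hL hφ hy (hub.trans_le hbt).le
    refine ⟨hzu, ?_⟩
    obtain ⟨d, hd⟩ := Nat.exists_eq_add_of_le hle
    set k' := level L z φ (u, x) with hk'
    -- At the finer generation k the point u lies in the slot right below that of y; its own cell is
    -- N = 2^d slots high.
    have hiu : ⌊(u - z) / side L k⌋ = i - 1 := by
      rw [Int.floor_eq_iff, le_div_iff₀ hs, div_lt_iff₀ hs]
      push_cast
      constructor <;> linarith
    set N : ℤ := ((2 ^ d : ℕ) : ℤ) with hN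
    have hN0 : 0 < N := by positivity
    have hkd : k = k' + d := hd
    have hi' : ⌊(u - z) / side L k'⌋ = (i - 1) / N := by
      rw [floor_div_side L _ k' d, ← hkd, hiu]
    have hsk' : side L k' = N * side L k := by
      rw [side_add L k' d, ← hkd, hN]; push_cast; ring
    show z + ⌊(u - z) / side L k'⌋ * side L k' + side L k' = z + i * side L k
    rw [hi']
    set e := (i - 1) / N with he
    have h1 : e * N ≤ i - 1 := Int.ediv_mul_le _ hN0.ne'
    have h2 : i - 1 < (e + 1) * N := Int.lt_ediv_add_one_mul_self _ hN0
    -- Either the cell of u ends at the bottom of the cell of y, as wanted, or it contains that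
    -- height. Then it would coincide with the cell of y, so d = 0 and N = 1, which is impossible.
    rcases (show i ≤ (e + 1) * N by linarith).eq_or_lt with h3 | h3
    · have h4 : (i : ℝ) = (e + 1) * N := by exact_mod_cast h3
      rw [h4, hsk']; ring
    · exfalso
      have h3' : (i : ℝ) < (e + 1) * N := by exact_mod_cast h3
      have h1' : (e : ℝ) * N ≤ i - 1 := by exact_mod_cast h1
      have hbu : bot L z (maxCube L z φ (u, x)) = z + e * side L k' := by
        show z + ⌊(u - z) / side L k'⌋ * side L k' = _
        rw [hi']
      have h5 := maxCube_const (t' := z + i * side L k) hL hφ hmem (by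
        rw [hbu, hsk']; nlinarith) (by
        rw [hbu, ← hk', hsk']; nlinarith)
      have h6 := maxCube_const (t' := z + i * side L k) hL hφ hy le_rfl (by
        rw [hb]; linarith)
      have h7 : maxCube L z φ (u, x) = maxCube L z φ (t, x) := h5.2.symm.trans h6.2
      have h8 := bot_cube_le (z := z) hL k (u, x)
      have h9 : k' = k := congrArg Prod.fst h7
      have h10 : d = 0 := by omega
      have h11 : N = 1 := by rw [hN, h10]; rfl
      rw [h11] at h1 h3 h2
      linarith

theorem measurableSet_region (hφ : Continuous φ) : MeasurableSet (region L z φ) := by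
  have h1 : MeasurableSet (base L m) := by
    have : base L m = ⋂ a, {x | -(L / 2) ≤ x a} ∩ {x | x a < L / 2} := by
      ext x; simp [base]
    rw [this]
    exact MeasurableSet.iInter fun a =>
      (measurableSet_le measurable_const (measurable_pi_apply a)).inter
        (measurableSet_lt (measurable_pi_apply a) measurable_const)
  exact (measurable_snd h1).inter ((measurableSet_le measurable_const measurable_fst).inter
    (measurableSet_lt measurable_fst (hφ.measurable.comp measurable_snd)))

theorem measurable_cube (k : ℕ) : Measurable (cube (m := m) L z k) := by
  refine measurable_const.prodMk (Measurable.prodMk ?_ (measurable_pi_lambda _ fun a => ?_))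
  · exact Int.measurable_floor.comp (by fun_prop)
  · exact Int.measurable_floor.comp (by fun_prop)

theorem measurable_maxCube (hL : 0 < L) (hφ : Continuous φ) : Measurable (maxCube L z φ) := by
  classical
  -- The alternative y ∉ region gives the level the default value 0 outside the region, so that it
  -- is everywhere the least element of a nonempty set.
  have hex : ∀ y, ∃ k, y ∉ region L z φ ∨ Good L z φ (cube L z k y) := fun y => by
    by_cases hy : y ∈ region L z φ
    · exact (exists_good hL hφ hy).imp fun k hk => Or.inr hk
    · exact ⟨0, Or.inl hy⟩
  have h1 : level L z φ = fun y => Nat.find (hex y) := funext fun y =>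
    ((Nat.find_eq_iff (hex y)).2 ⟨Nat.sInf_mem (hex y), fun n hn => Nat.notMem_of_lt_sInf hn⟩).symm
  have h2 : Measurable (level L z φ) := by
    rw [h1]
    exact measurable_find hex fun k => ((measurableSet_region hφ).compl).union
      (measurable_cube k (MeasurableSet.of_discrete (s := {s | Good L z φ s})))
  refine measurable_to_countable' fun s => ?_
  have h3 : maxCube L z φ ⁻¹' {s} = level L z φ ⁻¹' {s.1} ∩ cube L z s.1 ⁻¹' {s} := by
    ext y
    simp only [mem_preimage, mem_singleton_iff, mem_inter_iff]
    constructor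
    · rintro rfl
      exact ⟨rfl, rfl⟩
    · rintro ⟨h4, h5⟩
      rw [maxCube, h4, h5]
  rw [h3]
  exact (h2 (measurableSet_singleton _)).inter (measurable_cube _ (measurableSet_singleton _))

theorem floor_nonneg_of_mem_base (hL : 0 < L) {x : Fin m → ℝ} (hx : x ∈ base L m) (k : ℕ)
    (a : Fin m) : 0 ≤ ⌊(x a + L / 2) / side L k⌋ :=
  Int.floor_nonneg.2 (div_nonneg (by linarith [(hx a).1]) (side_pos hL k).le)

theorem dist_corner_zero_le (hL : 0 < L) {y : ℝ × (Fin m → ℝ)} (hy : y.2 ∈ base L m) (k : ℕ) :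
    dist (corner L (cube L z k y)) 0 ≤ L / 2 := by
  refine (dist_pi_le_iff (by positivity)).2 fun a => ?_
  rw [Real.dist_eq, Pi.zero_apply, sub_zero, abs_le]
  have h1 := corner_cube_le (z := z) hL k y a
  have h2 : (0 : ℝ) ≤ (⌊(y.2 a + L / 2) / side L k⌋ : ℝ) := by
    exact_mod_cast floor_nonneg_of_mem_base hL hy k a
  have h3 := mul_nonneg h2 (side_pos hL k).le
  refine ⟨?_, by linarith [(hy a).2]⟩
  simp only [corner, cube]
  linarith

/-- A maximal good cube of positive generation is close to the graph. -/
theorem exists_near_graph (hL : 0 < L) {y : ℝ × (Fin m → ℝ)} (hy : y ∈ region L z φ)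
    (h0 : level L z φ y ≠ 0) : ∃ x, dist x y.2 ≤ 6 * side L (level L z φ y) ∧
      dist x 0 ≤ 5 / 2 * L ∧ φ x ≤ y.1 + 4 * side L (level L z φ y) := by
  -- By minimality the parent cube, of generation k and twice the side, is not good. Its witness x
  -- gives the constants: 6 = 2(2 + 1) for the distance to y, 4 = 2 · 2 for the height, and 5/2 = 2
  -- + 1/2.
  obtain ⟨k, hk⟩ := Nat.exists_eq_succ_of_ne_zero h0
  have h1 : ¬ Good L z φ (cube L z k y) := fun h => by
    have := level_le h
    omega
  have hs : side L k = 2 * side L (level L z φ y) := by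
    rw [side_add L k 1, hk]; norm_num
  simp only [Good, not_forall, not_lt] at h1
  obtain ⟨x, h2, h3⟩ := h1
  have h4 := dist_corner_cube_le (z := z) hL k y
  have h5 := bot_cube_le (z := z) hL k y
  have h6 := dist_corner_zero_le (z := z) hL hy.1 k
  have h7 := side_le hL k
  change dist x (corner L (cube L z k y)) ≤ 2 * side L k at h2
  change φ x ≤ bot L z (cube L z k y) + 2 * side L k at h3
  refine ⟨x, ?_, ?_, by linarith⟩
  · linarith [dist_triangle_right x y.2 (corner L (cube L z k y))]
  · linarith [dist_triangle x (corner L (cube L z k y)) 0]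

/-- The distance to the graph in the vertical direction is at most a power of the side. -/
theorem sub_le_side_rpow (hL : 0 < L) (hL1 : L ≤ 1) {α K M : ℝ} (hα : 0 < α) (hα1 : α ≤ 1)
    (hK : 0 ≤ K) (hφ : ∀ x x', |φ x - φ x'| ≤ K * dist x x' ^ α) (hM : ∀ x ∈ base L m, φ x ≤ M)
    (hzM : z ≤ M) {y : ℝ × (Fin m → ℝ)} (hy : y ∈ region L z φ) :
    φ y.2 - y.1 ≤ ((M - z) / L ^ α + 4 + K * 6 ^ α) * side L (level L z φ y) ^ α := by
  have hs := side_pos hL (level L z φ y)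
  have hLα : 0 < L ^ α := by positivity
  have hMz : 0 ≤ (M - z) / L ^ α := div_nonneg (by linarith) hLα.le
  -- At generation 0 the height is at most M - z, paid for by the first summand since the side is L.
  -- Otherwise there is a graph point nearby: it costs 4ℓ ≤ 4ℓ^α, because ℓ ≤ 1 and α ≤ 1, and the
  -- oscillation of φ costs K (6ℓ)^α.
  by_cases h0 : level L z φ y = 0
  · have h1 : side L (level L z φ y) = L := by rw [h0]; simp [side]
    rw [h1]
    have h2 : (M - z) / L ^ α * L ^ α = M - z := by field_simp
    have h3 : 0 ≤ (4 + K * 6 ^ α) * L ^ α := by positivity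
    nlinarith [hM y.2 hy.1, hy.2.1]
  · obtain ⟨x, h1, -, h2⟩ := exists_near_graph hL hy h0
    set ℓ := side L (level L z φ y)
    have h3 := (abs_le.1 (hφ x y.2)).1
    have h4 : dist x y.2 ^ α ≤ 6 ^ α * ℓ ^ α := by
      rw [← Real.mul_rpow (by norm_num) hs.le]
      exact Real.rpow_le_rpow dist_nonneg h1 hα.le
    have h5 : ℓ ≤ ℓ ^ α := by
      have := Real.rpow_le_rpow_of_exponent_ge hs ((side_le hL _).trans hL1) hα1
      rwa [Real.rpow_one] at this
    have h6 : 0 ≤ (M - z) / L ^ α * ℓ ^ α := by positivity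
    have h7 := mul_le_mul_of_nonneg_left h4 hK
    nlinarith

/-- The floor is far enough below the graph for the single cube of generation 0 on it to be good, so
all fibres end in the same root. -/
theorem level_root (hL : 0 < L) (hroot : ∀ x : Fin m → ℝ, dist x 0 ≤ 5 / 2 * L → z + 2 * L < φ x)
    {x : Fin m → ℝ} (hx : x ∈ base L m) :
    (z, x) ∈ region L z φ ∧ maxCube L z φ (z, x) = (0, 0, 0) := by
  have hs : side L 0 = L := by simp [side]
  have h1 : cube L z 0 (z, x) = (0, 0, 0) := by
    simp only [cube, sub_self, zero_div, Int.floor_zero, hs, Prod.mk.injEq, true_and]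
    funext a
    rw [Pi.zero_apply, Int.floor_eq_zero_iff]
    refine ⟨div_nonneg (by linarith [(hx a).1]) hL.le, ?_⟩
    rw [div_lt_one hL]
    linarith [(hx a).2]
  have hx0 : dist x 0 ≤ L / 2 := by
    refine (dist_pi_le_iff (by positivity)).2 fun a => ?_
    rw [Real.dist_eq, Pi.zero_apply, sub_zero, abs_le]
    exact ⟨by linarith [(hx a).1], (hx a).2.le⟩
  have h2 : (z, x) ∈ region L z φ := ⟨hx, le_rfl, by linarith [hroot x (by linarith)]⟩
  have h3 : level L z φ (z, x) = 0 := by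
    refine Nat.le_zero.1 (level_le fun x' hx' => ?_)
    have h4 := dist_corner_zero_le (z := z) (y := (z, x)) hL hx 0
    change dist x' (corner L (cube L z 0 (z, x))) ≤ 2 * side L 0 at hx'
    rw [hs] at hx'
    have h5 := hroot x' (by linarith [dist_triangle x' (corner L (cube L z 0 (z, x))) 0])
    simp only [bot, cube, sub_self, zero_div, Int.floor_zero, hs]
    simpa using h5
  exact ⟨h2, by rw [maxCube, h3, h1]⟩

/-- A lower bound on the side bounds the generation, and the region is bounded, so only finitely
many positions remain. This is what makes the covering locally finite. -/
theorem finite_maxCube (hL : 0 < L) {M : ℝ} (hM : ∀ x ∈ base L m, φ x ≤ M) {η : ℝ} (hη : 0 < η) :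
    {s : Index m | (∃ y ∈ region L z φ, maxCube L z φ y = s) ∧ η ≤ side L s.1}.Finite := by
  obtain ⟨k₀, hk₀⟩ := ((tendsto_side L).eventually (gt_mem_nhds hη)).exists
  set N : ℤ := ⌈(M - z + L) / side L k₀⌉
  refine ((Set.finite_Icc 0 k₀).prod ((Set.finite_Icc 0 N).prod
    (Set.finite_Icc (0 : Fin m → ℤ) fun _ => N))).subset ?_
  rintro s ⟨⟨y, hy, rfl⟩, h⟩
  have hlt : level L z φ y ≤ k₀ := by
    by_contra h1
    exact absurd (h.trans (side_anti hL (not_le.1 h1).le)) (not_le.2 hk₀)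
  have hs := side_anti hL hlt
  have hs0 := side_pos hL k₀
  have hb : ∀ u : ℝ, 0 ≤ u → u ≤ M - z + L → ⌊u / side L (level L z φ y)⌋ ≤ N := by
    intro u hu h1
    refine (Int.floor_le_ceil _).trans (Int.ceil_le_ceil ?_)
    exact div_le_div₀ (hu.trans h1) h1 hs0 hs
  have hzM : z ≤ M := hy.2.1.trans (hy.2.2.le.trans (hM _ hy.1))
  refine ⟨⟨Nat.zero_le _, hlt⟩, ⟨?_, ?_⟩, fun a => floor_nonneg_of_mem_base hL hy.1 _ a, fun a => ?_⟩
  · exact Int.floor_nonneg.2 (div_nonneg (by linarith [hy.2.1]) (side_pos hL _).le)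
  · exact hb _ (by linarith [hy.2.1]) (by linarith [hy.2.2, hM _ hy.1])
  · exact hb _ (by linarith [(hy.1 a).1]) (by linarith [(hy.1 a).2])

end DyadicCube

/-! ### Cartesian coordinates with a distinguished vertical direction -/

/-- The vertical coordinate is put in front of the horizontal ones. -/
noncomputable def consIsometry (m : ℕ) :
    WithLp 2 (EuclideanSpace ℝ (Fin m) × ℝ) ≃ₗᵢ[ℝ] EuclideanSpace ℝ (Fin (m + 1)) where
  toFun v := WithLp.toLp 2 (Fin.cons v.snd v.fst)
  map_add' v w := by
    ext i
    refine Fin.cases ?_ (fun a => ?_) i <;> simp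
  map_smul' c v := by
    ext i
    refine Fin.cases ?_ (fun a => ?_) i <;> simp
  invFun v := WithLp.toLp 2 (WithLp.toLp 2 fun a => v a.succ, v 0)
  left_inv v := by
    refine WithLp.ofLp_injective 2 (Prod.ext ?_ ?_)
    · ext a; simp
    · simp
  right_inv v := by
    ext i
    refine Fin.cases ?_ (fun a => ?_) i <;> simp
  norm_map' v := by
    simp only [LinearEquiv.coe_mk, LinearMap.coe_mk, AddHom.coe_mk]
    rw [EuclideanSpace.norm_eq, WithLp.prod_norm_eq_of_L2, Fin.sum_univ_succ, EuclideanSpace.norm_eq,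
      Real.sq_sqrt (Finset.sum_nonneg fun i _ => sq_nonneg _)]
    simp [add_comm]

section Coords

variable {m : ℕ} (Ψ : EuclideanSpace ℝ (Fin (m + 1)) ≃ᵃⁱ[ℝ] EuclideanSpace ℝ (Fin (m + 1)))

/-- The coordinates of a point with respect to a Cartesian system, the vertical one first. -/
noncomputable def coords : EuclideanSpace ℝ (Fin (m + 1)) ≃ᵐ ℝ × (Fin m → ℝ) :=
  (Ψ.toHomeomorph.toMeasurableEquiv.trans (MeasurableEquiv.toLp 2 (Fin (m + 1) → ℝ)).symm).trans
    (MeasurableEquiv.piFinSuccAbove (fun _ => ℝ) 0)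

theorem coords_fst (x : EuclideanSpace ℝ (Fin (m + 1))) : (coords Ψ x).1 = Ψ x 0 := rfl

theorem coords_snd (x : EuclideanSpace ℝ (Fin (m + 1))) (a : Fin m) :
    (coords Ψ x).2 a = Ψ x a.succ := rfl

theorem AffineIsometryEquiv.volume_preserving :
    MeasurePreserving Ψ (volume : Measure (EuclideanSpace ℝ (Fin (m + 1)))) volume := by
  have h : (Ψ : EuclideanSpace ℝ (Fin (m + 1)) → EuclideanSpace ℝ (Fin (m + 1))) =
      (fun x => x + Ψ 0) ∘ Ψ.linearIsometryEquiv := by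
    ext1 x
    have := Ψ.map_vadd 0 x
    simpa using this
  rw [h]
  exact (measurePreserving_add_right volume (Ψ 0)).comp Ψ.linearIsometryEquiv.measurePreserving

theorem volume_preserving_coords : MeasurePreserving (coords Ψ) volume volume :=
  (volume_preserving_piFinSuccAbove (fun _ => ℝ) 0).comp
    ((PiLp.volume_preserving_ofLp (Fin (m + 1))).comp (AffineIsometryEquiv.volume_preserving Ψ))

theorem dist_coords_le (x y : EuclideanSpace ℝ (Fin (m + 1))) :
    dist (coords Ψ x) (coords Ψ y) ≤ dist x y := by
  have h : ∀ i, dist (Ψ x i) (Ψ y i) ≤ dist x y := fun i => by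
    rw [← Ψ.dist_map x y, dist_eq_norm (Ψ x), Real.dist_eq, ← Real.norm_eq_abs]
    exact PiLp.norm_apply_le (Ψ x - Ψ y) i
  rw [Prod.dist_eq]
  exact max_le (h 0) ((dist_pi_le_iff dist_nonneg).2 fun a => h a.succ)

theorem dist_le_dist_coords (x y : EuclideanSpace ℝ (Fin (m + 1))) :
    dist x y ≤ (m + 1) * dist (coords Ψ x) (coords Ψ y) := by
  set D := dist (coords Ψ x) (coords Ψ y) with hD
  have hD0 : 0 ≤ D := dist_nonneg
  have h : ∀ i, dist (Ψ x i) (Ψ y i) ≤ D := by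
    rw [hD, Prod.dist_eq]
    refine Fin.cases (le_max_left _ _) fun a => ?_
    exact (dist_le_pi_dist (coords Ψ x).2 (coords Ψ y).2 a).trans (le_max_right _ _)
  rw [← Ψ.dist_map x y, EuclideanSpace.dist_eq]
  refine Real.sqrt_le_iff.2 ⟨by positivity, ?_⟩
  calc ∑ i, dist (Ψ x i) (Ψ y i) ^ 2 ≤ ∑ _i : Fin (m + 1), D ^ 2 :=
        Finset.sum_le_sum fun i _ => by gcongr; exact h i
    _ = (m + 1) * D ^ 2 := by simp
    _ ≤ ((m + 1) * D) ^ 2 := by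
      have : (0 : ℝ) ≤ m := Nat.cast_nonneg m
      nlinarith [mul_nonneg this (sq_nonneg D), mul_nonneg (mul_nonneg this this) (sq_nonneg D)]

theorem continuous_coords : Continuous (coords Ψ) :=
  continuous_iff_continuousAt.2 fun x => Metric.tendsto_nhds_nhds.2 fun ε hε =>
    ⟨ε, hε, fun {y} hy => (dist_coords_le Ψ y x).trans_lt hy⟩

/-- An open box in coordinates, as a set of the form used for cubes. -/
theorem coords_box_eq (c : ℝ × (Fin m → ℝ)) (u v : ℝ) :
    ∃ Φ : EuclideanSpace ℝ (Fin (m + 1)) ≃ᵃⁱ[ℝ] EuclideanSpace ℝ (Fin (m + 1)),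
      {x | (c.1 < (coords Ψ x).1 ∧ (coords Ψ x).1 < c.1 + u) ∧
        ∀ a, c.2 a < (coords Ψ x).2 a ∧ (coords Ψ x).2 a < c.2 a + v} =
      {x | ∀ i, Φ x i ∈ Ioo 0 (if i = 0 then u else v)} := by
  refine ⟨Ψ.trans (AffineIsometryEquiv.constVAdd ℝ (EuclideanSpace ℝ (Fin (m + 1)))
    (WithLp.toLp 2 (Fin.cons (-c.1) fun a => -c.2 a))), ?_⟩
  ext x
  simp only [mem_ofPred_eq, Fin.forall_fin_succ, coords_fst, coords_snd,
    AffineIsometryEquiv.coe_trans, Function.comp_apply, AffineIsometryEquiv.coe_constVAdd, vadd_eq_add,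
    PiLp.add_apply, Fin.cons_zero, Fin.cons_succ, if_true, Fin.succ_ne_zero, if_false, mem_Ioo,
    neg_add_eq_sub, sub_pos, sub_lt_iff_lt_add']

end Coords

/-! ### The distance to the boundary -/

section BoundaryDist

variable {n : ℕ} {Ω : Set (EuclideanSpace ℝ (Fin n))}

theorem le_boundaryDist (hΩ : IsOpen Ω) (hne : (frontier Ω).Nonempty) {x : EuclideanSpace ℝ (Fin n)}
    {ρ : ℝ} (h : Metric.ball x ρ ⊆ Ω) : ρ ≤ boundaryDist Ω x := by
  refine (Metric.le_infDist hne).2 fun y hy => ?_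
  by_contra h1
  have h2 : y ∈ Ω := h (by rw [Metric.mem_ball, dist_comm]; exact not_le.1 h1)
  rw [hΩ.frontier_eq] at hy
  exact hy.2 h2

/-- The segment from x to w is connected and leaves Ω, so it meets the frontier. -/
theorem boundaryDist_le (hΩ : IsOpen Ω) {x w : EuclideanSpace ℝ (Fin n)} (hx : x ∈ Ω)
    (hw : w ∉ Ω) : boundaryDist Ω x ≤ dist x w := by
  obtain ⟨u, hu, hu'⟩ : (segment ℝ x w ∩ frontier Ω).Nonempty := by
    by_contra hne
    rw [not_nonempty_iff_eq_empty] at hne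
    have hcl : ∀ y ∈ segment ℝ x w, y ∉ Ω → y ∈ (closure Ω)ᶜ := fun y hy hyΩ hyc =>
      (eq_empty_iff_forall_notMem.1 hne y) ⟨hy, by rw [hΩ.frontier_eq]; exact ⟨hyc, hyΩ⟩⟩
    obtain ⟨y, -, hy1, hy2⟩ := (convex_segment x w).isPreconnected Ω (closure Ω)ᶜ hΩ
      isClosed_closure.isOpen_compl (fun y hy => or_iff_not_imp_left.2 (hcl y hy))
      ⟨x, left_mem_segment ℝ x w, hx⟩
      ⟨w, right_mem_segment ℝ x w, hcl w (right_mem_segment ℝ x w) hw⟩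
    exact hy2 (subset_closure hy1)
  refine (Metric.infDist_le_dist_of_mem hu').trans ?_
  have := dist_add_dist_of_mem_segment hu
  linarith [dist_nonneg (x := u) (y := w)]

theorem boundaryDist_pos (hΩ : IsOpen Ω) (hne : (frontier Ω).Nonempty)
    {x : EuclideanSpace ℝ (Fin n)} (hx : x ∈ Ω) : 0 < boundaryDist Ω x := by
  obtain ⟨ε, hε, h⟩ := Metric.isOpen_iff.1 hΩ x hx
  exact hε.trans_le (le_boundaryDist hΩ hne h)

theorem exists_boundaryDist_le (hΩ : Bornology.IsBounded Ω) :
    ∃ R : ℝ, 0 < R ∧ ∀ x ∈ Ω, boundaryDist Ω x ≤ R := by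
  rcases (frontier Ω).eq_empty_or_nonempty with h | ⟨w, hw⟩
  · exact ⟨1, one_pos, fun x _ => by simp [boundaryDist, h]⟩
  · obtain ⟨R, hR⟩ := hΩ.subset_closedBall w
    refine ⟨max R 1, by positivity, fun x hx => ?_⟩
    exact ((Metric.infDist_le_dist_of_mem hw).trans (hR hx)).trans (le_max_left _ _)

theorem measurable_boundaryDist : Measurable (boundaryDist Ω) :=
  (Metric.continuous_infDist_pt _).measurable

end BoundaryDist

/-! ### Charts at the boundary -/

/-- Cartesian coordinates in which `Ω` is the subgraph of a Hölder function `φ` in the cylinder over a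
cube of side `5 L` and between the heights `-h` and `h`. -/
structure IsBoundaryChart {m : ℕ} (α : ℝ) (Ω : Set (EuclideanSpace ℝ (Fin (m + 1))))
    (Ψ : EuclideanSpace ℝ (Fin (m + 1)) ≃ᵃⁱ[ℝ] EuclideanSpace ℝ (Fin (m + 1)))
    (φ : (Fin m → ℝ) → ℝ) (K L h : ℝ) : Prop where
  side_pos : 0 < L
  side_le_one : L ≤ 1
  side_le : L ≤ h / 16
  const_nonneg : 0 ≤ K
  continuous : Continuous φ
  holder : ∀ x x', |φ x - φ x'| ≤ K * dist x x' ^ α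
  abs_lt : ∀ x, dist x 0 ≤ 5 / 2 * L → |φ x| < h / 8
  mem_iff : ∀ x, dist (coords Ψ x).2 0 ≤ 5 / 2 * L → |(coords Ψ x).1| < h →
    (x ∈ Ω ↔ (coords Ψ x).1 < φ (coords Ψ x).2)

/-- The coordinatewise projection onto a cube. -/
noncomputable def clamp {m : ℕ} (c : ℝ) (x : Fin m → ℝ) : Fin m → ℝ :=
  fun a => max (min c (x a)) (-c)

theorem dist_clamp_le {m : ℕ} (c : ℝ) (x y : Fin m → ℝ) : dist (clamp c x) (clamp c y) ≤ dist x y := by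
  refine (dist_pi_le_iff dist_nonneg).2 fun a => le_trans ?_ (dist_le_pi_dist x y a)
  rw [Real.dist_eq, Real.dist_eq]
  exact (abs_max_sub_max_le_abs _ _ _).trans (by
    simpa [min_comm] using abs_min_sub_min_le_max c (x a) c (y a))

theorem dist_clamp_zero_le {m : ℕ} {c : ℝ} (hc : 0 ≤ c) (x : Fin m → ℝ) : dist (clamp c x) 0 ≤ c := by
  refine (dist_pi_le_iff hc).2 fun a => ?_
  rw [Pi.zero_apply, Real.dist_eq, sub_zero, abs_le]
  exact ⟨le_max_right _ _, max_le (min_le_left _ _) (by linarith)⟩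

theorem clamp_eq_self {m : ℕ} {c : ℝ} {x : Fin m → ℝ} (hx : dist x 0 ≤ c) : clamp c x = x := by
  ext a
  have h := (dist_le_pi_dist x 0 a).trans hx
  rw [Pi.zero_apply, Real.dist_eq, sub_zero, abs_le] at h
  rw [clamp, min_eq_right h.2, max_eq_left h.1]

theorem dist_toLp_le {m : ℕ} (x y : Fin m → ℝ) :
    dist (WithLp.toLp 2 x : EuclideanSpace ℝ (Fin m)) (WithLp.toLp 2 y) ≤ (m + 1) * dist x y := by
  rw [EuclideanSpace.dist_eq]
  have h0 : 0 ≤ dist x y := dist_nonneg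
  refine Real.sqrt_le_iff.2 ⟨by positivity, ?_⟩
  calc ∑ i, dist (x i) (y i) ^ 2 ≤ ∑ _i : Fin m, dist x y ^ 2 :=
        Finset.sum_le_sum fun i _ => by gcongr; exact dist_le_pi_dist x y i
    _ = m * dist x y ^ 2 := by simp
    _ ≤ ((m + 1) * dist x y) ^ 2 := by
      have : (0 : ℝ) ≤ m := Nat.cast_nonneg m
      nlinarith [mul_nonneg this (sq_nonneg (dist x y)), sq_nonneg (dist x y),
        mul_nonneg (mul_nonneg this this) (sq_nonneg (dist x y))]

/-- The graph function vanishes at the origin and is Hölder, so on a small enough cube it is small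
compared with h. Beyond that cube it is replaced by a global Hölder extension. -/
theorem exists_isBoundaryChart {m : ℕ} {α : ℝ} (hα : 0 < α)
    {Ω : Set (EuclideanSpace ℝ (Fin (m + 1)))} (hΩ : IsBoundedHolderDomain α Ω)
    {x₀ : EuclideanSpace ℝ (Fin (m + 1))} (hx₀ : x₀ ∈ frontier Ω) :
    ∃ (Ψ : EuclideanSpace ℝ (Fin (m + 1)) ≃ᵃⁱ[ℝ] EuclideanSpace ℝ (Fin (m + 1)))
      (φ : (Fin m → ℝ) → ℝ) (K L h : ℝ), IsBoundaryChart α Ω Ψ φ K L h ∧ Ψ x₀ = 0 := by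
  obtain ⟨Φ, r, h, φ₀, hr, hh, hΦ, ⟨K₀, hK₀⟩, hmem⟩ := hΩ.boundary x₀ hx₀
  change EuclideanSpace ℝ (Fin (m + 1)) ≃ᵃⁱ[ℝ] WithLp 2 (EuclideanSpace ℝ (Fin m) × ℝ) at Φ
  change EuclideanSpace ℝ (Fin m) → ℝ at φ₀
  set Ψ : EuclideanSpace ℝ (Fin (m + 1)) ≃ᵃⁱ[ℝ] EuclideanSpace ℝ (Fin (m + 1)) :=
    Φ.trans (consIsometry m).toAffineIsometryEquiv with hΨ
  have hfst : ∀ x, (coords Ψ x).1 = (Φ x).snd := fun x => rfl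
  have hsnd : ∀ x, WithLp.toLp 2 (coords Ψ x).2 = (Φ x).fst := fun x => rfl
  set K₁ : ℝ := max K₀ 0 with hK₁
  have hholder₀ : ∀ x ∈ Metric.ball (0 : EuclideanSpace ℝ (Fin m)) r, ∀ y ∈ Metric.ball 0 r,
      |φ₀ x - φ₀ y| ≤ K₁ * dist x y ^ α := fun x hx y hy => by
    refine (hK₀ x hx y hy).trans ?_
    rw [dist_eq_norm]
    gcongr
    exact le_max_left _ _
  have hnorm : ∀ x : Fin m → ℝ, ‖(WithLp.toLp 2 x : EuclideanSpace ℝ (Fin m))‖ ≤ (m + 1) * dist x 0 := by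
    intro x
    have := dist_toLp_le x 0
    rwa [WithLp.toLp_zero, dist_zero_right] at this
  -- x₀ is not in Ω, which excludes φ₀ 0 > 0. It is a limit of points of Ω, at which φ₀ exceeds a
  -- height tending to 0, and by Hölder continuity this excludes φ₀ 0 < 0.
  have hφ₀0 : φ₀ 0 = 0 := by
    rw [hΩ.isOpen.frontier_eq] at hx₀
    have h0 := hmem x₀ (by rw [hΦ]; simpa using hr) (by rw [hΦ]; simpa using hh)
    rw [hΦ] at h0
    refine le_antisymm (not_lt.1 fun h1 => hx₀.2 (h0.2 h1)) (not_lt.1 fun hneg => ?_)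
    have hc1 : Filter.Tendsto (fun x => (Φ x).fst) (nhds x₀) (nhds 0) := by
      have : Continuous fun x => (Φ x).fst := by
        have := Φ.continuous
        fun_prop
      simpa [hΦ] using this.tendsto x₀
    have hc2 : Filter.Tendsto (fun x => (Φ x).snd) (nhds x₀) (nhds 0) := by
      have : Continuous fun x => (Φ x).snd := by
        have := Φ.continuous
        fun_prop
      simpa [hΦ] using this.tendsto x₀
    have hc3 : Filter.Tendsto (fun x => K₁ * dist (Φ x).fst 0 ^ α) (nhds x₀) (nhds 0) := by
      have := ((tendsto_iff_dist_tendsto_zero.1 hc1).rpow_const (p := α) (Or.inr hα.le)).const_mul K₁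
      simpa [Real.zero_rpow hα.ne'] using this
    have e1 := hc1.eventually (Metric.ball_mem_nhds 0 hr)
    have e2 := hc2.eventually (Metric.ball_mem_nhds 0 hh)
    have e3 := hc2.eventually (lt_mem_nhds (show φ₀ 0 / 2 < 0 by linarith))
    have e4 := hc3.eventually (gt_mem_nhds (show 0 < -(φ₀ 0 / 2) by linarith))
    have e5 := mem_closure_iff_frequently.1 hx₀.1
    obtain ⟨x, hxΩ, ⟨⟨a1, a2⟩, a3⟩, a4⟩ := (e5.and_eventually (((e1.and e2).and e3).and e4)).exists
    have a5 := (hmem x (by simpa using a1) (by simpa using a2)).1 hxΩ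
    have a6 := (abs_le.1 (hholder₀ _ a1 0 (Metric.mem_ball_self hr))).2
    linarith
  obtain ⟨L, hL0, hL1, hL2, hL3, hL4⟩ : ∃ L : ℝ, 0 < L ∧ L ≤ 1 ∧ L ≤ h / 16 ∧
      (m + 1) * (5 / 2 * L) < r ∧ K₁ * ((m + 1) * (5 / 2 * L)) ^ α < h / 8 := by
    have h1 : Filter.Tendsto (fun L : ℝ => (m + 1) * (5 / 2 * L)) (nhds 0) (nhds 0) := by
      have : Continuous fun L : ℝ => (m + 1) * (5 / 2 * L) := by fun_prop
      simpa using this.tendsto 0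
    have h2 : Filter.Tendsto (fun L : ℝ => K₁ * ((m + 1) * (5 / 2 * L)) ^ α) (nhds 0) (nhds 0) := by
      have := (h1.rpow_const (p := α) (Or.inr hα.le)).const_mul K₁
      simpa [Real.zero_rpow hα.ne'] using this
    have h3 := ((((eventually_le_nhds (zero_lt_one (α := ℝ))).and
      (eventually_le_nhds (show (0 : ℝ) < h / 16 by positivity))).and
      (h1.eventually (gt_mem_nhds hr))).and (h2.eventually (gt_mem_nhds
        (show (0 : ℝ) < h / 8 by positivity)))).filter_mono
        (nhdsWithin_le_nhds (s := Ioi (0 : ℝ)))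
    obtain ⟨L, ⟨⟨⟨a1, a2⟩, a3⟩, a4⟩, a5⟩ := (h3.and self_mem_nhdsWithin).exists
    exact ⟨L, a5, a1, a2, a3, a4⟩
  have hball : ∀ x : Fin m → ℝ, dist x 0 ≤ 5 / 2 * L →
      (WithLp.toLp 2 x : EuclideanSpace ℝ (Fin m)) ∈ Metric.ball 0 r := fun x hx => by
    rw [mem_ball_zero_iff]
    refine (hnorm x).trans_lt (lt_of_le_of_lt ?_ hL3)
    gcongr
  -- Composing with the 1-Lipschitz projection onto the cube keeps the Hölder bound and makes it
  -- global; the factor (m + 1)^α in K comes from comparing the Euclidean with the sup norm.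
  set φ : (Fin m → ℝ) → ℝ := fun x => φ₀ (WithLp.toLp 2 (clamp (5 / 2 * L) x)) with hφ
  set K : ℝ := K₁ * (m + 1) ^ α with hK
  have hK0 : 0 ≤ K := by positivity
  have hc := fun x : Fin m → ℝ => hball _ (dist_clamp_zero_le (show 0 ≤ 5 / 2 * L by positivity) x)
  have hholder : ∀ x x', |φ x - φ x'| ≤ K * dist x x' ^ α := fun x x' => by
    refine (hholder₀ _ (hc x) _ (hc x')).trans ?_
    rw [hK, mul_assoc, ← Real.mul_rpow (by positivity) dist_nonneg]
    have := dist_clamp_le (5 / 2 * L) x x'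
    gcongr
    exact (dist_toLp_le _ _).trans (by gcongr)
  have hcont : Continuous φ := by
    refine continuous_iff_continuousAt.2 fun x => ?_
    rw [ContinuousAt, tendsto_iff_dist_tendsto_zero]
    have h1 : Filter.Tendsto (fun y => K * dist y x ^ α) (nhds x) (nhds 0) := by
      have h2 : Filter.Tendsto (fun y => dist y x) (nhds x) (nhds 0) :=
        tendsto_iff_dist_tendsto_zero.1 Filter.tendsto_id
      simpa [Real.zero_rpow hα.ne'] using (h2.rpow_const (p := α) (Or.inr hα.le)).const_mul K
    exact squeeze_zero (fun _ => dist_nonneg) (fun y => hholder y x) h1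
  refine ⟨Ψ, φ, K, L, h, ⟨hL0, hL1, hL2, hK0, hcont, hholder, fun x hx => ?_, fun x hx hx' => ?_⟩, ?_⟩
  · have h1 := hholder₀ _ (hball x hx) 0 (Metric.mem_ball_self hr)
    rw [hφ₀0, sub_zero, dist_zero_right] at h1
    simp only [hφ]
    rw [clamp_eq_self hx]
    refine h1.trans_lt (lt_of_le_of_lt ?_ hL4)
    gcongr
    exact (hnorm x).trans (by gcongr)
  · have h1 := hmem x (by
      have := hball _ hx
      rwa [hsnd, mem_ball_zero_iff] at this) hx'
    rw [h1]
    simp only [hφ]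
    rw [clamp_eq_self hx]
    rfl
  · rw [hΨ, AffineIsometryEquiv.coe_trans, Function.comp_apply, hΦ]
    simp

/-! ### The cubes of a boundary chart -/

namespace IsBoundaryChart

open DyadicCube FibrePartition

variable {m : ℕ} {α : ℝ} {Ω : Set (EuclideanSpace ℝ (Fin (m + 1)))}
  {Ψ : EuclideanSpace ℝ (Fin (m + 1)) ≃ᵃⁱ[ℝ] EuclideanSpace ℝ (Fin (m + 1))}
  {φ : (Fin m → ℝ) → ℝ} {K L h R : ℝ}

/-- The height of the lower face of the box that belongs to a dyadic cube. -/
noncomputable def boxBot (L h : ℝ) (s : Index m) : ℝ :=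
  open Classical in if s = (0, 0, 0) then bot L (-(h / 2)) s else
    bot L (-(h / 2)) s - side L s.1 / 2

/-- The closed box that belongs to a dyadic cube: the cube at the bottom, and otherwise the cube
extended downwards by half of its side. -/
def closedBox (L h : ℝ) (s : Index m) : Set (ℝ × (Fin m → ℝ)) :=
  {y | (boxBot L h s ≤ y.1 ∧ y.1 ≤ bot L (-(h / 2)) s + side L s.1) ∧
    ∀ a, corner L s a ≤ y.2 a ∧ y.2 a ≤ corner L s a + side L s.1}

/-- The open box that belongs to a dyadic cube. -/
def openBox (L h : ℝ) (s : Index m) : Set (ℝ × (Fin m → ℝ)) :=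
  {y | (boxBot L h s < y.1 ∧ y.1 < bot L (-(h / 2)) s + side L s.1) ∧
    ∀ a, corner L s a < y.2 a ∧ y.2 a < corner L s a + side L s.1}

theorem openBox_subset_closedBox (L h : ℝ) (s : Index m) : openBox L h s ⊆ closedBox L h s :=
  fun _ hy => ⟨⟨hy.1.1.le, hy.1.2.le⟩, fun a => ⟨(hy.2 a).1.le, (hy.2 a).2.le⟩⟩

theorem isOpen_openBox (L h : ℝ) (s : Index m) : IsOpen (openBox L h s) := by
  have h1 : openBox L h s = (Prod.fst ⁻¹' Ioo (boxBot L h s) (bot L (-(h / 2)) s + side L s.1)) ∩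
      Prod.snd ⁻¹' (Set.univ.pi fun a => Ioo (corner L s a) (corner L s a + side L s.1)) := by
    ext y
    simp [openBox]
  rw [h1]
  exact (isOpen_Ioo.preimage continuous_fst).inter
    ((isOpen_set_pi Set.finite_univ fun a _ => isOpen_Ioo).preimage continuous_snd)

theorem le_boxBot (hL : 0 < L) (s : Index m) : bot L (-(h / 2)) s - side L s.1 / 2 ≤ boxBot L h s := by
  unfold boxBot
  have := DyadicCube.side_pos hL s.1
  split_ifs <;> linarith

theorem boxBot_le (hL : 0 < L) (s : Index m) : boxBot L h s ≤ bot L (-(h / 2)) s := by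
  unfold boxBot
  have := DyadicCube.side_pos hL s.1
  split_ifs <;> linarith

theorem isOpenCube_or_isExtendedOpenCube (hL : 0 < L) (s : Index m) :
    IsOpenCube (coords Ψ ⁻¹' openBox L h s) ∨ IsExtendedOpenCube (coords Ψ ⁻¹' openBox L h s) := by
  have hs := DyadicCube.side_pos hL s.1
  by_cases h0 : s = (0, 0, 0)
  · left
    obtain ⟨Φ, hΦ⟩ := coords_box_eq Ψ (bot L (-(h / 2)) s, corner L s) (side L s.1) (side L s.1)
    refine ⟨Φ, side L s.1, hs, ?_⟩
    simp only [ite_self] at hΦ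
    rw [← hΦ]
    ext x
    simp only [openBox, boxBot, if_pos h0]
    rfl
  · right
    obtain ⟨Φ, hΦ⟩ := coords_box_eq Ψ (bot L (-(h / 2)) s - side L s.1 / 2, corner L s)
      (3 / 2 * side L s.1) (side L s.1)
    refine ⟨Φ, side L s.1, 0, hs, ?_⟩
    rw [← hΦ]
    ext x
    simp only [openBox, boxBot, if_neg h0, mem_preimage, mem_ofPred_eq]
    rw [show bot L (-(h / 2)) s - side L s.1 / 2 + 3 / 2 * side L s.1 =
      bot L (-(h / 2)) s + side L s.1 by ring]

theorem dist_corner_le_of_mem_closedBox (hL : 0 < L) {s : Index m} {y : ℝ × (Fin m → ℝ)}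
    (hy : y ∈ closedBox L h s) : dist y.2 (corner L s) ≤ side L s.1 := by
  refine (dist_pi_le_iff (DyadicCube.side_pos hL _).le).2 fun a => ?_
  rw [Real.dist_eq, abs_le]
  have := DyadicCube.side_pos hL s.1
  constructor <;> linarith [(hy.2 a).1, (hy.2 a).2]

/-- The part of `Ω` covered by the columns of the chart. -/
def patch (Ψ : EuclideanSpace ℝ (Fin (m + 1)) ≃ᵃⁱ[ℝ] EuclideanSpace ℝ (Fin (m + 1)))
    (φ : (Fin m → ℝ) → ℝ) (L h : ℝ) : Set (EuclideanSpace ℝ (Fin (m + 1))) :=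
  coords Ψ ⁻¹' region L (-(h / 2)) φ

theorem h_pos (H : IsBoundaryChart α Ω Ψ φ K L h) : 0 < h := by
  linarith [H.side_pos, H.side_le]

theorem dist_zero_of_mem_base (hL : 0 < L) {x : Fin m → ℝ} (hx : x ∈ base L m) :
    dist x 0 ≤ L / 2 := by
  refine (dist_pi_le_iff (by positivity)).2 fun a => ?_
  rw [Real.dist_eq, Pi.zero_apply, sub_zero, abs_le]
  exact ⟨(hx a).1, (hx a).2.le⟩

theorem apply_le (H : IsBoundaryChart α Ω Ψ φ K L h) {x : Fin m → ℝ} (hx : x ∈ base L m) :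
    φ x ≤ h / 8 :=
  (_root_.abs_lt.1 (H.abs_lt x ((dist_zero_of_mem_base H.side_pos hx).trans
    (by linarith [H.side_pos])))).2.le

theorem root_good (H : IsBoundaryChart α Ω Ψ φ K L h) (x : Fin m → ℝ)
    (hx : dist x 0 ≤ 5 / 2 * L) : -(h / 2) + 2 * L < φ x := by
  have := (_root_.abs_lt.1 (H.abs_lt x hx)).1
  linarith [H.side_le, H.h_pos]

theorem patch_subset (H : IsBoundaryChart α Ω Ψ φ K L h) : patch Ψ φ L h ⊆ Ω := by
  rintro x ⟨h1, h2, h3⟩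
  have hL := H.side_pos
  have hd : dist (coords Ψ x).2 0 ≤ 5 / 2 * L :=
    (dist_zero_of_mem_base hL h1).trans (by linarith)
  refine (H.mem_iff x hd ?_).2 h3
  have h4 := (_root_.abs_lt.1 (H.abs_lt _ hd)).2
  have := H.h_pos
  rw [_root_.abs_lt]
  constructor <;> linarith

theorem exists_nhds_subset_patch (H : IsBoundaryChart α Ω Ψ φ K L h)
    {x₀ : EuclideanSpace ℝ (Fin (m + 1))} (hx₀ : Ψ x₀ = 0) :
    ∃ N, IsOpen N ∧ x₀ ∈ N ∧ N ∩ Ω ⊆ patch Ψ φ L h := by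
  have hL := H.side_pos
  have hh := H.h_pos
  have h0 : coords Ψ x₀ = 0 := by
    ext
    · rw [coords_fst, hx₀]; rfl
    · rw [coords_snd, hx₀]; rfl
  refine ⟨coords Ψ ⁻¹' Metric.ball 0 (L / 2), (Metric.isOpen_ball).preimage (continuous_coords Ψ),
    by simp [h0, hL], ?_⟩
  rintro x ⟨hx, hxΩ⟩
  rw [mem_preimage, Metric.mem_ball, Prod.dist_eq, max_lt_iff] at hx
  have h1 : |(coords Ψ x).1| < L / 2 := by simpa [Real.dist_eq] using hx.1
  have h2 := H.side_le
  have h3 := _root_.abs_lt.1 h1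
  refine ⟨fun a => ?_, by linarith, ?_⟩
  · have h4 := (dist_le_pi_dist (coords Ψ x).2 0 a).trans_lt hx.2
    rw [Pi.zero_apply, Real.dist_eq, sub_zero, _root_.abs_lt] at h4
    exact ⟨h4.1.le, h4.2⟩
  · exact (H.mem_iff x (hx.2.le.trans (by linarith)) (by linarith)).1 hxΩ

section Boxes

variable (H : IsBoundaryChart α Ω Ψ φ K L h) {y₀ : ℝ × (Fin m → ℝ)}
  (hy₀ : y₀ ∈ region L (-(h / 2)) φ) {x : EuclideanSpace ℝ (Fin (m + 1))}
  (hx : coords Ψ x ∈ closedBox L h (maxCube L (-(h / 2)) φ y₀))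

include H hy₀ hx

/-- The factor 2 in `Good` is made for this: a point within ℓ of the box lies horizontally within 2ℓ
of the corner and below b + 2ℓ, hence below the graph. -/
theorem ball_subset_of_mem_closedBox :
    Metric.ball x (side L (level L (-(h / 2)) φ y₀)) ⊆ Ω := by
  intro w hw
  have hL := H.side_pos
  set s := maxCube L (-(h / 2)) φ y₀ with hs
  set ℓ := side L (level L (-(h / 2)) φ y₀) with hℓ
  have hℓ0 : 0 < ℓ := DyadicCube.side_pos hL _
  have hℓL : ℓ ≤ L := DyadicCube.side_le hL _
  have h1 := (dist_coords_le Ψ w x).trans_lt hw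
  rw [Prod.dist_eq, max_lt_iff, Real.dist_eq, _root_.abs_lt] at h1
  have h2 : dist (coords Ψ w).2 (corner L s) ≤ 2 * ℓ := by
    have h3 := dist_corner_le_of_mem_closedBox hL hx
    change dist _ _ ≤ ℓ at h3
    linarith [dist_triangle (coords Ψ w).2 (coords Ψ x).2 (corner L s)]
  have h4 := level_spec hL H.continuous hy₀ (coords Ψ w).2 h2
  have h5 : dist (coords Ψ w).2 0 ≤ 5 / 2 * L := by
    have := dist_corner_zero_le (z := -(h / 2)) hL hy₀.1 (level L (-(h / 2)) φ y₀)
    change dist (corner L s) 0 ≤ L / 2 at this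
    linarith [dist_triangle (coords Ψ w).2 (corner L s) 0]
  have h6 := _root_.abs_lt.1 (H.abs_lt _ h5)
  have h7 : (coords Ψ x).1 ≤ bot L (-(h / 2)) s + ℓ := hx.1.2
  change bot L (-(h / 2)) s + 2 * ℓ < _ at h4
  have h8 : bot L (-(h / 2)) s - ℓ / 2 ≤ (coords Ψ x).1 := (le_boxBot hL s).trans hx.1.1
  have h9 : -(h / 2) ≤ bot L (-(h / 2)) s := bot_nonneg hL _ hy₀.2.1
  have h10 := H.side_le
  have hh := H.h_pos
  refine (H.mem_iff w h5 ?_).2 (by linarith)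
  rw [_root_.abs_lt]
  constructor <;> linarith

theorem mem_of_mem_closedBox : x ∈ Ω :=
  H.ball_subset_of_mem_closedBox hy₀ hx
    (Metric.mem_ball_self (DyadicCube.side_pos H.side_pos _))

theorem side_le_boundaryDist (hΩ : IsOpen Ω) (hne : (frontier Ω).Nonempty) :
    side L (level L (-(h / 2)) φ y₀) ≤ boundaryDist Ω x :=
  le_boundaryDist hΩ hne (H.ball_subset_of_mem_closedBox hy₀ hx)

/-- For positive generation the failure of the parent cube produces a point outside Ω within 8ℓ in
coordinates. For generation 0 the side is L and the term R / L absorbs the bound R. -/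
theorem boundaryDist_le_side (hΩ : IsOpen Ω) (hR0 : 0 < R) (hR : ∀ x ∈ Ω, boundaryDist Ω x ≤ R) :
    boundaryDist Ω x ≤ (8 * (m + 1) + R / L) * side L (level L (-(h / 2)) φ y₀) := by
  have hL := H.side_pos
  have hxΩ := H.mem_of_mem_closedBox hy₀ hx
  set s := maxCube L (-(h / 2)) φ y₀ with hs
  have hR' := hR x hxΩ
  by_cases h0 : level L (-(h / 2)) φ y₀ = 0
  · have h1 : side L (level L (-(h / 2)) φ y₀) = L := by rw [h0]; simp [side]
    rw [h1, add_mul, div_mul_cancel₀ _ hL.ne']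
    have : 0 ≤ 8 * ((m : ℝ) + 1) * L := by positivity
    linarith
  obtain ⟨x'', h1, h2, h3⟩ := exists_near_graph hL hy₀ h0
  set ℓ := side L (level L (-(h / 2)) φ y₀) with hℓ
  have hℓ0 : 0 < ℓ := DyadicCube.side_pos hL _
  set b := bot L (-(h / 2)) s with hb
  have h4 : b ≤ y₀.1 := bot_cube_le hL _ y₀
  have h5 : y₀.1 < b + ℓ := lt_bot_cube hL _ y₀
  have h6 : -(h / 2) ≤ b := bot_nonneg hL _ hy₀.2.1
  -- The graph may lie far below the cube at x''; taking the maximum with b keeps the point outside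
  -- Ω and still close to the box.
  set w := (coords Ψ).symm (max (φ x'') b, x'') with hw
  have hcw : coords Ψ w = (max (φ x'') b, x'') := (coords Ψ).apply_symm_apply _
  have hh := H.h_pos
  have hφ := _root_.abs_lt.1 (H.abs_lt x'' h2)
  have hbh : b ≤ h / 8 := h4.trans (hy₀.2.2.le.trans (H.apply_le hy₀.1))
  have hwΩ : w ∉ Ω := by
    rw [H.mem_iff w (by rw [hcw]; exact h2) (by
      rw [hcw, _root_.abs_lt]
      exact ⟨lt_max_of_lt_left (by linarith), max_lt (by linarith) (by linarith)⟩), hcw]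
    exact not_lt.2 (le_max_left _ _)
  refine (boundaryDist_le hΩ hxΩ hwΩ).trans ((dist_le_dist_coords Ψ x w).trans ?_)
  have h7 : dist (coords Ψ x) (coords Ψ w) ≤ 8 * ℓ := by
    rw [hcw, Prod.dist_eq]
    refine max_le ?_ ?_
    · have h8 : (coords Ψ x).1 ≤ b + ℓ := hx.1.2
      have h9 : b - ℓ / 2 ≤ (coords Ψ x).1 := (le_boxBot hL s).trans hx.1.1
      have h10 : max (φ x'') b ≤ b + 5 * ℓ := max_le (by linarith) (by linarith)
      have h11 : b ≤ max (φ x'') b := le_max_right _ _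
      rw [Real.dist_eq, abs_le]
      constructor <;> linarith
    · have h8 := dist_corner_le_of_mem_closedBox hL hx
      have h9 := dist_corner_cube_le (z := -(h / 2)) hL (level L (-(h / 2)) φ y₀) y₀
      change dist _ (corner L s) ≤ ℓ at h8 h9
      have h10 := dist_triangle_right (coords Ψ x).2 y₀.2 (corner L s)
      have h11 := dist_triangle_right (coords Ψ x).2 x'' y₀.2
      simp only
      linarith
  have h8 : 0 ≤ R / L * ℓ := by positivity
  have h9 := mul_le_mul_of_nonneg_left h7 (show (0 : ℝ) ≤ m + 1 by positivity)
  linarith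

end Boxes

theorem mem_closedBox_maxCube (hL : 0 < L) (y : ℝ × (Fin m → ℝ)) :
    y ∈ closedBox L h (maxCube L (-(h / 2)) φ y) :=
  ⟨⟨(boxBot_le hL _).trans (bot_cube_le hL _ y), (lt_bot_cube hL _ y).le⟩,
    fun a => ⟨corner_cube_le hL _ y a, (lt_corner_cube hL _ y a).le⟩⟩

/-- A point in the sliver below the next cell belongs to the box of that cell. The condition `hz`
excludes the root, the only box without a downward extension. -/
theorem mem_closedBox_next (hL : 0 < L) {y : ℝ × (Fin m → ℝ)}
    (hbot : bot L (-(h / 2)) (next (maxCube L (-(h / 2)) φ) (bot L (-(h / 2)))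
      (fun s => side L s.1) y) - side L (next (maxCube L (-(h / 2)) φ) (bot L (-(h / 2)))
      (fun s => side L s.1) y).1 / 2 ≤ y.1)
    (hlt : y.1 < bot L (-(h / 2)) (next (maxCube L (-(h / 2)) φ) (bot L (-(h / 2)))
      (fun s => side L s.1) y))
    (hz : -(h / 2) < bot L (-(h / 2)) (next (maxCube L (-(h / 2)) φ) (bot L (-(h / 2)))
      (fun s => side L s.1) y)) :
    y ∈ closedBox L h (next (maxCube L (-(h / 2)) φ) (bot L (-(h / 2)))
      (fun s => side L s.1) y) := by
  set s := next (maxCube L (-(h / 2)) φ) (bot L (-(h / 2))) (fun s => side L s.1) y with hs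
  have h0 : s ≠ (0, 0, 0) := fun h0 => by
    rw [h0] at hz
    simp [bot] at hz
  have hside := DyadicCube.side_pos hL s.1
  refine ⟨⟨?_, by linarith⟩, fun a => ?_⟩
  · rw [boxBot, if_neg h0]; exact hbot
  · exact ⟨corner_cube_le hL _ (top _ _ _ y, y.2) a, (lt_corner_cube hL _ (top _ _ _ y, y.2) a).le⟩

/-- The union of the hyperplanes that contain faces of boxes. -/
def grid (L h : ℝ) (m : ℕ) : Set (ℝ × (Fin m → ℝ)) :=
  ⋃ s : Index m, {y | y.1 = bot L (-(h / 2)) s} ∪ {y | y.1 = bot L (-(h / 2)) s - side L s.1 / 2} ∪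
    ⋃ a, {y | y.2 a = corner L s a}

theorem volume_grid (L h : ℝ) (m : ℕ) : volume (grid L h m) = 0 := by
  have h1 : ∀ c : ℝ, volume {y : ℝ × (Fin m → ℝ) | y.1 = c} = 0 := fun c =>
    Measure.quasiMeasurePreserving_fst.preimage_null (s := {c}) (by simp)
  have h2 : ∀ (c : ℝ) (a : Fin m), volume {y : ℝ × (Fin m → ℝ) | y.2 a = c} = 0 := fun c a =>
    Measure.quasiMeasurePreserving_snd.preimage_null (s := {x : Fin m → ℝ | x a = c})
      ((Measure.quasiMeasurePreserving_eval (fun _ : Fin m => (volume : Measure ℝ)) a).preimage_null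
        (s := {c}) (by simp))
  refine measure_iUnion_null fun s => measure_union_null (measure_union_null (h1 _) (h1 _))
    (measure_iUnion_null fun a => h2 _ a)

/-- Away from the grid, a point of a closed box lies in the open box if it is below the upper
faces. -/
theorem mem_openBox {y : ℝ × (Fin m → ℝ)} (hy : y ∉ grid L h m) {s : Index m}
    (hs : y ∈ closedBox L h s) (h1 : y.1 < bot L (-(h / 2)) s + side L s.1)
    (h2 : ∀ a, y.2 a < corner L s a + side L s.1) : y ∈ openBox L h s := by
  simp only [grid, mem_iUnion, mem_union, mem_ofPred_eq, not_exists, not_or] at hy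
  obtain ⟨⟨a1, a2⟩, a3⟩ := hy s
  refine ⟨⟨lt_of_le_of_ne hs.1.1 fun he => ?_, h1⟩,
    fun a => ⟨lt_of_le_of_ne (hs.2 a).1 (Ne.symm (a3 a)), h2 a⟩⟩
  unfold boxBot at he
  split_ifs at he
  · exact a1 he.symm
  · exact a2 he.symm

end IsBoundaryChart

/-! ### Integrability -/

/-- On a set of finite measure |f| ≤ 1 + |f|^q, and the weight is bounded below there. -/
theorem integrable_of_lintegral_weight_lt_top {X : Type*} [MeasurableSpace X] {μ : Measure X}
    {S : Set X} (hμ : μ S ≠ ⊤) {f : X → ℝ} (hf : Measurable f) (hfS : Function.support f ⊆ S)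
    {q : ℝ} (hq : 1 ≤ q) {w : X → ℝ≥0∞} {c : ℝ≥0∞} (hc : c ≠ 0) (hc' : c ≠ ⊤)
    (hw : ∀ x ∈ S, c ≤ w x) (hE : ∫⁻ x, ‖f x‖ₑ ^ q * w x ∂μ < ⊤) : Integrable f μ := by
  rw [← integrableOn_iff_integrable_of_support_subset hfS]
  refine ⟨hf.aestronglyMeasurable, ?_⟩
  have h1 : ∀ x, ‖f x‖ₑ ≤ 1 + c⁻¹ * (‖f x‖ₑ ^ q * w x) := by
    intro x
    by_cases hx : x ∈ S
    · calc ‖f x‖ₑ ≤ 1 + ‖f x‖ₑ ^ q := by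
            rcases le_total ‖f x‖ₑ 1 with h | h
            · exact h.trans le_self_add
            · refine le_trans ?_ le_add_self
              simpa using ENNReal.rpow_le_rpow_of_exponent_le h hq
        _ = 1 + c⁻¹ * (‖f x‖ₑ ^ q * c) := by
            rw [mul_comm (‖f x‖ₑ ^ q), ← mul_assoc, ENNReal.inv_mul_cancel hc hc', one_mul]
        _ ≤ _ := by gcongr; exact hw x hx
    · have : f x = 0 := by
        by_contra h
        exact hx (hfS h)
      simp [this]
  calc ∫⁻ x in S, ‖f x‖ₑ ∂μ ≤ ∫⁻ x in S, (1 + c⁻¹ * (‖f x‖ₑ ^ q * w x)) ∂μ := lintegral_mono h1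
    _ ≤ μ S + c⁻¹ * ∫⁻ x, ‖f x‖ₑ ^ q * w x ∂μ := by
      rw [lintegral_add_left measurable_const, setLIntegral_const, one_mul,
        lintegral_const_mul' _ _ (ENNReal.inv_ne_top.2 hc)]
      gcongr
      exact Measure.restrict_le_self
    _ < ⊤ := ENNReal.add_lt_top.2 ⟨hμ.lt_top, ENNReal.mul_lt_top (ENNReal.inv_lt_top.2
        (pos_iff_ne_zero.2 hc)) hE⟩

theorem min_rpow_le {a b t e : ℝ} (ha : 0 < a) (hat : a ≤ t) (htb : t ≤ b) :
    min (a ^ e) (b ^ e) ≤ t ^ e := by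
  rcases le_total 0 e with he | he
  · exact (min_le_left _ _).trans (Real.rpow_le_rpow ha.le hat he)
  · exact (min_le_right _ _).trans (Real.rpow_le_rpow_of_nonpos (ha.trans_le hat) htb he)

section

variable {n : ℕ} {Ω : Set (EuclideanSpace ℝ (Fin n))}

theorem exists_const_le_boundaryDist_rpow (hb : Bornology.IsBounded Ω)
    {S : Set (EuclideanSpace ℝ (Fin n))} (hS : S ⊆ Ω) {δ : ℝ} (hδ : 0 < δ)
    (hSδ : ∀ x ∈ S, δ ≤ boundaryDist Ω x) (e : ℝ) :
    ∃ c : ℝ, 0 < c ∧ ∀ x ∈ S, c ≤ boundaryDist Ω x ^ e := by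
  obtain ⟨R, hR0, hR⟩ := exists_boundaryDist_le hb
  exact ⟨min (δ ^ e) (R ^ e), by positivity, fun x hx => min_rpow_le hδ (hSδ x hx) (hR x (hS hx))⟩

/-- A function supported at a positive distance from the boundary is integrable if a weighted
`L^q` norm is finite. -/
theorem integrable_of_support_subset (hb : Bornology.IsBounded Ω)
    {S : Set (EuclideanSpace ℝ (Fin n))} (hS : S ⊆ Ω)
    (hδ : ∃ δ : ℝ, 0 < δ ∧ ∀ x ∈ S, δ ≤ boundaryDist Ω x) {q : ℝ} (hq : 1 ≤ q) (e : ℝ)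
    {f : EuclideanSpace ℝ (Fin n) → ℝ} (hf : Measurable f) (hfS : Function.support f ⊆ S)
    (hE : ∫⁻ x, ‖f x‖ₑ ^ q * ENNReal.ofReal (boundaryDist Ω x ^ e) < ⊤) : Integrable f := by
  obtain ⟨δ, hδ0, hSδ⟩ := hδ
  obtain ⟨c, hc, hcS⟩ := exists_const_le_boundaryDist_rpow hb hS hδ0 hSδ e
  exact integrable_of_lintegral_weight_lt_top
    ((measure_mono hS).trans_lt hb.measure_lt_top).ne hf hfS hq
    (ENNReal.ofReal_pos.2 hc).ne' ENNReal.ofReal_ne_top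
    (fun x hx => ENNReal.ofReal_le_ofReal (hcS x hx)) hE

/-- A family of open subsets `U t` of `Ω` such that functions on `D` have a decomposition subordinate to it
with pieces of mean zero, except for the piece of a root `r`, which carries the whole mass. -/
structure IsLocalDecomposition (Ω : Set (EuclideanSpace ℝ (Fin n))) (p q α β : ℝ) {Γ : Type} (r : Γ)
    (U : Γ → Set (EuclideanSpace ℝ (Fin n))) (D : Set (EuclideanSpace ℝ (Fin n))) (C : ℝ≥0) :
    Prop where
  isOpen : ∀ t, IsOpen (U t)
  nonempty : (U r).Nonempty
  subset : ∀ t, U t ⊆ Ω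
  away : ∀ t, ∃ δ : ℝ, 0 < δ ∧ ∀ x ∈ U t, δ ≤ boundaryDist Ω x
  finite : ∀ δ : ℝ, 0 < δ → {t | ∃ x ∈ U t, δ ≤ boundaryDist Ω x}.Finite
  measurable : MeasurableSet D
  region_subset : D ⊆ Ω
  null : volume (D \ ⋃ t, U t) = 0
  weight : ∫⁻ x in D, ENNReal.ofReal (boundaryDist Ω x ^ (β * p)) < ⊤
  decomp : ∀ g : EuclideanSpace ℝ (Fin n) → ℝ, Measurable g → (∀ x ∉ D, g x = 0) → Integrable g →
    ∫⁻ x in D, ‖g x‖ₑ ^ q * ENNReal.ofReal (boundaryDist Ω x ^ (-β * q)) < ⊤ →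
    ∃ G : Γ → EuclideanSpace ℝ (Fin n) → ℝ, (∀ t, Measurable (G t)) ∧
      (∀ t, Function.support (G t) ⊆ U t) ∧ (∀ᵐ x, HasSum (fun t => G t x) (g x)) ∧
      (∀ t, t ≠ r → ∫ x, G t x = 0) ∧
      ∑' t, ∫⁻ x, ‖G t x‖ₑ ^ q * ENNReal.ofReal (boundaryDist Ω x ^ ((1 - α - β) * q)) ≤
        C * ∫⁻ x in D, ‖g x‖ₑ ^ q * ENNReal.ofReal (boundaryDist Ω x ^ (-β * q)) ∧
      ∫ x, G r x = ∫ x, g x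

end

/-! ### The local decomposition over a boundary patch -/

namespace IsBoundaryChart

open DyadicCube FibrePartition

variable {m : ℕ} {α : ℝ} {Ω : Set (EuclideanSpace ℝ (Fin (m + 1)))}
  {Ψ : EuclideanSpace ℝ (Fin (m + 1)) ≃ᵃⁱ[ℝ] EuclideanSpace ℝ (Fin (m + 1))}
  {φ : (Fin m → ℝ) → ℝ} {K L h R : ℝ}

theorem openBox_nonempty (hL : 0 < L) (s : Index m) : (openBox L h s).Nonempty := by
  have h1 := DyadicCube.side_pos hL s.1
  have h2 := boxBot_le (h := h) hL s
  refine ⟨((boxBot L h s + (bot L (-(h / 2)) s + side L s.1)) / 2,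
    fun a => corner L s a + side L s.1 / 2), ⟨?_, ?_⟩, fun a => ⟨?_, ?_⟩⟩ <;> simp only <;> linarith

theorem bot_ne_of_ne_root (H : IsBoundaryChart α Ω Ψ φ K L h) {y : ℝ × (Fin m → ℝ)}
    (hy : y ∈ region L (-(h / 2)) φ) (hne : maxCube L (-(h / 2)) φ y ≠ (0, 0, 0)) :
    bot L (-(h / 2)) (maxCube L (-(h / 2)) φ y) ≠ -(h / 2) := fun h1 => by
  have h2 := (fibrePartition H.side_pos H.continuous).bot_mem hy
  rw [h1] at h2
  exact hne (h2.2.symm.trans (level_root H.side_pos H.root_good hy.1).2)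

theorem next_mem_range (H : IsBoundaryChart α Ω Ψ φ K L h) {y : ℝ × (Fin m → ℝ)}
    (hy : y ∈ region L (-(h / 2)) φ) : ∃ y' ∈ region L (-(h / 2)) φ, maxCube L (-(h / 2)) φ y' =
      next (maxCube L (-(h / 2)) φ) (bot L (-(h / 2))) (fun s => side L s.1) y :=
  ⟨_, (fibrePartition H.side_pos H.continuous).top_mem hy, rfl⟩

/-- Away from the grid, the pieces are supported in the open boxes. -/
theorem mem_openBox_of_piece_ne_zero (H : IsBoundaryChart α Ω Ψ φ K L h) {y : ℝ × (Fin m → ℝ)}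
    (hgrid : y ∉ grid L h m) {g : ℝ × (Fin m → ℝ) → ℝ} {s : Index m}
    (hs : piece (maxCube L (-(h / 2)) φ) (bot L (-(h / 2))) (fun s => side L s.1)
      (region L (-(h / 2)) φ) g s y ≠ 0) : y ∈ openBox L h s := by
  have hL := H.side_pos
  obtain ⟨-, h1 | ⟨h1, h2, h3, h4⟩⟩ := (fibrePartition hL H.continuous).piece_ne_zero hs
  · rw [← h1]
    exact mem_openBox hgrid (mem_closedBox_maxCube hL y) (lt_bot_cube hL _ y)
      fun a => lt_corner_cube hL _ y a
  · rw [← h1] at h2 h3 h4 ⊢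
    exact mem_openBox hgrid (mem_closedBox_next hL h2 h3 h4)
      (by linarith [DyadicCube.side_pos hL (next (maxCube L (-(h / 2)) φ) (bot L (-(h / 2)))
        (fun s => side L s.1) y).1])
      fun a => lt_corner_cube hL _ (top (maxCube L (-(h / 2)) φ) (bot L (-(h / 2)))
        (fun s => side L s.1) y, y.2) a

/-- The sides of the cubes are comparable to the boundary distance, so the maximal dyadic cubes
satisfy all the assumptions of the abstract fibre transport, and its result is pulled back through
the measure-preserving coordinates. -/
theorem exists_isLocalDecomposition (H : IsBoundaryChart α Ω Ψ φ K L h) (hΩ : IsOpen Ω)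
    (hb : Bornology.IsBounded Ω) (hne : (frontier Ω).Nonempty) {p q β : ℝ}
    (hqp : q.HolderConjugate p) (hα : 0 < α) (hα1 : α ≤ 1) (hβ : -α < β * p) :
    ∃ (Γ : Type) (_ : Countable Γ) (r : Γ) (U : Γ → Set (EuclideanSpace ℝ (Fin (m + 1))))
      (C : ℝ≥0), IsLocalDecomposition Ω p q α β r U (patch Ψ φ L h) C ∧
        ∀ t, IsOpenCube (U t) ∨ IsExtendedOpenCube (U t) := by
  classical
  have hL := H.side_pos
  have hh := H.h_pos
  obtain ⟨R, hR0, hR⟩ := exists_boundaryDist_le hb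
  set z : ℝ := -(h / 2) with hz
  set D := region L z φ with hD
  set Q := maxCube L z φ with hQ
  set b : Index m → ℝ := bot L z with hbdef
  set ℓ : Index m → ℝ := fun s => side L s.1 with hℓ
  have P : FibrePartition D Q b ℓ z φ (base L m) := fibrePartition hL H.continuous
  have hQm : Measurable Q := measurable_maxCube hL H.continuous
  have hDm : MeasurableSet D := measurableSet_region H.continuous
  set δ : ℝ × (Fin m → ℝ) → ℝ := fun y => boundaryDist Ω ((coords Ψ).symm y) with hδ
  have hδm : Measurable δ := measurable_boundaryDist.comp (coords Ψ).symm.measurable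
  have hδc : ∀ x, δ (coords Ψ x) = boundaryDist Ω x := fun x => by simp [hδ]
  have hMP := volume_preserving_coords Ψ
  set C₁ : ℝ := 8 * (m + 1) + R / L with hC₁
  have hC₁0 : 0 < C₁ := by positivity
  -- comparison of the distance with the sides of the cubes
  have low : ∀ y₀ ∈ D, ∀ y ∈ closedBox L h (Q y₀), ℓ (Q y₀) ≤ δ y := fun y₀ hy₀ y hy =>
    H.side_le_boundaryDist hy₀ (by simpa using hy) hΩ hne
  have high : ∀ y₀ ∈ D, ∀ y ∈ closedBox L h (Q y₀), δ y ≤ C₁ * ℓ (Q y₀) := fun y₀ hy₀ y hy =>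
    H.boundaryDist_le_side hy₀ (by simpa using hy) hΩ hR0 hR
  have low' : ∀ y ∈ D, ℓ (Q y) ≤ δ y := fun y hy => low y hy y (mem_closedBox_maxCube hL y)
  have high' : ∀ y ∈ D, δ y ≤ C₁ * ℓ (Q y) := fun y hy => high y hy y (mem_closedBox_maxCube hL y)
  have hδR : ∀ y ∈ D, 0 < δ y ∧ δ y ≤ R := fun y hy =>
    ⟨(P.pos y hy).trans_le (low' y hy), hR _ (H.patch_subset (by simpa [patch] using hy))⟩
  set C₂ : ℝ := (h / 8 - z) / L ^ α + 4 + K * 6 ^ α with hC₂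
  have hz8 : z ≤ h / 8 := by rw [hz]; linarith
  have hC₂0 : 0 < C₂ := by
    have h1 : 0 ≤ (h / 8 - z) / L ^ α := div_nonneg (by linarith) (by positivity)
    have h2 : 0 ≤ K * 6 ^ α := mul_nonneg H.const_nonneg (by positivity)
    linarith
  have hφδ : ∀ y ∈ D, φ y.2 - y.1 ≤ C₂ * δ y ^ α := fun y hy => by
    refine (sub_le_side_rpow hL H.side_le_one hα hα1 H.const_nonneg H.holder
      (fun x hx => H.apply_le hx) hz8 hy).trans ?_
    refine mul_le_mul_of_nonneg_left ?_ hC₂0.le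
    exact Real.rpow_le_rpow (DyadicCube.side_pos hL _).le (low' y hy) hα.le
  -- The distance is almost decreasing upwards because the sides are: it is compared with the side
  -- of the cell at both points.
  have hmono : ∀ y ∈ D, ∀ t, y.1 ≤ t → (t, y.2) ∈ D → δ (t, y.2) ≤ C₁ * δ y := by
    rintro ⟨u, x⟩ hy t ht hyt
    refine (high' _ hyt).trans (mul_le_mul_of_nonneg_left ?_ hC₁0.le)
    exact (side_anti hL (level_mono hL H.continuous hyt ht)).trans (low' _ hy)
  have hnext : ∀ y ∈ D, top Q b ℓ y - ℓ (next Q b ℓ y) / 2 ≤ y.1 →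
      δ y ≤ C₁ * ℓ (next Q b ℓ y) := fun y hy h1 => by
    have h2 : b (next Q b ℓ y) = top Q b ℓ y := P.above_bot y hy
    have h3 : y.1 < top Q b ℓ y := P.lt_top y hy
    refine high _ (P.top_mem hy) y (mem_closedBox_next hL ?_ ?_ ?_)
    · change b (next Q b ℓ y) - _ ≤ _
      rw [h2]; exact h1
    · change _ < b (next Q b ℓ y)
      rw [h2]; exact h3
    · change _ < b (next Q b ℓ y)
      rw [h2]; exact hy.2.1.trans_lt h3
  obtain ⟨C, hC⟩ := P.exists_tsum_lintegral_piece_le hQm hDm hqp hα hα1 hβ hC₁0 hC₂0 hC₁0 hR0 hδm hδR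
    hφδ hmono hnext
  have hroot : ∀ x ∈ base L m, (z, x) ∈ D ∧ Q (z, x) = (0, 0, 0) := fun x hx =>
    level_root hL H.root_good hx
  have hbase : (0 : Fin m → ℝ) ∈ base L m := fun a => by
    simp only [Pi.zero_apply]; constructor <;> linarith
  have hgrid : ∀ᵐ x, coords Ψ x ∉ grid L h m :=
    measure_eq_zero_iff_ae_notMem.1
      (hMP.quasiMeasurePreserving.preimage_null (volume_grid L h m))
  -- Only the indices of cells that occur are kept, since the boxes of other dyadic cubes need not
  -- lie in Ω.
  refine ⟨{s : Index m // ∃ y ∈ D, Q y = s}, inferInstance,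
    ⟨(0, 0, 0), (z, 0), (hroot 0 hbase).1, (hroot 0 hbase).2⟩,
    fun s => coords Ψ ⁻¹' openBox L h s.1, C, ?_, fun s => isOpenCube_or_isExtendedOpenCube hL s.1⟩
  have hU : ∀ (s : {s : Index m // ∃ y ∈ D, Q y = s}), ∀ x ∈ coords Ψ ⁻¹' openBox L h s.1,
      x ∈ Ω ∧ ℓ s ≤ boundaryDist Ω x ∧ boundaryDist Ω x ≤ C₁ * ℓ s := by
    rintro ⟨s, y₀, hy₀, rfl⟩ x hx
    have hx' := openBox_subset_closedBox L h _ hx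
    have h1 := low _ hy₀ _ hx'
    have h2 := high _ hy₀ _ hx'
    rw [hδc] at h1 h2
    exact ⟨H.mem_of_mem_closedBox hy₀ hx', h1, h2⟩
  have hℓpos : ∀ s, 0 < ℓ s := fun s => DyadicCube.side_pos hL _
  have haway : ∀ s : {s : Index m // ∃ y ∈ D, Q y = s}, ∃ δ : ℝ, 0 < δ ∧
      ∀ x ∈ coords Ψ ⁻¹' openBox L h s.1, δ ≤ boundaryDist Ω x :=
    fun s => ⟨ℓ s, hℓpos s, fun x hx => (hU s x hx).2.1⟩
  refine ⟨fun s => (isOpen_openBox L h s.1).preimage (continuous_coords Ψ), ?_,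
    fun s x hx => (hU s x hx).1, haway, fun η hη => ?_, (coords Ψ).measurable hDm, H.patch_subset,
    ?_, ?_, fun g hg hgD hgi hgE => ?_⟩
  · exact (openBox_nonempty hL _).preimage (coords Ψ).surjective
  · have h1 := finite_maxCube (z := z) (φ := φ) hL (fun x hx => H.apply_le hx)
      (show 0 < η / C₁ by positivity)
    refine (h1.preimage (Subtype.val_injective.injOn)).subset ?_
    rintro s ⟨x, hx, hx'⟩
    refine ⟨s.2, ?_⟩
    rw [div_le_iff₀' hC₁0]
    exact hx'.trans (hU s x hx).2.2
  · refine measure_mono_null ?_ (ae_iff.1 hgrid)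
    rintro x ⟨hx, hx'⟩ h1
    refine hx' (mem_iUnion.2 ⟨⟨Q (coords Ψ x), _, hx, rfl⟩, ?_⟩)
    exact mem_openBox h1 (mem_closedBox_maxCube hL _) (lt_bot_cube hL _ _)
      fun a => lt_corner_cube hL _ _ a
  · have h1 := P.lintegral_weight_lt_top hDm hα hβ hC₂0
      (show 0 < R + h by positivity) hδm (fun y hy => ⟨(hδR y hy).1, by linarith [(hδR y hy).2]⟩) hφδ
      (fun x hx => by rw [hz]; linarith [H.apply_le hx]) (by
        have : base L m = Prod.mk z ⁻¹' D := by
          ext x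
          exact ⟨fun hx => (hroot x hx).1, fun hx => hx.1⟩
        rw [this]
        exact measurable_prodMk_left hDm)
      (Bornology.IsBounded.measure_lt_top (Metric.isBounded_closedBall.subset fun x hx =>
        dist_zero_of_mem_base hL hx)).ne
    rw [← hMP.setLIntegral_comp_preimage hDm (by fun_prop)] at h1
    simp only [hδc] at h1
    exact h1
  -- the decomposition
  set g' : ℝ × (Fin m → ℝ) → ℝ := g ∘ (coords Ψ).symm with hg'
  have hg'c : ∀ x, g' (coords Ψ x) = g x := fun x => by simp [hg']
  have hg'm : Measurable g' := hg.comp (coords Ψ).symm.measurable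
  have hg'D : ∀ y ∉ D, g' y = 0 := fun y hy => hgD _ (by simpa [patch] using hy)
  have hg'i : Integrable g' :=
    (hMP.symm (coords Ψ)).integrable_comp_of_integrable hgi
  set F : Index m → ℝ × (Fin m → ℝ) → ℝ := fun s => piece Q b ℓ D g' s with hF
  have hFm : ∀ s, Measurable (F s) := fun s => measurable_piece hQm hDm hg'm s
  -- Cutting off to the open box changes the piece only on the grid, a null set, and makes the
  -- support condition hold at every point.
  set G : {s : Index m // ∃ y ∈ D, Q y = s} → EuclideanSpace ℝ (Fin (m + 1)) → ℝ := fun s =>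
    (coords Ψ ⁻¹' openBox L h s.1).indicator (F s ∘ coords Ψ) with hG
  have hGm : ∀ s, Measurable (G s) := fun s => ((hFm s).comp (coords Ψ).measurable).indicator
    ((isOpen_openBox L h s.1).preimage (continuous_coords Ψ)).measurableSet
  have hGsupp : ∀ s, Function.support (G s) ⊆ coords Ψ ⁻¹' openBox L h s.1 := fun s =>
    support_indicator_subset
  have hGF : ∀ᵐ x, ∀ s, G s x = F s (coords Ψ x) := by
    filter_upwards [hgrid] with x hx s
    simp only [hG, indicator]
    split_ifs with h1
    · rfl
    · by_contra h2
      exact h1 (H.mem_openBox_of_piece_ne_zero hx (Ne.symm h2))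
  have henergy : ∑' s, ∫⁻ x, ‖G s x‖ₑ ^ q *
      ENNReal.ofReal (boundaryDist Ω x ^ ((1 - α - β) * q)) ≤
      C * ∫⁻ x in patch Ψ φ L h, ‖g x‖ₑ ^ q * ENNReal.ofReal (boundaryDist Ω x ^ (-β * q)) := by
    calc _ ≤ ∑' s : {s : Index m // ∃ y ∈ D, Q y = s}, ∫⁻ y in D, ‖F s y‖ₑ ^ q *
          ENNReal.ofReal (δ y ^ ((1 - α - β) * q)) := by
          refine ENNReal.tsum_le_tsum fun s => ?_
          rw [← hMP.setLIntegral_comp_preimage hDm (by have := hFm s; fun_prop),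
            ← lintegral_indicator ((coords Ψ).measurable hDm)]
          refine lintegral_mono_ae ?_
          filter_upwards [hGF] with x hx
          rw [hx s]
          by_cases h1 : coords Ψ x ∈ D
          · rw [indicator_of_mem (by exact h1), hδc]
          · have : F s (coords Ψ x) = 0 := by
              by_contra h2
              exact h1 (P.piece_ne_zero h2).1
            simp [this, hqp.pos]
      _ ≤ ∑' s, ∫⁻ y in D, ‖F s y‖ₑ ^ q * ENNReal.ofReal (δ y ^ ((1 - α - β) * q)) :=
          ENNReal.tsum_comp_le_tsum_of_injective Subtype.val_injective _
      _ ≤ _ := hC g' hg'm hg'D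
      _ = _ := by
          rw [← hMP.setLIntegral_comp_preimage hDm (by fun_prop)]
          simp only [hδc, hg'c]
          rfl
  have hGi : ∀ s, Integrable (G s) := fun s => by
    refine integrable_of_support_subset hb (fun x hx => (hU s x hx).1) (haway s) hqp.lt.le
      ((1 - α - β) * q) (hGm s) (hGsupp s) ?_
    exact ((ENNReal.le_tsum s).trans henergy).trans_lt (ENNReal.mul_lt_top ENNReal.coe_lt_top hgE)
  have hFi : ∀ s : {s : Index m // ∃ y ∈ D, Q y = s}, Integrable (F s) := fun s => by
    rw [← hMP.integrable_comp_emb (coords Ψ).measurableEmbedding]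
    refine (hGi s).congr ?_
    filter_upwards [hGF] with x hx
    exact hx s
  have hint : ∀ s, ∫ x, G s x = ∫ y, F s y := fun s => by
    rw [← hMP.integral_comp' (f := coords Ψ)]
    refine integral_congr_ae ?_
    filter_upwards [hGF] with x hx
    exact hx s
  refine ⟨G, hGm, hGsupp, ?_, ?_, henergy, ?_⟩
  · filter_upwards [hGF] with x hx
    have h1 := hasSum_piece (Q := Q) (b := b) (ℓ := ℓ) hg'D (coords Ψ x)
    rw [hg'c] at h1
    have h2 : (fun t => G t x) = (fun s => F s (coords Ψ x)) ∘ Subtype.val :=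
      funext fun s => hx s
    rw [h2]
    refine (hasSum_subtype_iff_of_support_subset (s := {s | ∃ y ∈ D, Q y = s}) fun s hs => ?_).2 h1
    obtain ⟨h3, h4 | h4⟩ := P.piece_ne_zero hs
    · exact ⟨_, h3, h4⟩
    · obtain ⟨y', hy', h5⟩ := H.next_mem_range h3
      exact ⟨y', hy', h5.trans h4.1⟩
  · rintro ⟨s, y₀, hy₀, rfl⟩ hs
    rw [hint]
    refine P.integral_piece_eq_zero hg'D hg'i (hFi ⟨_, y₀, hy₀, rfl⟩)
      (H.bot_ne_of_ne_root hy₀ fun h1 => hs (Subtype.ext h1))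
  · rw [hint, P.integral_piece_root hg'D hg'i (hFi _) (by simp [hbdef, bot]) hroot,
      ← hMP.integral_comp' (f := coords Ψ)]
    simp only [hg'c]

end IsBoundaryChart

/-! ### Balls and small cubes -/

/-- After a reflection that turns the outer normal at x₀ into the vertical direction, the ball lies
below the graph of x' ↦ √(ε² - |x'|²) - ε. -/
theorem isBoundedSmoothDomain_ball {m : ℕ} (c : EuclideanSpace ℝ (Fin (m + 1))) {ε : ℝ} (hε : 0 < ε) :
    IsBoundedSmoothDomain (Metric.ball c ε) where
  isOpen := Metric.isOpen_ball
  isConnected := ⟨Metric.nonempty_ball.2 hε, (convex_ball c ε).isPreconnected⟩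
  isBounded := Metric.isBounded_ball
  boundary x₀ hx₀ := by
    rw [frontier_ball c hε.ne', mem_sphere_iff_norm] at hx₀
    set ν : EuclideanSpace ℝ (Fin (m + 1)) := ε⁻¹ • (x₀ - c) with hν
    have hν1 : ‖ν‖ = 1 := by
      rw [hν, norm_smul, hx₀, norm_inv, Real.norm_eq_abs, abs_of_pos hε, inv_mul_cancel₀ hε.ne']
    set e : WithLp 2 (EuclideanSpace ℝ (Fin m) × ℝ) := WithLp.toLp 2 (0, 1) with he
    have he1 : ‖consIsometry m e‖ = 1 := by
      rw [LinearIsometryEquiv.norm_map, WithLp.prod_norm_eq_of_L2]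
      simp [he]
    set ρ := (ℝ ∙ (ν - consIsometry m e))ᗮ.reflection with hρ
    have hρν : ρ ν = consIsometry m e := Submodule.reflection_sub (hν1.trans he1.symm)
    set A := ρ.trans (consIsometry m).symm with hA
    have hAν : A ν = e := by
      rw [hA, LinearIsometryEquiv.trans_apply, hρν, LinearIsometryEquiv.symm_apply_apply]
    set Φ : EuclideanSpace ℝ (Fin (m + 1)) ≃ᵃⁱ[ℝ] WithLp 2 (EuclideanSpace ℝ (Fin m) × ℝ) :=
      (AffineIsometryEquiv.vaddConst ℝ x₀).symm.trans A.toAffineIsometryEquiv with hΦ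
    have hΦA : ∀ x, Φ x = A (x - x₀) := fun x => rfl
    refine ⟨Φ, ε, ε, fun x' => Real.sqrt (ε ^ 2 - ‖x'‖ ^ 2) - ε, hε, hε, by simp [hΦA], ?_, ?_⟩
    · refine ContDiffOn.sub (ContDiffOn.sqrt ?_ fun x' hx' => ?_) contDiffOn_const
      · exact contDiffOn_const.sub (contDiff_norm_sq ℝ).contDiffOn
      · rw [mem_ball_zero_iff] at hx'
        have := norm_nonneg x'
        nlinarith
    · intro x h1 h2
      have h3 : A (x - c) = Φ x + ε • e := by
        rw [hΦA, ← hAν, ← map_smul, ← map_add, hν, smul_inv_smul₀ hε.ne']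
        congr 1
        abel
      have h4 : ‖x - c‖ ^ 2 = ‖(Φ x).fst‖ ^ 2 + ((Φ x).snd + ε) ^ 2 := by
        rw [← A.norm_map, h3, WithLp.prod_norm_eq_of_L2, Real.sq_sqrt (by positivity)]
        simp [he]
      rw [Metric.mem_ball, dist_eq_norm, lt_sub_iff_add_lt,
        Real.lt_sqrt (by linarith [(abs_lt.1 h2).1]), lt_sub_iff_add_lt,
        ← sq_lt_sq₀ (norm_nonneg _) hε.le, h4, add_comm (‖(Φ x).fst‖ ^ 2)]

section SmallSets

variable {n : ℕ} {Ω : Set (EuclideanSpace ℝ (Fin n))}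

theorem exists_ball_away (hΩ : IsOpen Ω) (hne : (frontier Ω).Nonempty)
    {x : EuclideanSpace ℝ (Fin n)} (hx : x ∈ Ω) :
    ∃ ε : ℝ, 0 < ε ∧ Metric.ball x ε ⊆ Ω ∧ ∀ y ∈ Metric.ball x ε, ε ≤ boundaryDist Ω y := by
  obtain ⟨ε, hε, h⟩ := Metric.isOpen_iff.1 hΩ x hx
  refine ⟨ε / 2, by positivity, (Metric.ball_subset_ball (by linarith)).trans h, fun y hy => ?_⟩
  refine le_boundaryDist hΩ hne ((Metric.ball_subset_ball' ?_).trans h)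
  rw [Metric.mem_ball] at hy
  linarith

/-- The axis-parallel open cube with center `x` and edge length `2 * η`. -/
theorem isOpenCube_centered (x : EuclideanSpace ℝ (Fin n)) {η : ℝ} (hη : 0 < η) :
    IsOpenCube {y : EuclideanSpace ℝ (Fin n) | ∀ i, |y i - x i| < η} := by
  refine ⟨AffineIsometryEquiv.constVAdd ℝ (EuclideanSpace ℝ (Fin n))
    (WithLp.toLp 2 (fun i => η - x i)), 2 * η, by positivity, ?_⟩
  ext y
  simp only [mem_ofPred_eq, AffineIsometryEquiv.coe_constVAdd, vadd_eq_add, PiLp.add_apply, mem_Ioo]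
  refine forall_congr' fun i => ?_
  rw [abs_lt]
  constructor <;> rintro ⟨h1, h2⟩ <;> constructor <;> linarith

theorem exists_isOpenCube_away (hΩ : IsOpen Ω) (hne : (frontier Ω).Nonempty)
    {x : EuclideanSpace ℝ (Fin n)} (hx : x ∈ Ω) :
    ∃ V : Set (EuclideanSpace ℝ (Fin n)), IsOpenCube V ∧ IsOpen V ∧ x ∈ V ∧ V ⊆ Ω ∧
      ∃ δ : ℝ, 0 < δ ∧ ∀ y ∈ V, δ ≤ boundaryDist Ω y := by
  obtain ⟨ε, hε, h1, h2⟩ := exists_ball_away hΩ hne hx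
  set η : ℝ := ε / (n + 1) with hη
  have hη0 : 0 < η := by positivity
  have h3 : {y : EuclideanSpace ℝ (Fin n) | ∀ i, |y i - x i| < η} ⊆ Metric.ball x ε := by
    intro y hy
    rw [Metric.mem_ball, EuclideanSpace.dist_eq, Real.sqrt_lt' hε]
    have hn : (0 : ℝ) ≤ n := Nat.cast_nonneg n
    calc ∑ i, dist (y i) (x i) ^ 2 ≤ ∑ _i : Fin n, η ^ 2 := by
          refine Finset.sum_le_sum fun i _ => ?_
          rw [Real.dist_eq]
          have := hy i
          gcongr
      _ = n * η ^ 2 := by simp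
      _ < ((n + 1) * η) ^ 2 := by nlinarith [pow_pos hη0 2, mul_nonneg hn hn]
      _ = ε ^ 2 := by rw [hη, mul_div_cancel₀ _ (by positivity)]
  refine ⟨_, isOpenCube_centered x hη0, ?_, fun i => by simpa using hη0, h3.trans h1, ε, hε,
    fun y hy => h2 y (h3 hy)⟩
  have h4 : {y : EuclideanSpace ℝ (Fin n) | ∀ i, |y i - x i| < η} = ⋂ i, {y | |y i - x i| < η} := by
    ext; simp
  rw [h4]
  exact isOpen_iInter_of_finite fun i => isOpen_lt (by fun_prop) continuous_const

end SmallSets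

/-! ### Chains of open sets -/

/-- Being joined by a chain is an equivalence relation that holds between each point and its
neighbours in Ω; on a preconnected set it holds between any two points. -/
theorem IsPreconnected.reflTransGen_inter_nonempty {X : Type*} [TopologicalSpace X] {Ω : Set X}
    (hΩ : IsPreconnected Ω) {V : X → Set X} (hV : ∀ x ∈ Ω, IsOpen (V x)) (hmem : ∀ x ∈ Ω, x ∈ V x)
    {x y : X} (hx : x ∈ Ω) (hy : y ∈ Ω) :
    Relation.ReflTransGen (fun a b => a ∈ Ω ∧ b ∈ Ω ∧ (V a ∩ V b).Nonempty) x y := by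
  refine hΩ.induction₂ (fun x y =>
    Relation.ReflTransGen (fun a b => a ∈ Ω ∧ b ∈ Ω ∧ (V a ∩ V b).Nonempty) x y)
    (fun x hx => ?_) (fun _ _ _ _ _ _ h1 h2 => h1.trans h2) (fun x y _ _ h => ?_) hx hy
  · filter_upwards [mem_nhdsWithin_of_mem_nhds ((hV x hx).mem_nhds (hmem x hx)),
      self_mem_nhdsWithin] with y hy hyΩ
    exact Relation.ReflTransGen.single ⟨hx, hyΩ, y, hy, hmem y hyΩ⟩
  · clear * - h
    induction h with
    | refl => exact Relation.ReflTransGen.refl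
    | tail _ h1 ih => exact Relation.ReflTransGen.head ⟨h1.2.1, h1.1, by rw [inter_comm]; exact h1.2.2⟩ ih

/-- The vertices of one chain form a finite set within which each of them is reached. This allows
finitely many chains to be collected into one finite family. -/
theorem exists_finset_reflTransGen {X : Type*} {r : X → X → Prop} {x y : X}
    (h : Relation.ReflTransGen r x y) : ∃ S : Finset X, x ∈ S ∧ y ∈ S ∧
      (∀ z ∈ S, Relation.ReflTransGen r x z) ∧
      ∀ z ∈ S, Relation.ReflTransGen (fun a b => a ∈ S ∧ b ∈ S ∧ r a b) x z := by
  classical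
  induction h with
  | refl => exact ⟨{x}, by simp, by simp, by simp [Relation.ReflTransGen.refl],
      by simp [Relation.ReflTransGen.refl]⟩
  | @tail b c hb hbc ih =>
    obtain ⟨S, h1, h2, h3, h4⟩ := ih
    have h5 : ∀ z ∈ S, Relation.ReflTransGen
        (fun u v => u ∈ insert c S ∧ v ∈ insert c S ∧ r u v) x z := fun z hz =>
      Relation.ReflTransGen.mono (fun u v h => ⟨Finset.mem_insert_of_mem h.1,
        Finset.mem_insert_of_mem h.2.1, h.2.2⟩) _ _ (h4 z hz)
    refine ⟨insert c S, Finset.mem_insert_of_mem h1, Finset.mem_insert_self c S, ?_, ?_⟩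
    · intro z hz
      rcases Finset.mem_insert.1 hz with rfl | hz
      · exact hb.tail hbc
      · exact h3 z hz
    · intro z hz
      rcases Finset.mem_insert.1 hz with rfl | hz
      · exact (h5 b h2).tail ⟨Finset.mem_insert_of_mem h2, Finset.mem_insert_self _ _, hbc⟩
      · exact h5 z hz

/-! ### Transfer of mass along chains -/

section Transfer

variable {n : ℕ}

theorem exists_bump {W : Set (EuclideanSpace ℝ (Fin n))} (hW : IsOpen W) (hne : W.Nonempty) :
    ∃ f : EuclideanSpace ℝ (Fin n) → ℝ, Measurable f ∧ Integrable f ∧ (∃ M, ∀ x, |f x| ≤ M) ∧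
      Function.support f ⊆ W ∧ ∫ x, f x = 1 := by
  obtain ⟨x, hx⟩ := hne
  obtain ⟨ε, hε, h⟩ := Metric.isOpen_iff.1 hW x hx
  have hv0 : volume (Metric.ball x ε) ≠ 0 := (Metric.measure_ball_pos volume x hε).ne'
  have hv1 : volume (Metric.ball x ε) ≠ ⊤ := Metric.isBounded_ball.measure_lt_top.ne
  set c : ℝ := (volume.real (Metric.ball x ε))⁻¹ with hc
  refine ⟨(Metric.ball x ε).indicator fun _ => c, measurable_const.indicator measurableSet_ball,
    (integrable_indicator_iff measurableSet_ball).2 (integrableOn_const hv1 enorm_ne_top),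
    ⟨|c|, fun y => ?_⟩, support_indicator_subset.trans h, ?_⟩
  · by_cases hy : y ∈ Metric.ball x ε
    · rw [indicator_of_mem hy]
    · rw [indicator_of_notMem hy, abs_zero]
      exact abs_nonneg _
  · rw [integral_indicator_const _ measurableSet_ball, smul_eq_mul, hc]
    exact mul_inv_cancel₀ (ENNReal.toReal_ne_zero.2 ⟨hv0, hv1⟩)

/-- Unit mass can be moved along a chain of open sets by functions supported in these sets. -/
theorem exists_transfer {ι : Type*} [Fintype ι] [DecidableEq ι]
    {V : ι → Set (EuclideanSpace ℝ (Fin n))} (hV : ∀ i, IsOpen (V i)) {a j : ι}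
    (h : Relation.ReflTransGen (fun i j => (V i ∩ V j).Nonempty) a j) :
    ∃ c : ι → EuclideanSpace ℝ (Fin n) → ℝ, (∀ k, Measurable (c k)) ∧ (∀ k, Integrable (c k)) ∧
      (∀ k, ∃ M, ∀ x, |c k x| ≤ M) ∧ (∀ k, Function.support (c k) ⊆ V k) ∧
      (∀ x, ∑ k, c k x = 0) ∧
      ∀ k, ∫ x, c k x = (if k = j then 1 else 0) - if k = a then 1 else 0 := by
  induction h with
  | refl => exact ⟨0, fun k => measurable_const, fun k => integrable_zero _ _ _,
      fun k => ⟨0, fun x => by simp⟩, fun k => by simp, fun x => by simp, fun k => by simp⟩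
  | @tail b j hb hbj ih =>
    obtain ⟨c, h1, h2, h3, h4, h5, h6⟩ := ih
    -- One link of the chain: a unit bump in the overlap of V b and V j is added to the j-th
    -- function and subtracted from the b-th, so the sum stays zero while the unit mass passes from
    -- b to j.
    obtain ⟨f, f1, f2, ⟨M, f3⟩, f4, f5⟩ := exists_bump ((hV b).inter (hV j)) hbj
    set s : ι → ℝ := fun k => (if k = j then 1 else 0) - if k = b then 1 else 0 with hs
    refine ⟨fun k x => c k x + s k * f x, fun k => (h1 k).add (f1.const_mul _),
      fun k => (h2 k).add (f2.const_mul _), fun k => ?_, fun k x hx => ?_, fun x => ?_, fun k => ?_⟩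
    · obtain ⟨M', h3'⟩ := h3 k
      refine ⟨M' + |s k| * M, fun x => (abs_add_le _ _).trans ?_⟩
      rw [abs_mul]
      have := f3 x
      gcongr
      exact h3' x
    · by_contra hk
      have e1 : c k x = 0 := by
        by_contra h7
        exact hk (h4 k h7)
      have e2 : f x ≠ 0 := fun h7 => hx (by simp [e1, h7])
      have e3 : s k ≠ 0 := fun h7 => hx (by simp [e1, h7])
      obtain ⟨e4, e5⟩ := f4 e2
      by_cases hkj : k = j
      · exact hk (hkj ▸ e5)
      · by_cases hkb : k = b
        · exact hk (hkb ▸ e4)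
        · exact e3 (by simp [hs, hkj, hkb])
    · rw [Finset.sum_add_distrib, h5, ← Finset.sum_mul, zero_add]
      simp [hs]
    · rw [integral_add (h2 k) (f2.const_mul _), h6, integral_const_mul, f5]
      simp only [hs]
      ring

end Transfer

/-! ### Gluing local decompositions -/

theorem ofReal_abs_rpow_mul (a b : ℝ) {q : ℝ} (hq : 0 ≤ q) :
    ENNReal.ofReal (|a| ^ q * b) = ‖a‖ₑ ^ q * ENNReal.ofReal b := by
  rw [ENNReal.ofReal_mul (by positivity), Real.enorm_eq_ofReal_abs,
    ENNReal.ofReal_rpow_of_nonneg (abs_nonneg _) hq]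

theorem hasSum_sigma_of_fintype {ι : Type*} [Fintype ι] {Γ : ι → Type*} {M : Type*} [AddCommMonoid M]
    [TopologicalSpace M] [ContinuousAdd M] {f : (Σ i, Γ i) → M} {a : ι → M}
    (h : ∀ i, HasSum (fun t => f ⟨i, t⟩) (a i)) : HasSum f (∑ i, a i) := by
  classical
  have h1 : ∀ i, HasSum (fun s : Σ i, Γ i => if s.1 = i then f s else 0) (a i) := fun i => by
    refine (sigma_mk_injective.hasSum_iff (g := Sigma.mk i) ?_).1 (by simpa [Function.comp_def] using h i)
    rintro ⟨k, t⟩ hk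
    refine if_neg fun h2 => hk ?_
    obtain rfl : k = i := h2
    exact ⟨t, rfl⟩
  simpa using hasSum_sum fun i (_ : i ∈ Finset.univ) => h1 i

theorem lintegral_enorm_rpow_sum_le {X ι : Type*} [MeasurableSpace X] {μ : Measure X} [Fintype ι]
    {q : ℝ} (hq : 1 ≤ q) {c : ι → X → ℝ} (hc : ∀ i, Measurable (c i)) (a : ι → ℝ) {w : X → ℝ≥0∞}
    (hw : Measurable w) :
    ∫⁻ x, ‖∑ i, a i * c i x‖ₑ ^ q * w x ∂μ ≤
      (Fintype.card ι : ℝ≥0∞) ^ (q - 1) * ∑ i, ‖a i‖ₑ ^ q * ∫⁻ x, ‖c i x‖ₑ ^ q * w x ∂μ := by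
  have hq0 : 0 ≤ q := by linarith
  have hm : ∀ i, Measurable fun x => ‖c i x‖ₑ ^ q * w x := fun i => by
    have := hc i
    fun_prop
  have hcard : (Fintype.card ι : ℝ≥0∞) ^ (q - 1) ≠ ⊤ :=
    ENNReal.rpow_ne_top_of_nonneg (by linarith) (ENNReal.natCast_ne_top _)
  calc _ ≤ ∫⁻ x, (Fintype.card ι : ℝ≥0∞) ^ (q - 1) *
        ∑ i, ‖a i‖ₑ ^ q * (‖c i x‖ₑ ^ q * w x) ∂μ := by
        refine lintegral_mono fun x => ?_
        simp only [← mul_assoc, ← Finset.sum_mul]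
        refine mul_le_mul_left ?_ _
        calc ‖∑ i, a i * c i x‖ₑ ^ q ≤ (∑ i, ‖a i * c i x‖ₑ) ^ q :=
              ENNReal.rpow_le_rpow (enorm_sum_le _ _) hq0
          _ ≤ _ := ENNReal.rpow_sum_le_const_mul_sum_rpow _ _ hq
          _ = _ := by simp [enorm_mul, ENNReal.mul_rpow_of_nonneg _ _ hq0]
    _ = _ := by
        rw [lintegral_const_mul' _ _ hcard, lintegral_finsetSum]
        · congr 1
          refine Finset.sum_congr rfl fun i _ => ?_
          rw [lintegral_const_mul' _ _ (ENNReal.rpow_ne_top_of_nonneg hq0 enorm_ne_top)]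
        · exact fun i _ => (hm i).const_mul _

section

variable {n : ℕ} {Ω : Set (EuclideanSpace ℝ (Fin n))}

theorem le_max_rpow {a b t e : ℝ} (ha : 0 < a) (hat : a ≤ t) (htb : t ≤ b) :
    t ^ e ≤ max (a ^ e) (b ^ e) := by
  rcases le_total 0 e with he | he
  · exact (Real.rpow_le_rpow (ha.le.trans hat) htb he).trans (le_max_right _ _)
  · exact (Real.rpow_le_rpow_of_nonpos ha hat he).trans (le_max_left _ _)

theorem exists_boundaryDist_rpow_le_const (hb : Bornology.IsBounded Ω)
    {S : Set (EuclideanSpace ℝ (Fin n))} (hS : S ⊆ Ω)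
    (hδ : ∃ δ : ℝ, 0 < δ ∧ ∀ x ∈ S, δ ≤ boundaryDist Ω x) (e : ℝ) :
    ∃ c : ℝ≥0, ∀ x ∈ S, ENNReal.ofReal (boundaryDist Ω x ^ e) ≤ c := by
  obtain ⟨R, hR0, hR⟩ := exists_boundaryDist_le hb
  obtain ⟨δ, hδ, hSδ⟩ := hδ
  refine ⟨(max (δ ^ e) (R ^ e)).toNNReal, fun x hx => ?_⟩
  exact ENNReal.ofReal_le_ofReal (le_max_rpow hδ (hSδ x hx) (hR x (hS hx)))

/-- The bounded functions supported away from the boundary have finite weighted norm. -/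
theorem lintegral_enorm_rpow_mul_lt_top (hb : Bornology.IsBounded Ω)
    {S : Set (EuclideanSpace ℝ (Fin n))} (hS : S ⊆ Ω)
    (hδ : ∃ δ : ℝ, 0 < δ ∧ ∀ x ∈ S, δ ≤ boundaryDist Ω x) {q : ℝ} (hq : 0 < q) (e : ℝ)
    {f : EuclideanSpace ℝ (Fin n) → ℝ} (hfS : Function.support f ⊆ S) {M : ℝ} (hM : ∀ x, |f x| ≤ M) :
    ∫⁻ x, ‖f x‖ₑ ^ q * ENNReal.ofReal (boundaryDist Ω x ^ e) < ⊤ := by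
  obtain ⟨c, hc⟩ := exists_boundaryDist_rpow_le_const hb hS hδ e
  calc _ ≤ ∫⁻ x, S.indicator (fun _ => ENNReal.ofReal M ^ q * c) x := by
        refine lintegral_mono fun x => ?_
        by_cases hx : x ∈ S
        · rw [indicator_of_mem hx]
          refine mul_le_mul' (ENNReal.rpow_le_rpow ?_ hq.le) (hc x hx)
          rw [Real.enorm_eq_ofReal_abs]
          exact ENNReal.ofReal_le_ofReal (hM x)
        · have : f x = 0 := by
            by_contra h
            exact hx (hfS h)
          simp [this, hq]
    _ ≤ ENNReal.ofReal M ^ q * c * volume S := lintegral_indicator_const_le _ _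
    _ < ⊤ := ENNReal.mul_lt_top (ENNReal.mul_lt_top (ENNReal.rpow_lt_top_of_nonneg hq.le
          ENNReal.ofReal_ne_top).lt_top ENNReal.coe_lt_top)
          ((measure_mono hS).trans_lt hb.measure_lt_top)

/-- Far from the boundary nothing has to be moved: g is its own single piece, and the weights differ
by d^((1-α)q) ≤ R^((1-α)q). -/
theorem isLocalDecomposition_of_away (hb : Bornology.IsBounded Ω)
    {V : Set (EuclideanSpace ℝ (Fin n))} (hV : IsOpen V) (hVne : V.Nonempty) (hVΩ : V ⊆ Ω)
    (hδ : ∃ δ : ℝ, 0 < δ ∧ ∀ x ∈ V, δ ≤ boundaryDist Ω x) {p q α : ℝ} (β : ℝ) (hq : 0 < q) (hα1 : α ≤ 1) :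
    ∃ C, IsLocalDecomposition Ω p q α β () (fun _ => V) V C := by
  obtain ⟨R, hR0, hR⟩ := exists_boundaryDist_le hb
  have hpos : ∀ x ∈ V, 0 < boundaryDist Ω x := fun x hx => by
    obtain ⟨δ, h1, h2⟩ := hδ
    exact h1.trans_le (h2 x hx)
  refine ⟨(R ^ ((1 - α) * q)).toNNReal, fun _ => hV, hVne, fun _ => hVΩ, fun _ => hδ,
    fun δ _ => toFinite _, hV.measurableSet, hVΩ, by simp [iUnion_const], ?_,
    fun g hg hgV hgi hgE => ⟨fun _ => g, fun _ => hg, fun _ x hx => ?_, ?_, ?_, ?_, rfl⟩⟩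
  · obtain ⟨c, hc⟩ := exists_boundaryDist_rpow_le_const hb hVΩ hδ (β * p)
    refine (setLIntegral_mono' hV.measurableSet hc).trans_lt ?_
    rw [setLIntegral_const]
    exact ENNReal.mul_lt_top ENNReal.coe_lt_top ((measure_mono hVΩ).trans_lt hb.measure_lt_top)
  · by_contra h
    exact hx (hgV x h)
  · exact Filter.Eventually.of_forall fun x => hasSum_unique (fun _ : Unit => g x)
  · exact fun t ht => (ht rfl).elim
  · rw [tsum_fintype, Finset.univ_unique, Finset.sum_singleton, ← lintegral_const_mul' _ _ ENNReal.coe_ne_top,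
      ← lintegral_indicator hV.measurableSet]
    refine lintegral_mono fun x => ?_
    by_cases hx : x ∈ V
    · rw [indicator_of_mem hx, mul_left_comm]
      refine mul_le_mul_right ?_ _
      rw [show (1 - α - β) * q = (1 - α) * q + -β * q by ring, Real.rpow_add (hpos x hx),
        ENNReal.ofReal_mul (Real.rpow_nonneg (hpos x hx).le _)]
      refine mul_le_mul_left (ENNReal.ofReal_le_ofReal ?_) _
      exact Real.rpow_le_rpow (hpos x hx).le (hR x (hVΩ hx)) (mul_nonneg (by linarith) hq.le)
    · simp [hgV x hx, hq]

/-- Hölder's inequality for |g| = |g| d^(-β) · d^β. Besides integrability of g it bounds the masses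
carried by the roots. -/
theorem lintegral_enorm_le_of_weight (hΩ : IsOpen Ω) (hne : (frontier Ω).Nonempty) {p q β : ℝ}
    (hqp : q.HolderConjugate p) {g : EuclideanSpace ℝ (Fin n) → ℝ} (hg : Measurable g) :
    ∫⁻ x in Ω, ‖g x‖ₑ ≤
      (∫⁻ x in Ω, ‖g x‖ₑ ^ q * ENNReal.ofReal (boundaryDist Ω x ^ (-β * q))) ^ (1 / q) *
        (∫⁻ x in Ω, ENNReal.ofReal (boundaryDist Ω x ^ (β * p))) ^ (1 / p) := by
  have hd := measurable_boundaryDist (Ω := Ω)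
  have h1 := ENNReal.lintegral_mul_le_Lp_mul_Lq (volume.restrict Ω) hqp
    (f := fun x => ‖g x‖ₑ * ENNReal.ofReal (boundaryDist Ω x ^ (-β)))
    (g := fun x => ENNReal.ofReal (boundaryDist Ω x ^ β)) (by fun_prop) (by fun_prop)
  have h2 : ∀ x ∈ Ω, 0 < boundaryDist Ω x := fun x hx => boundaryDist_pos hΩ hne hx
  convert h1 using 1
  · refine setLIntegral_congr_fun hΩ.measurableSet fun x hx => ?_
    simp only [Pi.mul_apply]
    rw [mul_assoc, ← ENNReal.ofReal_mul (Real.rpow_nonneg (h2 x hx).le _), ← Real.rpow_add (h2 x hx)]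
    simp
  · congr 2
    · refine setLIntegral_congr_fun hΩ.measurableSet fun x hx => ?_
      rw [ENNReal.mul_rpow_of_nonneg _ _ hqp.nonneg, ENNReal.ofReal_rpow_of_nonneg
        (Real.rpow_nonneg (h2 x hx).le _) hqp.nonneg, ← Real.rpow_mul (h2 x hx).le]
    · refine setLIntegral_congr_fun hΩ.measurableSet fun x hx => ?_
      rw [ENNReal.ofReal_rpow_of_nonneg
        (Real.rpow_nonneg (h2 x hx).le _) hqp.symm.nonneg, ← Real.rpow_mul (h2 x hx).le]

/-- Splitting of a function along a finite measurable cover. -/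
theorem exists_split_of_cover {X ι : Type*} [MeasurableSpace X] [Fintype ι] {D : ι → Set X}
    (hD : ∀ i, MeasurableSet (D i)) {g : X → ℝ} (hg : Measurable g)
    (hcov : Function.support g ⊆ ⋃ i, D i) :
    ∃ h : ι → X → ℝ, (∀ i, Measurable (h i)) ∧ (∀ i, ∀ x ∉ D i, h i x = 0) ∧
      (∀ i x, |h i x| ≤ |g x|) ∧ ∀ x, ∑ i, h i x = g x := by
  -- The number of sets containing x. It is at least 1 on the cover, so dividing g equally among
  -- them gives parts no larger than g.
  set N : X → ℝ := fun x => ∑ i, (D i).indicator 1 x with hN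
  have hNm : Measurable N := Finset.measurable_sum _ fun i _ => measurable_one.indicator (hD i)
  have hN1 : ∀ i, ∀ x ∈ D i, 1 ≤ N x := fun i x hx => by
    have h1 : (D i).indicator (1 : X → ℝ) x ≤ N x :=
      Finset.single_le_sum (f := fun i => (D i).indicator (1 : X → ℝ) x)
        (fun k _ => indicator_nonneg (fun _ _ => zero_le_one) x) (Finset.mem_univ i)
    simpa [hx] using h1
  refine ⟨fun i => (D i).indicator fun x => g x / N x, fun i => (hg.div hNm).indicator (hD i),
    fun i x hx => indicator_of_notMem hx _, fun i x => ?_, fun x => ?_⟩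
  · change |(D i).indicator (fun x => g x / N x) x| ≤ |g x|
    by_cases hx : x ∈ D i
    · rw [indicator_of_mem hx, abs_div]
      exact div_le_self (abs_nonneg _) ((hN1 i x hx).trans (le_abs_self _))
    · rw [indicator_of_notMem hx, abs_zero]
      exact abs_nonneg _
  · by_cases hx : g x = 0
    · simp [indicator, hx]
    · obtain ⟨i, hi⟩ := mem_iUnion.1 (hcov hx)
      have h1 : N x ≠ 0 := (zero_lt_one.trans_le (hN1 i x hi)).ne'
      calc ∑ i, (D i).indicator (fun x => g x / N x) x
          = ∑ i, (D i).indicator (1 : X → ℝ) x * (g x / N x) := by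
            refine Finset.sum_congr rfl fun i _ => ?_
            by_cases hxi : x ∈ D i <;> simp [hxi]
        _ = N x * (g x / N x) := by rw [← Finset.sum_mul]
        _ = g x := mul_div_cancel₀ _ h1

/-- The root pieces carry masses μ_j with sum zero. Moving each μ_j back to the common index a along
its chain leaves mean zero everywhere, and |μ_j|^q is bounded by the weighted norm of g. -/
theorem exists_glued_decomposition {ι : Type} [Fintype ι] (hΩ : IsOpen Ω)
    (hb : Bornology.IsBounded Ω) (hne : (frontier Ω).Nonempty) {p q α β : ℝ}
    (hqp : q.HolderConjugate p) {Γ : ι → Type} [∀ i, Countable (Γ i)] {r : ∀ i, Γ i}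
    {U : ∀ i, Γ i → Set (EuclideanSpace ℝ (Fin n))} {D : ι → Set (EuclideanSpace ℝ (Fin n))}
    {C : ι → ℝ≥0} (H : ∀ i, IsLocalDecomposition Ω p q α β (r i) (U i) (D i) (C i))
    (hD : Ω ⊆ ⋃ i, D i) {a : ι}
    (hchain : ∀ j, Relation.ReflTransGen (fun i j => (U i (r i) ∩ U j (r j)).Nonempty) a j) :
    ∃ C' : ℝ≥0, ∀ g : EuclideanSpace ℝ (Fin n) → ℝ,
      MemWeightedLp Ω q (fun x => boundaryDist Ω x ^ (-β * q)) g → ∫ x in Ω, g x = 0 →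
      ∃ G : (Σ i, Γ i) → EuclideanSpace ℝ (Fin n) → ℝ,
        IsConstOrthogonalDecomposition Ω (fun t : Σ i, Γ i => U t.1 t.2) g G ∧
        ∑' t : Σ i, Γ i, weightedEnergy (U t.1 t.2) q
          (fun x => boundaryDist Ω x ^ ((1 - α - β) * q)) (G t) ≤
          C' * weightedEnergy Ω q (fun x => boundaryDist Ω x ^ (-β * q)) g := by
  classical
  have hq0 := hqp.pos
  have hq1 : 1 ≤ q := hqp.lt.le
  have hd := measurable_boundaryDist (Ω := Ω)
  set w : EuclideanSpace ℝ (Fin n) → ℝ≥0∞ := fun x => ENNReal.ofReal (boundaryDist Ω x ^ (-β * q))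
    with hw
  set w' : EuclideanSpace ℝ (Fin n) → ℝ≥0∞ :=
    fun x => ENNReal.ofReal (boundaryDist Ω x ^ ((1 - α - β) * q)) with hw'
  have hwm : Measurable w := by fun_prop
  have hwm' : Measurable w' := by fun_prop
  -- c j k is the share of the k-th root set in the transfer of unit mass from a to j; these
  -- functions depend only on the covering, not on g.
  choose c c1 c2 c3 c4 c5 c6 using fun j =>
    exists_transfer (V := fun i => U i (r i)) (fun i => (H i).isOpen (r i)) (hchain j)
  -- constants
  set W : ℝ≥0∞ := ∫⁻ x in Ω, ENNReal.ofReal (boundaryDist Ω x ^ (β * p)) with hW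
  have hWtop : W < ⊤ := by
    calc W ≤ ∫⁻ x in ⋃ i, D i, ENNReal.ofReal (boundaryDist Ω x ^ (β * p)) :=
          lintegral_mono_set hD
      _ ≤ ∑' i, ∫⁻ x in D i, ENNReal.ofReal (boundaryDist Ω x ^ (β * p)) := lintegral_iUnion_le _ _
      _ < ⊤ := by
          rw [tsum_fintype]
          exact ENNReal.sum_lt_top.2 fun i _ => (H i).weight
  set κ : ι → ι → ℝ≥0∞ := fun j k => ∫⁻ x, ‖c j k x‖ₑ ^ q * w' x with hκ
  have hκtop : ∀ j k, κ j k < ⊤ := fun j k => by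
    obtain ⟨M, hM⟩ := c3 j k
    exact lintegral_enorm_rpow_mul_lt_top hb ((H k).subset _) ((H k).away _) hq0 _ (c4 j k) hM
  set A : ℝ≥0∞ := (Fintype.card ι : ℝ≥0∞) ^ (q - 1) with hA
  have hAtop : A < ⊤ := ENNReal.rpow_lt_top_of_nonneg (by linarith) (ENNReal.natCast_ne_top _)
  set B : ℝ≥0∞ := 2 ^ (q - 1) with hB
  have hBtop : B < ⊤ := ENNReal.rpow_lt_top_of_nonneg (by linarith) ENNReal.ofNat_ne_top
  set W' : ℝ≥0∞ := W ^ (q / p) with hW'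
  have hWtop' : W' < ⊤ :=
    ENNReal.rpow_lt_top_of_nonneg (div_nonneg hqp.nonneg hqp.symm.nonneg) hWtop.ne
  set K : ℝ≥0∞ := ∑ i, B * (C i + A * ∑ j, W' * κ j i) with hK
  have hKtop : K < ⊤ := ENNReal.sum_lt_top.2 fun i _ => ENNReal.mul_lt_top hBtop
    (ENNReal.add_lt_top.2 ⟨ENNReal.coe_lt_top, ENNReal.mul_lt_top hAtop
      (ENNReal.sum_lt_top.2 fun j _ => ENNReal.mul_lt_top hWtop' (hκtop j i))⟩)
  refine ⟨K.toNNReal, fun g ⟨hgm, hgE⟩ hg0 => ?_⟩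
  rw [ENNReal.coe_toNNReal hKtop.ne]
  -- a measurable representative vanishing off the domain
  set f : EuclideanSpace ℝ (Fin n) → ℝ := Ω.indicator (hgm.mk g) with hf
  have hfm : Measurable f := hgm.measurable_mk.indicator hΩ.measurableSet
  have hfg : ∀ᵐ x ∂(volume.restrict Ω), g x = f x := by
    filter_upwards [hgm.ae_eq_mk, ae_restrict_mem hΩ.measurableSet] with x hx hxΩ
    rw [hf, indicator_of_mem hxΩ, hx]
  have hfsupp : Function.support f ⊆ Ω := support_indicator_subset
  set E : ℝ≥0∞ := ∫⁻ x in Ω, ‖f x‖ₑ ^ q * w x with hE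
  have hEg : weightedEnergy Ω q (fun x => boundaryDist Ω x ^ (-β * q)) g = E := by
    refine lintegral_congr_ae ?_
    filter_upwards [hfg] with x hx
    rw [ofReal_abs_rpow_mul _ _ hq0.le, hx]
  rw [hEg] at hgE ⊢
  have hf1 : ∫⁻ x in Ω, ‖f x‖ₑ ≤ E ^ (1 / q) * W ^ (1 / p) :=
    lintegral_enorm_le_of_weight hΩ hne hqp hfm
  have hfi : Integrable f := by
    rw [← integrableOn_iff_integrable_of_support_subset hfsupp]
    refine ⟨hfm.aestronglyMeasurable, hf1.trans_lt (ENNReal.mul_lt_top ?_ ?_)⟩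
    · exact ENNReal.rpow_lt_top_of_nonneg (by positivity) hgE.ne
    · exact ENNReal.rpow_lt_top_of_nonneg (one_div_nonneg.2 hqp.symm.nonneg) hWtop.ne
  have hf0 : ∫ x, f x = 0 := by
    rw [← setIntegral_eq_integral_of_forall_compl_eq_zero (s := Ω) fun x hx => indicator_of_notMem hx _,
      ← hg0]
    exact (integral_congr_ae hfg).symm
  obtain ⟨h, h1, h2, h3, h4⟩ := exists_split_of_cover (fun i => (H i).measurable) hfm (hfsupp.trans hD)
  have h3' : ∀ i x, ‖h i x‖ₑ ≤ ‖f x‖ₑ := fun i x => by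
    rw [Real.enorm_eq_ofReal_abs, Real.enorm_eq_ofReal_abs]
    exact ENNReal.ofReal_le_ofReal (h3 i x)
  have hhi : ∀ i, Integrable (h i) := fun i =>
    hfi.mono (h1 i).aestronglyMeasurable (Filter.Eventually.of_forall (h3 i))
  have hhE : ∀ i, ∫⁻ x in D i, ‖h i x‖ₑ ^ q * w x ≤ E := fun i =>
    (lintegral_mono fun x => mul_le_mul_left (ENNReal.rpow_le_rpow (h3' i x) hq0.le) _).trans
      (lintegral_mono_set (H i).region_subset)
  choose F F1 F2 F3 F4 F5 F6 using fun i => (H i).decomp (h i) (h1 i) (h2 i) (hhi i)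
    ((hhE i).trans_lt hgE)
  set μ : ι → ℝ := fun j => ∫ x, h j x with hμ
  have hμ0 : ∑ j, μ j = 0 := by
    rw [← integral_finsetSum _ fun i _ => hhi i, ← hf0]
    exact integral_congr_ae (Filter.Eventually.of_forall h4)
  have hμE : ∀ j, ‖μ j‖ₑ ^ q ≤ E * W' := fun j => by
    have e1 : ‖μ j‖ₑ ≤ E ^ (1 / q) * W ^ (1 / p) := by
      refine (enorm_integral_le_lintegral_enorm _).trans (le_trans ?_ hf1)
      rw [setLIntegral_eq_of_support_subset]
      · exact lintegral_mono (h3' j)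
      · exact fun x hx => hfsupp (by simpa using hx)
    calc _ ≤ (E ^ (1 / q) * W ^ (1 / p)) ^ q := ENNReal.rpow_le_rpow e1 hq0.le
      _ = E * W' := by
          rw [ENNReal.mul_rpow_of_nonneg _ _ hq0.le, ← ENNReal.rpow_mul, ← ENNReal.rpow_mul,
            one_div_mul_cancel hq0.ne', ENNReal.rpow_one, one_div_mul_eq_div]
  set T : ι → EuclideanSpace ℝ (Fin n) → ℝ := fun k x => ∑ j, μ j * c j k x with hT
  have hTm : ∀ k, Measurable (T k) := fun k =>
    Finset.measurable_sum _ fun j _ => (c1 j k).const_mul _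
  have hTi : ∀ k, Integrable (T k) := fun k =>
    integrable_finsetSum _ fun j _ => (c2 j k).const_mul _
  have hTE : ∀ k, ∫⁻ x, ‖T k x‖ₑ ^ q * w' x ≤ A * (∑ j, W' * κ j k) * E := fun k => by
    refine (lintegral_enorm_rpow_sum_le hq1 (fun j => c1 j k) μ hwm').trans ?_
    rw [mul_assoc, Finset.sum_mul]
    refine mul_le_mul_right (Finset.sum_le_sum fun j _ => ?_) _
    refine (mul_le_mul_left (hμE j) _).trans_eq ?_
    simp only [hκ]
    ring
  -- At k = a there is an additional term -∑ μ_j, which vanishes because g has mean zero; this is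
  -- the only place where the total mass matters.
  have hTint : ∀ k, ∫ x, T k x = μ k := fun k => by
    rw [integral_finsetSum _ fun j _ => (c2 j k).const_mul _]
    simp only [integral_const_mul, c6, mul_sub, Finset.sum_sub_distrib, ← Finset.sum_mul, hμ0,
      zero_mul, sub_zero]
    simp
  have hTsum : ∀ x, ∑ k, T k x = 0 := fun x => by
    simp only [hT]
    rw [Finset.sum_comm]
    simp [← Finset.mul_sum, c5]
  -- Only the root pieces are corrected. Their integrals become μ_k - μ_k = 0, and the corrections
  -- add up to zero, so the sum of all pieces is still f.
  set G : (Σ i, Γ i) → EuclideanSpace ℝ (Fin n) → ℝ := fun t x =>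
    F t.1 t.2 x - if t.2 = r t.1 then T t.1 x else 0 with hG
  have hGsupp : ∀ t, Function.support (G t) ⊆ U t.1 t.2 := by
    rintro ⟨i, t⟩ x hx
    by_contra hxU
    have e1 : F i t x = 0 := by
      by_contra e
      exact hxU (F2 i t e)
    refine hx ?_
    simp only [hG, e1, zero_sub, neg_eq_zero, ite_eq_right_iff]
    rintro rfl
    refine Finset.sum_eq_zero fun j _ => ?_
    have : c j i x = 0 := by
      by_contra e
      exact hxU (c4 j i e)
    rw [this, mul_zero]
  have hFi : ∀ i t, Integrable (F i t) := fun i t =>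
    integrable_of_support_subset hb ((H i).subset t) ((H i).away t) hq1 ((1 - α - β) * q) (F1 i t)
      (F2 i t) (((ENNReal.le_tsum t).trans (F5 i)).trans_lt
        (ENNReal.mul_lt_top ENNReal.coe_lt_top ((hhE i).trans_lt hgE)))
  have hGi : ∀ t, Integrable (G t) := by
    rintro ⟨i, t⟩
    refine (hFi i t).sub ?_
    by_cases ht : t = r i
    · simpa [ht] using hTi i
    · simp [ht]
  refine ⟨G, ⟨?_, hg0, fun t => (hGi t).integrableOn, ?_, hGsupp, ?_⟩, ?_⟩
  · exact hfi.integrableOn.congr (by filter_upwards [hfg] with x hx using hx.symm)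
  · filter_upwards [hfg, ae_restrict_of_ae (ae_all_iff.2 F3)] with x hx hF
    have e1 := hasSum_sigma_of_fintype (f := fun t => G t x) (a := fun i => h i x - T i x)
      fun i => (hF i).sub (hasSum_ite_eq (r i) (T i x))
    rwa [Finset.sum_sub_distrib, h4, hTsum, sub_zero, ← hx] at e1
  · rintro ⟨i, t⟩
    rw [setIntegral_eq_integral_of_forall_compl_eq_zero fun x hx => by
      by_contra e
      exact hx (hGsupp ⟨i, t⟩ e)]
    by_cases ht : t = r i
    · subst ht
      simp only [hG, if_true]
      rw [integral_sub (hFi _ _) (hTi i), F6, hTint, sub_self]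
    · simp only [hG, if_neg ht, sub_zero]
      exact F4 i t ht
  · have e1 : ∀ t : Σ i, Γ i, weightedEnergy (U t.1 t.2) q
        (fun x => boundaryDist Ω x ^ ((1 - α - β) * q)) (G t) ≤
        B * ((∫⁻ x, ‖F t.1 t.2 x‖ₑ ^ q * w' x) +
          if t.2 = r t.1 then ∫⁻ x, ‖T t.1 x‖ₑ ^ q * w' x else 0) := by
      rintro ⟨i, t⟩
      simp only [weightedEnergy, ofReal_abs_rpow_mul _ _ hq0.le]
      refine (setLIntegral_le_lintegral _ _).trans ?_
      have e2 : ∀ x, ‖G ⟨i, t⟩ x‖ₑ ^ q * w' x ≤ B * (‖F i t x‖ₑ ^ q * w' x +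
          if t = r i then ‖T i x‖ₑ ^ q * w' x else 0) := fun x => by
        have e3 : (if t = r i then ‖T i x‖ₑ ^ q * w' x else 0) =
            ‖if t = r i then T i x else 0‖ₑ ^ q * w' x := by
          split_ifs <;> simp [hq0]
        rw [e3, ← add_mul, ← mul_assoc]
        refine mul_le_mul_left ?_ _
        exact (ENNReal.rpow_le_rpow enorm_sub_le hq0.le).trans
          (ENNReal.rpow_add_le_mul_rpow_add_rpow _ _ hq1)
      refine (lintegral_mono e2).trans ?_
      have := F1 i t
      rw [lintegral_const_mul' _ _ hBtop.ne, lintegral_add_left (by fun_prop)]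
      split_ifs <;> simp
    calc _ ≤ ∑' t : Σ i, Γ i, B * ((∫⁻ x, ‖F t.1 t.2 x‖ₑ ^ q * w' x) +
          if t.2 = r t.1 then ∫⁻ x, ‖T t.1 x‖ₑ ^ q * w' x else 0) := ENNReal.tsum_le_tsum e1
      _ = ∑ i, B * ((∑' t, ∫⁻ x, ‖F i t x‖ₑ ^ q * w' x) + ∫⁻ x, ‖T i x‖ₑ ^ q * w' x) := by
          rw [ENNReal.tsum_sigma', tsum_fintype]
          refine Finset.sum_congr rfl fun i _ => ?_
          rw [ENNReal.tsum_mul_left, ENNReal.tsum_add]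
          congr 2
          exact tsum_ite_eq (r i) _
      _ ≤ ∑ i, B * (C i + A * ∑ j, W' * κ j i) * E := by
          refine Finset.sum_le_sum fun i _ => ?_
          rw [mul_assoc, add_mul]
          refine mul_le_mul_right (add_le_add ((F5 i).trans ?_) (hTE i)) _
          exact mul_le_mul_right (hhE i) _
      _ = K * E := by rw [hK, Finset.sum_mul]

end

/-! ### The covering -/

section

variable {n : ℕ} {Ω : Set (EuclideanSpace ℝ (Fin n))}

/-- A set at distance at least δ from the boundary can only meet sets that contain a point at such a
distance, and each of the finitely many local families has finitely many of these. -/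
theorem isOpenCovering_of_isLocalDecomposition {ι : Type} [Finite ι] {p q α β : ℝ} {Γ : ι → Type}
    {r : ∀ i, Γ i} {U : ∀ i, Γ i → Set (EuclideanSpace ℝ (Fin n))}
    {D : ι → Set (EuclideanSpace ℝ (Fin n))} {C : ι → ℝ≥0}
    (H : ∀ i, IsLocalDecomposition Ω p q α β (r i) (U i) (D i) (C i)) (hD : Ω ⊆ ⋃ i, D i) :
    IsOpenCovering Ω fun t : Σ i, Γ i => U t.1 t.2 where
  isOpen t := (H t.1).isOpen t.2
  subset t := (H t.1).subset t.2
  null := by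
    refine measure_mono_null ?_ (measure_iUnion_null fun i => (H i).null)
    rintro x ⟨hx, hxU⟩
    obtain ⟨i, hi⟩ := mem_iUnion.1 (hD hx)
    refine mem_iUnion.2 ⟨i, hi, fun h => hxU ?_⟩
    obtain ⟨t, ht⟩ := mem_iUnion.1 h
    exact mem_iUnion.2 ⟨⟨i, t⟩, ht⟩
  finite_inter t := by
    obtain ⟨δ, hδ, h⟩ := (H t.1).away t.2
    refine (finite_iUnion fun i => ((H i).finite δ hδ).image (Sigma.mk i)).subset ?_
    rintro ⟨i, s⟩ ⟨x, hx, hx'⟩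
    exact mem_iUnion.2 ⟨i, s, ⟨x, hx', h x hx⟩, rfl⟩

/-- A cover by sets at a positive distance from the boundary is infinite. -/
theorem IsOpenCovering.infinite {Γ : Type} {U : Γ → Set (EuclideanSpace ℝ (Fin n))}
    (h : IsOpenCovering Ω U) (hΩ : IsOpen Ω) (hne : (frontier Ω).Nonempty)
    (haway : ∀ t, ∃ δ : ℝ, 0 < δ ∧ ∀ x ∈ U t, δ ≤ boundaryDist Ω x) : Infinite Γ := by
  refine not_finite_iff_infinite.1 fun hfin => ?_
  choose δ hδ hU using haway
  obtain ⟨δ₀, h0, h1⟩ : ∃ δ₀ : ℝ, 0 < δ₀ ∧ ∀ t, δ₀ ≤ δ t := by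
    rcases isEmpty_or_nonempty Γ with hΓ | hΓ
    · exact ⟨1, one_pos, fun t => hΓ.elim t⟩
    · obtain ⟨t, ht⟩ := Finite.exists_min δ
      exact ⟨δ t, hδ t, ht⟩
  obtain ⟨w, hw⟩ := hne
  -- Finitely many sets would stay a common distance δ₀ away from the boundary and miss this open
  -- nonempty subset of Ω, which has positive measure.
  have h2 : (Metric.ball w δ₀ ∩ Ω).Nonempty :=
    mem_closure_iff.1 (frontier_subset_closure hw) _ Metric.isOpen_ball (Metric.mem_ball_self h0)
  refine ((Metric.isOpen_ball.inter hΩ).measure_pos volume h2).ne' (measure_mono_null ?_ h.null)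
  rintro x ⟨hx, hxΩ⟩
  refine ⟨hxΩ, fun h3 => ?_⟩
  obtain ⟨t, ht⟩ := mem_iUnion.1 h3
  have h4 : boundaryDist Ω x ≤ dist x w := Metric.infDist_le_dist_of_mem hw
  have h5 := (h1 t).trans (hU t x ht)
  rw [Metric.mem_ball] at hx
  linarith

end

/-! ### The finite family of patches, ball and linking cubes -/

namespace IsBoundedHolderDomain

variable {m : ℕ} {α : ℝ} {Ω : Set (EuclideanSpace ℝ (Fin (m + 1)))}

theorem frontier_nonempty (hΩ : IsBoundedHolderDomain α Ω) : (frontier Ω).Nonempty := by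
  refine nonempty_frontier_iff.2 ⟨hΩ.isConnected.nonempty, fun h => ?_⟩
  exact NormedSpace.unbounded_univ ℝ (EuclideanSpace ℝ (Fin (m + 1))) (h ▸ hΩ.isBounded)

/-- A finite family of local decompositions: boundary patches, a ball, and small cubes that connect
the root sets of the patches with the ball. -/
theorem exists_finite_family (hΩ : IsBoundedHolderDomain α Ω) {p q β : ℝ}
    (hqp : q.HolderConjugate p) (hα : 0 < α) (hα1 : α ≤ 1) (hβ : -α < β * p) :
    ∃ (ι : Type) (_ : Fintype ι) (a : ι) (Γ : ι → Type) (_ : ∀ i, Countable (Γ i)) (r : ∀ i, Γ i)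
      (U : ∀ i, Γ i → Set (EuclideanSpace ℝ (Fin (m + 1))))
      (D : ι → Set (EuclideanSpace ℝ (Fin (m + 1)))) (C : ι → ℝ≥0),
      (∀ i, IsLocalDecomposition Ω p q α β (r i) (U i) (D i) (C i)) ∧ Ω ⊆ ⋃ i, D i ∧
      (∀ j, Relation.ReflTransGen (fun i j => (U i (r i) ∩ U j (r j)).Nonempty) a j) ∧
      IsBoundedSmoothDomain (U a (r a)) ∧ Subsingleton (Γ a) ∧
      ∀ i, i ≠ a → ∀ t, IsOpenCube (U i t) ∨ IsExtendedOpenCube (U i t) := by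
  classical
  have hne := hΩ.frontier_nonempty
  have hb := hΩ.isBounded
  have ho := hΩ.isOpen
  -- boundary patches
  have hpatch : ∀ x : frontier Ω, ∃ (N D : Set (EuclideanSpace ℝ (Fin (m + 1)))) (Γ : Type)
      (_ : Countable Γ) (r : Γ) (U : Γ → Set (EuclideanSpace ℝ (Fin (m + 1)))) (C : ℝ≥0),
      IsOpen N ∧ x.1 ∈ N ∧ N ∩ Ω ⊆ D ∧ IsLocalDecomposition Ω p q α β r U D C ∧
        ∀ t, IsOpenCube (U t) ∨ IsExtendedOpenCube (U t) := by
    rintro ⟨x, hx⟩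
    obtain ⟨Ψ, φ, K, L, h, H, hΨ⟩ := exists_isBoundaryChart hα hΩ hx
    obtain ⟨N, h1, h2, h3⟩ := H.exists_nhds_subset_patch hΨ
    obtain ⟨Γ, h4, r, U, C, h5, h6⟩ := H.exists_isLocalDecomposition ho hb hne hqp hα hα1 hβ
    exact ⟨N, _, Γ, h4, r, U, C, h1, h2, h3, h5, h6⟩
  choose N D₁ Γ₁ hΓ₁ r₁ U₁ C₁ hNo hNm hND H₁ hcube₁ using hpatch
  have hcpt : IsCompact (closure Ω) := hb.isCompact_closure
  obtain ⟨P, hP⟩ := (hcpt.of_isClosed_subset isClosed_frontier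
    frontier_subset_closure).elim_finite_subcover N hNo fun x hx => mem_iUnion.2 ⟨⟨x, hx⟩, hNm _⟩
  -- interior sets
  obtain ⟨x₀, hx₀⟩ := hΩ.isConnected.nonempty
  -- One interior set per point: a ball at the base point x₀, which becomes the smooth domain, and
  -- cubes elsewhere. Outside Ω nothing is required.
  have hint : ∀ x, ∃ V : Set (EuclideanSpace ℝ (Fin (m + 1))), x ∈ Ω →
      IsOpen V ∧ x ∈ V ∧ V ⊆ Ω ∧ (∃ δ : ℝ, 0 < δ ∧ ∀ y ∈ V, δ ≤ boundaryDist Ω y) ∧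
        (x = x₀ → IsBoundedSmoothDomain V) ∧ (x ≠ x₀ → IsOpenCube V) := by
    intro x
    by_cases hx : x ∈ Ω
    · by_cases h0 : x = x₀
      · obtain ⟨ε, hε, h1, h2⟩ := exists_ball_away ho hne hx
        exact ⟨Metric.ball x ε, fun _ => ⟨Metric.isOpen_ball, Metric.mem_ball_self hε, h1, ⟨ε, hε, h2⟩,
          fun _ => isBoundedSmoothDomain_ball x hε, fun h => (h h0).elim⟩⟩
      · obtain ⟨V, h1, h2, h3, h4, h5⟩ := exists_isOpenCube_away ho hne hx
        exact ⟨V, fun _ => ⟨h2, h3, h4, h5, fun h => (h0 h).elim, fun _ => h1⟩⟩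
    · exact ⟨∅, fun h => (hx h).elim⟩
  choose V hV using hint
  have hinner : closure Ω \ ⋃ i ∈ P, N i ⊆ Ω := fun x ⟨hx, hx'⟩ => by
    by_contra h
    exact hx' (hP (by rw [ho.frontier_eq]; exact ⟨hx, h⟩))
  -- What the boundary neighbourhoods leave of the closure is a compact subset of Ω.
  obtain ⟨S₀, hS₀, hcov⟩ := (hcpt.diff (isOpen_biUnion fun i (_ : i ∈ P) => hNo i)).elim_nhds_subcover V
    fun x hx => (hV x (hinner hx)).1.mem_nhds (hV x (hinner hx)).2.1
  -- chains
  have hchain : ∀ x : Ω, ∃ S : Finset (EuclideanSpace ℝ (Fin (m + 1))), x₀ ∈ S ∧ x.1 ∈ S ∧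
      (∀ z ∈ S, z ∈ Ω) ∧
      ∀ z ∈ S, Relation.ReflTransGen (fun a b => a ∈ S ∧ b ∈ S ∧ (V a ∩ V b).Nonempty) x₀ z := by
    rintro ⟨x, hx⟩
    obtain ⟨S, h1, h2, h3, h4⟩ := exists_finset_reflTransGen
      (hΩ.isConnected.isPreconnected.reflTransGen_inter_nonempty (V := V) (fun x hx => (hV x hx).1)
        (fun x hx => (hV x hx).2.1) hx₀ hx)
    refine ⟨S, h1, h2, fun z hz => ?_, fun z hz => ?_⟩
    · cases h3 z hz with
      | refl => exact hx₀
      | tail _ h => exact h.2.1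
    · exact Relation.ReflTransGen.mono (fun u v h => ⟨h.1, h.2.1, h.2.2.2.2⟩) _ _ (h4 z hz)
  choose S hSx₀ hSx hSΩ hSchain using hchain
  choose y hy using fun i => (H₁ i).nonempty
  have hyΩ : ∀ i, y i ∈ Ω := fun i => (H₁ i).subset _ (hy i)
  -- The points to be joined to x₀: x₀ itself, the centres of the interior cover, and a point of the
  -- root box of each patch. All vertices of their chains enter the family.
  set T : Finset Ω := {⟨x₀, hx₀⟩} ∪ (S₀.attach.image fun s => ⟨s.1, hinner (hS₀ s.1 s.2)⟩) ∪
    P.image fun i => ⟨y i, hyΩ i⟩ with hT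
  set S' : Finset (EuclideanSpace ℝ (Fin (m + 1))) := T.biUnion S with hS'
  have hSS' : ∀ x ∈ T, S x ⊆ S' := fun x hx => Finset.subset_biUnion_of_mem S hx
  have hS'Ω : ∀ z ∈ S', z ∈ Ω := fun z hz => by
    obtain ⟨x, -, hx⟩ := Finset.mem_biUnion.1 hz
    exact hSΩ x z hx
  have hx₀S' : x₀ ∈ S' := hSS' ⟨x₀, hx₀⟩ (by simp [hT]) (hSx₀ _)
  have hyS' : ∀ i ∈ P, y i ∈ S' := fun i hi => by
    refine hSS' ⟨y i, hyΩ i⟩ ?_ (hSx ⟨y i, hyΩ i⟩)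
    exact Finset.mem_union_right _ (Finset.mem_image_of_mem _ hi)
  have hS₀S' : ∀ z ∈ S₀, z ∈ S' := fun z hz => by
    refine hSS' ⟨z, hinner (hS₀ z hz)⟩ ?_ (hSx ⟨z, hinner (hS₀ z hz)⟩)
    exact Finset.mem_union_left _ (Finset.mem_union_right _
      (Finset.mem_image.2 ⟨⟨z, hz⟩, Finset.mem_attach _ _, rfl⟩))
  -- the family
  set a : P ⊕ S' := Sum.inr ⟨x₀, hx₀S'⟩ with ha
  -- The root sets are fixed before the index types are chosen, so that the chain condition can be
  -- stated and proved for them alone.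
  set R : P ⊕ S' → Set (EuclideanSpace ℝ (Fin (m + 1))) :=
    Sum.elim (fun i => U₁ i (r₁ i)) (fun z => V z) with hR
  set D : P ⊕ S' → Set (EuclideanSpace ℝ (Fin (m + 1))) :=
    Sum.elim (fun i => D₁ i) (fun z => V z) with hD
  have hfam : ∀ i : P ⊕ S', ∃ (Γ : Type) (_ : Countable Γ) (r : Γ)
      (U : Γ → Set (EuclideanSpace ℝ (Fin (m + 1)))) (C : ℝ≥0),
      IsLocalDecomposition Ω p q α β r U (D i) C ∧ U r = R i ∧ (i = a → Subsingleton Γ) ∧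
        (i ≠ a → ∀ t, IsOpenCube (U t) ∨ IsExtendedOpenCube (U t)) := by
    rintro (i | ⟨z, hz⟩)
    · exact ⟨Γ₁ i, hΓ₁ i, r₁ i, U₁ i, C₁ i, H₁ i, rfl, fun h => (Sum.inl_ne_inr h).elim,
        fun _ => hcube₁ i⟩
    · obtain ⟨h1, h2, h3, h4, -, h5⟩ := hV z (hS'Ω z hz)
      obtain ⟨C, hC⟩ := isLocalDecomposition_of_away hb h1 ⟨z, h2⟩ h3 h4 (p := p) β hqp.pos hα1
      refine ⟨Unit, inferInstance, (), fun _ => V z, C, hC, rfl, fun _ => inferInstance,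
        fun h _ => Or.inl (h5 fun h6 => h ?_)⟩
      subst h6
      rfl
  choose Γ hΓ r U C H hUR hsub hcube using hfam
  have hchainR : ∀ z (hz : z ∈ S'), Relation.ReflTransGen (fun i j => (R i ∩ R j).Nonempty) a
      (Sum.inr ⟨z, hz⟩) := fun z hz => by
    obtain ⟨x, hx, hzx⟩ := Finset.mem_biUnion.1 hz
    have h1 := hSchain x z hzx
    clear hzx
    induction h1 with
    | refl => exact Relation.ReflTransGen.refl
    | tail _ h2 ih => exact (ih (hSS' x hx h2.1)).tail h2.2.2
  refine ⟨P ⊕ S', inferInstance, a, Γ, hΓ, r, U, D, C, H, fun x hx => ?_, fun j => ?_, ?_, hsub a rfl,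
    hcube⟩
  · by_cases h1 : x ∈ ⋃ i ∈ P, N i
    · obtain ⟨i, hi, hxi⟩ := mem_iUnion₂.1 h1
      exact mem_iUnion.2 ⟨Sum.inl ⟨i, hi⟩, hND i ⟨hxi, hx⟩⟩
    · obtain ⟨z, hz, hxz⟩ := mem_iUnion₂.1 (hcov ⟨subset_closure hx, h1⟩)
      exact mem_iUnion.2 ⟨Sum.inr ⟨z, hS₀S' z hz⟩, hxz⟩
  · simp only [hUR]
    rcases j with ⟨i, hi⟩ | ⟨z, hz⟩
    · exact (hchainR _ (hyS' i hi)).tail ⟨y i, (hV _ (hyΩ i)).2.1, hy i⟩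
    · exact hchainR z hz
  · rw [hUR]
    exact (hV x₀ hx₀).2.2.2.2.1 rfl

end IsBoundedHolderDomain

theorem mainTheorem2 (n : ℕ) (hn : 2 ≤ n) (α β p q : ℝ) (hα : 0 < α) (hα1 : α ≤ 1)
    (hp : 1 < p) (hq : 1 < q) (hpq : 1 / p + 1 / q = 1) (hβ : -α < β * p)
    (Ω : Set (EuclideanSpace ℝ (Fin n))) (hΩ : IsBoundedHolderDomain α Ω) :
    ∃ (Γ : Type) (_ : Countable Γ) (_ : Infinite Γ) (a : Γ)
      (U : Γ → Set (EuclideanSpace ℝ (Fin n))) (C : ℝ≥0),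
      IsOpenCovering Ω U ∧
      IsBoundedSmoothDomain (U a) ∧ (∃ δ : ℝ, 0 < δ ∧ ∀ x ∈ U a, δ ≤ boundaryDist Ω x) ∧
      (∀ t, t ≠ a → IsOpenCube (U t) ∨ IsExtendedOpenCube (U t)) ∧
      ∀ g : EuclideanSpace ℝ (Fin n) → ℝ,
        MemWeightedLp Ω q (fun x => boundaryDist Ω x ^ (-β * q)) g → ∫ x in Ω, g x = 0 →
        ∃ G : Γ → EuclideanSpace ℝ (Fin n) → ℝ,
          IsConstOrthogonalDecomposition Ω U g G ∧
          ∑' t, weightedEnergy (U t) q (fun x => boundaryDist Ω x ^ ((1 - α - β) * q)) (G t) ≤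
            C * weightedEnergy Ω q (fun x => boundaryDist Ω x ^ (-β * q)) g := by
  obtain ⟨m, rfl⟩ : ∃ m, n = m + 1 := ⟨n - 1, by omega⟩
  have hqp : q.HolderConjugate p :=
    Real.holderConjugate_iff.2 ⟨hq, by rw [← hpq, one_div, one_div, add_comm]⟩
  have hne := hΩ.frontier_nonempty
  obtain ⟨ι, _, a, Γ, _, r, U, D, C, H, hD, hchain, hsmooth, hsub, hcube⟩ :=
    hΩ.exists_finite_family hqp hα hα1 hβ
  obtain ⟨C', hC'⟩ := exists_glued_decomposition hΩ.isOpen hΩ.isBounded hne hqp H hD hchain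
  have hcov := isOpenCovering_of_isLocalDecomposition H hD
  refine ⟨Σ i, Γ i, inferInstance,
    hcov.infinite hΩ.isOpen hne fun t => (H t.1).away t.2, ⟨a, r a⟩, fun t => U t.1 t.2, C', hcov,
    hsmooth, (H a).away (r a), fun t ht => ?_, hC'⟩
  -- The local family of the ball has a single member, so every index other than ⟨a, r a⟩ belongs to
  -- another local family.
  refine hcube t.1 (fun h => ht ?_) t.2
  obtain ⟨i, s⟩ := t
  obtain rfl : i = a := h
  exact congrArg (Sigma.mk i) (Subsingleton.elim _ _)
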